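/- Let $T>0$, $\bar a<\bar b$, $\sigma>0$, $r\ge 0$ and $\lambda=\frac12\left(\frac{\sigma}{2}+\frac{r}{\sigma}\right)^2$. Let $\alpha\in W^{1,\infty}(0,T)$ satisfy $0<\alpha(t)\le\alpha^*<1$ on $[0,T]$ and $\alpha'(0)=0$, and put $\alpha_0=\alpha(0)$, $$\beta_{\alpha_0}(t)=\frac{t^{\alpha_0-1}}{\Gamma(\alpha_0)},\qquad k(t)=\frac{t^{-\alpha(t)}}{\Gamma(1-\alpha(t))},\qquad q=\beta_{\alpha_0}*k,\qquad (g_1*g_2)(t)=\int_0^t g_1(t-s)g_2(s)\,\mathrm ds .$$ Write $(\cdot,\cdot)$ and $\|\cdot\|$ for the inner product and norm of $L^2(\bar a,\bar b)$. Let $F:[0,T]\to L^2(\bar a,\bar b)$, and let $\omega:[0,T]\to H^2(\bar a,\bar b)$ satisfy $$\omega+q'*\omega-\tfrac12\sigma^2\,\beta_{\alpha_0}*\partial_x^2\omega+\lambda\,\beta_{\alpha_0}*\omega=F\quad\text{in }L^2(\bar a,\bar b)\text{ for }0<t\le T,$$ $$\omega(\bar a,t)=\omega(\bar b,t)=0,\qquad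 \omega(x,0)=0,$$ and, for a constant $K>0$, the regularity assumption $$t\,\|\partial_t^2\omega(t)\|_{H^{2m}}+\|\partial_t\omega(t)\|_{H^{2m}}\le K\,t^{\alpha_0-1}\quad\text{for a.e. }t\in(0,T],\ m=0,1,$$ where $\omega$ is absolutely continuous on $[0,T]$ and $\partial_t\omega$ is locally absolutely continuous on $(0,T]$, both with values in $H^2(\bar a,\bar b)$. Let $N\ge 1$, $\tau=T/N$, $t_n=n\tau$, $\omega^n=\omega(t_n)$, $F^n=F(t_n)$, and for $1\le j\le n\le N$ $$\varpi_{n,j}=\frac1\tau\int_{t_{n-1}}^{t_n}\int_{t_{j-1}}^{\min(t,t_j)}q'(t-s)\,\mathrm ds\,\mathrm dt,\qquad \widetilde\varpi_{n,j}=\frac1\tau\int_{t_{n-1}}^{t_n}\int_{t_{j-1}}^{\min(t,t_j)}\beta_{\alpha_0}(t-s)\,\mathrm ds\,\mathrm dt .$$ Let $\bar a=x_0<\dots<x_M=\bar b$ be a partition with mesh diameter $h=\max_i(x_{i+1}-x_i)$, quasi-uniform with constant $\rho\ge 1$, i.e. $h\le\rho\,(x_{i+1}-x_i)$ for all $i$,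 and let $S_h\subset H_0^1(\bar a,\bar b)$ be the space of continuous functions that are affine on each $[x_i,x_{i+1}]$ and vanish at $\bar a$ and $\bar b$. Let $\mathcal W_h^1,\dots,\mathcal W_h^N\in S_h$ solve the fully discrete scheme: for $1\le n\le N$ and all $\Lambda\in S_h$, $$(\mathcal W_h^n,\Lambda)+\Big(\sum_{j=1}^n\varpi_{n,j}\mathcal W_h^j,\Lambda\Big)+\lambda\Big(\sum_{j=1}^n\widetilde\varpi_{n,j}\mathcal W_h^j,\Lambda\Big)+\tfrac12\sigma^2\Big(\sum_{j=1}^n\widetilde\varpi_{n,j}\nabla\mathcal W_h^j,\nabla\Lambda\Big)=(F^n,\Lambda).$$ Then there are constants $C>0$ and $\tau_0>0$, depending only on $T,\bar a,\bar b,\sigma,r,\alpha,K,\rho$ (and not on $F$, $\omega$, $N$, the partition or $\mathcal W_h$), such that, whenever $\tau\le\tau_0$, $$\sqrt{\tau\sum_{n=1}^N\|\omega^n-\mathcal W_h^n\|^2}\le C\left(\tau^{\frac12+\frac32\alpha_0}+h^2\right).$$ -/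

import Mathlib

open MeasureTheory Set


noncomputable section

namespace BlackScholesFEM

/-! ### Function spaces -/

/-- The Hilbert space `L²(a, b)`. -/
abbrev L2 (a b : ℝ) := Lp ℝ 2 (volume.restrict (Ioo a b))

/-- `v` is the weak derivative of `u` on `(a, b)`: integration by parts holds against every
test function `φ ∈ C_c^∞(a, b)`. -/
def IsWeakDeriv {a b : ℝ} (u v : L2 a b) : Prop :=
  ∀ φ : ℝ → ℝ, ContDiff ℝ (⊤ : ℕ∞) φ → HasCompactSupport φ → tsupport φ ⊆ Ioo a b →
    ∫ x in Ioo a b, u x * deriv φ x = -∫ x in Ioo a b, v x * φ x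

theorem integral_mul_eq_inner {a b : ℝ} (u : L2 a b) {ψ : ℝ → ℝ}
    (hψ : MemLp ψ 2 (volume.restrict (Ioo a b))) :
    ∫ x in Ioo a b, u x * ψ x = inner ℝ (hψ.toLp ψ) u := by
  rw [L2.inner_def]
  refine integral_congr_ae ?_
  filter_upwards [hψ.coeFn_toLp] with x hx
  simp [hx]

theorem memLp_test {a b : ℝ} {φ : ℝ → ℝ} (hφ : Continuous φ) (hc : HasCompactSupport φ) :
    MemLp φ 2 (volume.restrict (Ioo a b)) :=
  (hφ.memLp_of_hasCompactSupport hc).restrict _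

theorem isWeakDeriv_iff {a b : ℝ} {u v : L2 a b} :
    IsWeakDeriv u v ↔ ∀ (φ : ℝ → ℝ) (h : ContDiff ℝ (⊤ : ℕ∞) φ) (hc : HasCompactSupport φ),
      tsupport φ ⊆ Ioo a b →
      inner ℝ ((memLp_test (a := a) (b := b) (h.continuous_deriv (by simp)) hc.deriv).toLp _) u
        + inner ℝ ((memLp_test (a := a) (b := b) h.continuous hc).toLp _) v = 0 := by
  unfold IsWeakDeriv
  refine forall_congr' fun φ => forall_congr' fun h => forall_congr' fun hc =>
    forall_congr' fun _ => ?_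
  rw [integral_mul_eq_inner u (memLp_test (h.continuous_deriv (by simp)) hc.deriv),
    integral_mul_eq_inner v (memLp_test h.continuous hc), eq_neg_iff_add_eq_zero]

/-- The Sobolev space `H²(a, b)`. An element is a function `u ∈ L²(a, b)` listed together with its
(unique) weak derivatives `u'`, `u'' ∈ L²(a, b)`, as the triple `(u, u', u'')`; the norm inherited
from the `ℓ²`-product is the standard one, `‖u‖² + ‖u'‖² + ‖u''‖²` under the square root. -/
def H2 (a b : ℝ) : Submodule ℝ (PiLp 2 fun _ : Fin 3 => L2 a b) where
  carrier := {U | IsWeakDeriv (U 0) (U 1) ∧ IsWeakDeriv (U 1) (U 2)}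
  zero_mem' := by
    simp [isWeakDeriv_iff]
  add_mem' := by
    rintro U V ⟨h1, h2⟩ ⟨h3, h4⟩
    simp only [isWeakDeriv_iff] at *
    refine ⟨fun φ h hc hs => ?_, fun φ h hc hs => ?_⟩
    · have e1 := h1 φ h hc hs
      have e2 := h3 φ h hc hs
      simp only [PiLp.add_apply, inner_add_right]
      linarith
    · have e1 := h2 φ h hc hs
      have e2 := h4 φ h hc hs
      simp only [PiLp.add_apply, inner_add_right]
      linarith
  smul_mem' := by
    rintro c U ⟨h1, h2⟩
    simp only [isWeakDeriv_iff] at *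
    refine ⟨fun φ h hc hs => ?_, fun φ h hc hs => ?_⟩
    · have e1 := h1 φ h hc hs
      simp only [PiLp.smul_apply, real_inner_smul_right]
      rw [← mul_add, e1, mul_zero]
    · have e1 := h2 φ h hc hs
      simp only [PiLp.smul_apply, real_inner_smul_right]
      rw [← mul_add, e1, mul_zero]

theorem isClosed_H2 (a b : ℝ) :
    IsClosed (H2 a b : Set (PiLp 2 fun _ : Fin 3 => L2 a b)) := by
  have hc : ∀ i, Continuous fun U : PiLp 2 (fun _ : Fin 3 => L2 a b) => U i :=
    fun i => PiLp.continuous_apply 2 _ i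
  have key : ∀ i j : Fin 3,
      IsClosed {U : PiLp 2 (fun _ : Fin 3 => L2 a b) | IsWeakDeriv (U i) (U j)} := by
    intro i j
    simp only [isWeakDeriv_iff, ofPred_forall]
    refine isClosed_iInter fun φ => isClosed_iInter fun h => isClosed_iInter fun hs =>
      isClosed_iInter fun _ => isClosed_eq ?_ continuous_const
    exact (continuous_const.inner (hc i)).add (continuous_const.inner (hc j))
  exact (key 0 1).inter (key 1 2)

instance (a b : ℝ) : CompleteSpace (H2 a b) := (isClosed_H2 a b).completeSpace_coe

/-- The underlying `L²`-function of an `H²`-function. -/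
def toL2 {a b : ℝ} (u : H2 a b) : L2 a b := (u : PiLp 2 fun _ : Fin 3 => L2 a b) 0

/-- The second weak derivative `∂ₓ² u` of an `H²`-function. -/
def dxx {a b : ℝ} (u : H2 a b) : L2 a b := (u : PiLp 2 fun _ : Fin 3 => L2 a b) 2

/-- Zero boundary values: the continuous representative of `u` vanishes at `a` and at `b`, that is
`u ∈ H¹₀(a, b)`. -/
def ZeroBoundary {a b : ℝ} (u : H2 a b) : Prop :=
  ∃ g : ℝ → ℝ, ContinuousOn g (Icc a b) ∧ g a = 0 ∧ g b = 0 ∧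
    toL2 u =ᵐ[volume.restrict (Ioo a b)] g

/-- The function `u` of time with values in a Banach space is locally absolutely continuous on the
interval `I` with weak derivative `v`: it is the continuous representative of an element of
`W^{1,1}` of every compact subinterval of `I`, and `∂ₜ u = v` there. -/
def IsTimeDerivOn {E : Type*} [NormedAddCommGroup E] [NormedSpace ℝ E] (I : Set ℝ)
    (u v : ℝ → E) : Prop :=
  ∀ s ∈ I, ∀ t ∈ I, s ≤ t →
    IntervalIntegrable v volume s t ∧ u t - u s = ∫ y in s..t, v y

/-- `g` is (the continuous representative of) an element of `W^{1,∞}(0, T)`. -/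
def MemW1Infty (T : ℝ) (g : ℝ → ℝ) : Prop :=
  ∃ g' : ℝ → ℝ, IsTimeDerivOn (Icc 0 T) g g' ∧
    ∃ M : ℝ, ∀ᵐ t ∂(volume.restrict (Ioo 0 T)), |g' t| ≤ M

/-! ### The transformed model -/

/-- Convolution in time, `(g * f)(t) = ∫₀ᵗ g(t - s) f(s) ds`. -/
def conv {E : Type*} [NormedAddCommGroup E] [NormedSpace ℝ E] (g : ℝ → ℝ) (f : ℝ → E) (t : ℝ) :
    E :=
  ∫ s in (0 : ℝ)..t, g (t - s) • f s

/-- `β_μ(t) = t^{μ-1} / Γ(μ)`. -/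
def beta (μ t : ℝ) : ℝ := t ^ (μ - 1) / Real.Gamma μ

/-- The variable-exponent kernel `k(t) = t^{-α(t)} / Γ(1 - α(t))`. -/
def kern (α : ℝ → ℝ) (t : ℝ) : ℝ := t ^ (-α t) / Real.Gamma (1 - α t)

/-- `q = β_{α₀} * k` on `(0, T]`, with `α₀ = α(0)`. Only the derivative of `q` on `(0, T)` enters
the model. -/
def qfun (α : ℝ → ℝ) (t : ℝ) : ℝ := conv (beta (α 0)) (kern α) t

/-- The reaction coefficient `λ = (σ/2 + r/σ)² / 2` of the transformed equation. -/
def lam (σ r : ℝ) : ℝ := 1 / 2 * (σ / 2 + r / σ) ^ 2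

/-- `0 < α(t) ≤ α* < 1` on `[0, T]` for some constant `α*`, `α ∈ W^{1,∞}(0, T)`, and
`α'(0) = 0`. -/
structure AdmissibleExponent (T : ℝ) (α : ℝ → ℝ) : Prop where
  pos : ∀ t ∈ Icc 0 T, 0 < α t
  le : ∃ αstar < 1, ∀ t ∈ Icc 0 T, α t ≤ αstar
  memW : MemW1Infty T α
  deriv_zero : HasDerivWithinAt α 0 (Ici 0) 0

/-- `ω` solves
`ω + q' * ω - (σ²/2) β_{α₀} * ∂ₓ²ω + λ β_{α₀} * ω = F` in `L²(a, b)` for `0 < t ≤ T`,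
`ω(a, t) = ω(b, t) = 0`, `ω(x, 0) = 0`. -/
structure IsSolution (a b T σ r : ℝ) (α : ℝ → ℝ) (F : ℝ → L2 a b) (ω : ℝ → H2 a b) : Prop where
  initial : ω 0 = 0
  boundary : ∀ t ∈ Icc 0 T, ZeroBoundary (ω t)
  equation : ∀ t ∈ Ioc 0 T,
    toL2 (ω t) + conv (deriv (qfun α)) (fun s => toL2 (ω s)) t
      - (1 / 2 * σ ^ 2) • conv (beta (α 0)) (fun s => dxx (ω s)) t
      + lam σ r • conv (beta (α 0)) (fun s => toL2 (ω s)) t = F t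

/-- The regularity assumption: `t ‖∂ₜ²ω‖_{H^{2m}} + ‖∂ₜω‖_{H^{2m}} ≤ K t^{α₀-1}` for a.e.
`t ∈ (0, T]` and `m = 0, 1`. -/
def RegularityBound {a b : ℝ} (T α₀ K : ℝ) (ω : ℝ → H2 a b) : Prop :=
  ∃ ω₁ ω₂ : ℝ → H2 a b,
    IsTimeDerivOn (Icc 0 T) ω ω₁ ∧ IsTimeDerivOn (Ioc 0 T) ω₁ ω₂ ∧
    (∀ᵐ t ∂(volume.restrict (Ioc 0 T)),
      t * ‖toL2 (ω₂ t)‖ + ‖toL2 (ω₁ t)‖ ≤ K * t ^ (α₀ - 1)) ∧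
    (∀ᵐ t ∂(volume.restrict (Ioc 0 T)), t * ‖ω₂ t‖ + ‖ω₁ t‖ ≤ K * t ^ (α₀ - 1))

/-! ### The fully discrete scheme -/

/-- The convolution quadrature weight
`(1/τ) ∫_{t_{n-1}}^{t_n} ∫_{t_{j-1}}^{min(t, t_j)} g(t - s) ds dt`, where `t_i = i τ`. -/
def weight (g : ℝ → ℝ) (τ : ℝ) (n j : ℕ) : ℝ :=
  1 / τ * ∫ t in (((n : ℝ) - 1) * τ)..((n : ℝ) * τ),
    ∫ s in (((j : ℝ) - 1) * τ)..(min t ((j : ℝ) * τ)), g (t - s)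

/-- A partition `a = x₀ < x₁ < ⋯ < x_M = b` of `[a, b]`. -/
structure Mesh (a b : ℝ) where
  M : ℕ
  node : Fin (M + 1) → ℝ
  strictMono : StrictMono node
  node_zero : node 0 = a
  node_last : node (Fin.last M) = b

/-- The length of the `i`-th cell. -/
def Mesh.cell {a b : ℝ} (P : Mesh a b) (i : Fin P.M) : ℝ := P.node i.succ - P.node i.castSucc

/-- The mesh diameter `h`, the largest cell length. -/
def Mesh.diam {a b : ℝ} (P : Mesh a b) : ℝ := ⨆ i : Fin P.M, P.cell i

/-- Quasi-uniformity with constant `ρ`: every cell has length at least `h / ρ`. -/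
def Mesh.QuasiUniform {a b : ℝ} (P : Mesh a b) (ρ : ℝ) : Prop := ∀ i, P.diam ≤ ρ * P.cell i

/-- The finite element space `S_h ⊂ H¹₀(a, b)`: functions that are continuous on `[a, b]`, affine
on each cell and zero at `a` and `b` (their values outside `[a, b]` play no role). -/
def Mesh.femSpace {a b : ℝ} (P : Mesh a b) : Set (ℝ → ℝ) :=
  {v | ContinuousOn v (Icc a b) ∧ v a = 0 ∧ v b = 0 ∧
    ∀ i : Fin P.M, ∃ c d : ℝ, ∀ x ∈ Icc (P.node i.castSucc) (P.node i.succ), v x = c + d * x}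

/-- The inner product `(f, g)` of `L²(a, b)`, for functions. -/
def l2Inner (a b : ℝ) (f g : ℝ → ℝ) : ℝ := ∫ x in Ioo a b, f x * g x

/-- The norm of `L²(a, b)`, for functions. -/
def l2Norm (a b : ℝ) (f : ℝ → ℝ) : ℝ := Real.sqrt (l2Inner a b f f)

/-- `W¹, …, W^N ∈ S_h` solve the fully discrete finite element scheme with step `τ = T / N`. -/
structure IsDiscreteSolution {a b : ℝ} (T σ r : ℝ) (α : ℝ → ℝ) (F : ℝ → L2 a b) (N : ℕ)
    (P : Mesh a b) (W : ℕ → ℝ → ℝ) : Prop where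
  mem : ∀ n ∈ Finset.Icc 1 N, W n ∈ P.femSpace
  scheme : ∀ n ∈ Finset.Icc 1 N, ∀ v ∈ P.femSpace,
    l2Inner a b (W n) v
      + l2Inner a b (∑ j ∈ Finset.Icc 1 n, weight (deriv (qfun α)) (T / N) n j • W j) v
      + lam σ r * l2Inner a b (∑ j ∈ Finset.Icc 1 n, weight (beta (α 0)) (T / N) n j • W j) v
      + 1 / 2 * σ ^ 2 *
        l2Inner a b (∑ j ∈ Finset.Icc 1 n, weight (beta (α 0)) (T / N) n j • deriv (W j)) (deriv v)
      = l2Inner a b (F (n * (T / N))) v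

end BlackScholesFEM

end

open BlackScholesFEM

/-! ### Positive convolution sequences -/

/-! The averaged weights are product-integration weights in disguise. Exchanging the two integrals
turns `weight g τ n j` into the integral of `g (t_n - s)` against the hat function centred at `t_j`.
Since `ω 0 = 0`, the quadrature sum is then exactly the convolution of `g` with the piecewise linear
time interpolant of `ω`. Positivity, summability and consistency of the weights are all read off
from this form.

The error is split as `(ω - z) + (z - W)` with `z` the Ritz projection. In one dimension `z` is the
nodal interpolant, because a test function has constant slope on each cell (`exists_ritz`); its `L²`
error is at most `2 h² ‖∂ₓ²ω‖`, with no duality argument. The difference `ξ = z - W` solves the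
scheme with a right-hand side made of projection errors and quadrature defects only
(`exists_error_equation`).

Stability comes from testing with `ξ n` and summing over `n`. The `β` weights are multiples of
second differences of `k ^ (α₀ + 1)`. After doubling the diagonal they form a nonnegative,
nonincreasing, convex sequence, that is, a positive combination of a constant and Fejér kernels, so
the reaction and diffusion terms have a sign (`sum_convex_nonneg`, `sum_powerWeight_nonneg`). The
kernel `q'` has no sign, but `|q'| ≤ C β_{α₀}` (`exists_abs_deriv_qfun_le`). Its contribution is
absorbed by Young's inequality and a Gronwall argument with weight `exp (-κ t)`, where `κ` is so
large that the weighted sum of the kernel is small (`gronwall_convolution`).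

For the rate in time write `a = α₀`. The interpolation error is `O(τ^a)` on the first time cell and
`O(τ² s^(a-2))` on the others; both are `O(τ^((1+3a)/2) s^(-(1+a)/2))`. Convolution with `β_a` turns
the power of `s` into `t^((a-1)/2)`, whose square `t^(a-1)` has bounded Riemann sums. Hence the `ℓ²`
norm in time keeps the full power `(1+3a)/2`. -/

theorem card_Ico_inter_Ico (n j L : ℕ) :
    (Finset.Ico n (n + L) ∩ Finset.Ico j (j + L)).card = L - Nat.dist n j := by
  rw [Finset.Ico_inter_Ico, Nat.card_Ico, Nat.dist]
  rcases le_total n j with h | h <;> simp [h] <;> omega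

section Fejer

variable {E : Type*} [NormedAddCommGroup E] [InnerProductSpace ℝ E]

/-- The kernel counts the integers `z` common to the windows `[n, n + L)` and `[j, j + L)`, so it is
a Gram kernel: the double sum equals the sum over `z` of the squared norm of the sum of those `φ n`
whose window contains `z`. Truncated subtraction makes it vanish at distance `L` and beyond. -/
theorem sum_fejer_nonneg (m L : ℕ) (φ : ℕ → E) :
    0 ≤ ∑ n ∈ Finset.range m, ∑ j ∈ Finset.range m,
      ((L - Nat.dist n j : ℕ) : ℝ) * inner ℝ (φ n) (φ j) := by
  have key : ∀ n ∈ Finset.range m, ∀ j ∈ Finset.range m,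
      ((L - Nat.dist n j : ℕ) : ℝ) * inner ℝ (φ n) (φ j)
        = ∑ z ∈ Finset.range (m + L),
          inner ℝ (if z ∈ Finset.Ico n (n + L) then φ n else 0)
            (if z ∈ Finset.Ico j (j + L) then φ j else 0) := by
    intro n hn j hj
    have hsub : Finset.Ico n (n + L) ∩ Finset.Ico j (j + L)
        = (Finset.range (m + L)).filter
          (fun z => z ∈ Finset.Ico n (n + L) ∧ z ∈ Finset.Ico j (j + L)) := by
      ext z
      simp only [Finset.mem_inter, Finset.mem_filter, Finset.mem_range, Finset.mem_Ico] at *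
      omega
    rw [← card_Ico_inter_Ico, hsub, Finset.card_filter, Nat.cast_sum, Finset.sum_mul]
    refine Finset.sum_congr rfl fun z _ => ?_
    by_cases h1 : z ∈ Finset.Ico n (n + L) <;> by_cases h2 : z ∈ Finset.Ico j (j + L) <;>
      simp only [h1, h2, and_self, and_true, and_false, if_true, if_false, inner_zero_left,
        inner_zero_right] <;> simp
  rw [Finset.sum_congr rfl fun n hn => Finset.sum_congr rfl fun j hj => key n hn j hj]
  rw [Finset.sum_congr rfl fun n _ => Finset.sum_comm, Finset.sum_comm]
  refine Finset.sum_nonneg fun z _ => ?_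
  rw [Finset.sum_congr rfl fun n _ => (inner_sum _ _ _).symm, ← sum_inner]
  exact real_inner_self_nonneg

/-- Summation by parts twice, i.e. a discrete Taylor formula anchored at `m`. With truncated
subtraction the ramps in `k` are Fejér kernels as soon as `k` is a distance of indices. -/
theorem eq_sum_second_difference (c : ℕ → ℝ) {k m : ℕ} (hkm : k ≤ m) :
    c k = c m + ((m - k : ℕ) : ℝ) * (c m - c (m + 1))
      + ∑ l ∈ Finset.range m, ((l + 1 - k : ℕ) : ℝ) * (c l - 2 * c (l + 1) + c (l + 2)) := by
  induction m, hkm using Nat.le_induction with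
  | base =>
    rw [Finset.sum_eq_zero]
    · simp
    · intro l hl
      have : l + 1 - k = 0 := by have := Finset.mem_range.1 hl; omega
      simp [this]
  | succ m hm ih =>
    rw [Finset.sum_range_succ]
    have h1 : ((m + 1 - k : ℕ) : ℝ) = ((m - k : ℕ) : ℝ) + 1 := by
      rw [Nat.succ_sub hm]; push_cast; ring
    rw [h1]
    linarith [ih]

/-- Discrete Pólya criterion: by the previous expansion `c` is a combination, with nonnegative
coefficients, of the constant kernel and Fejér kernels, each of which is positive semidefinite. -/
theorem sum_convex_nonneg {c : ℕ → ℝ} (h0 : ∀ k, 0 ≤ c k) (h1 : ∀ k, c (k + 1) ≤ c k)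
    (h2 : ∀ k, 0 ≤ c k - 2 * c (k + 1) + c (k + 2)) (m : ℕ) (φ : ℕ → E) :
    0 ≤ ∑ n ∈ Finset.range m, ∑ j ∈ Finset.range m,
      c (Nat.dist n j) * inner ℝ (φ n) (φ j) := by
  have key : ∀ n ∈ Finset.range m, ∀ j ∈ Finset.range m,
      c (Nat.dist n j) * inner ℝ (φ n) (φ j)
        = c m * inner ℝ (φ n) (φ j)
          + (c m - c (m + 1)) * (((m - Nat.dist n j : ℕ) : ℝ) * inner ℝ (φ n) (φ j))
          + ∑ l ∈ Finset.range m, (c l - 2 * c (l + 1) + c (l + 2)) *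
            (((l + 1 - Nat.dist n j : ℕ) : ℝ) * inner ℝ (φ n) (φ j)) := by
    intro n hn j hj
    have hd : Nat.dist n j ≤ m := by
      simp only [Finset.mem_range] at hn hj
      unfold Nat.dist; omega
    conv_lhs => rw [eq_sum_second_difference c hd]
    rw [add_mul, add_mul, Finset.sum_mul]
    congr 1
    · ring
    · exact Finset.sum_congr rfl fun l _ => by ring
  rw [Finset.sum_congr rfl fun n hn => Finset.sum_congr rfl fun j hj => key n hn j hj]
  simp only [Finset.sum_add_distrib, ← Finset.mul_sum]
  refine add_nonneg (add_nonneg ?_ ?_) ?_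
  · refine mul_nonneg (h0 m) ?_
    rw [Finset.sum_congr rfl fun n _ => (inner_sum _ _ _).symm, ← sum_inner]
    exact real_inner_self_nonneg
  · exact mul_nonneg (sub_nonneg.2 (h1 m)) (sum_fejer_nonneg m m φ)
  · rw [Finset.sum_congr rfl fun n _ => Finset.sum_comm, Finset.sum_comm]
    refine Finset.sum_nonneg fun l _ => ?_
    simp only [← Finset.mul_sum]
    exact mul_nonneg (h2 l) (sum_fejer_nonneg m (l + 1) φ)

/-- The causal sum is half of a symmetric one in which the diagonal coefficient becomes `2 * b 0`.
For this reason the monotonicity and convexity hypotheses at index `0` involve `2 * b 0`. -/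
theorem sum_convolution_nonneg {b : ℕ → ℝ} (h0 : ∀ k, 0 ≤ b k) (h1 : ∀ k, b (k + 2) ≤ b (k + 1))
    (h01 : b 1 ≤ 2 * b 0) (h02 : 0 ≤ 2 * b 0 - 2 * b 1 + b 2)
    (h2 : ∀ k, 0 ≤ b (k + 1) - 2 * b (k + 2) + b (k + 3)) (m : ℕ) (φ : ℕ → E) :
    0 ≤ ∑ n ∈ Finset.Icc 1 m, ∑ j ∈ Finset.Icc 1 n, b (n - j) * inner ℝ (φ j) (φ n) := by
  set c : ℕ → ℝ := fun k => if k = 0 then 2 * b 0 else b k with hc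
  have full := sum_convex_nonneg (c := c) (E := E)
    (fun k => by by_cases h : k = 0 <;> simp [hc, h, h0])
    (fun k => by rcases k with _ | k <;> simp [hc, h01, h1])
    (fun k => by rcases k with _ | k <;> simp [hc] <;> [exact h02; exact h2 k]) m
    (fun n => φ (n + 1))
  have half : ∀ m : ℕ, ∑ n ∈ Finset.range m, ∑ j ∈ Finset.range m,
      c (Nat.dist n j) * inner ℝ (φ (n + 1)) (φ (j + 1))
      = 2 * ∑ n ∈ Finset.Icc 1 m, ∑ j ∈ Finset.Icc 1 n, b (n - j) * inner ℝ (φ j) (φ n) := by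
    intro m
    induction m with
    | zero => simp
    | succ m ih =>
      rw [Finset.sum_Icc_succ_top (by omega), mul_add, ← ih, Finset.sum_range_succ]
      simp only [Finset.sum_range_succ, Finset.sum_add_distrib]
      rw [Finset.sum_Icc_succ_top (by omega)]
      have e : ∑ j ∈ Finset.Icc 1 m, b (m + 1 - j) * inner ℝ (φ j) (φ (m + 1))
          = ∑ j ∈ Finset.range m, b (m - j) * inner ℝ (φ (j + 1)) (φ (m + 1)) := by
        have hI : Finset.Icc 1 m = Finset.Ico (0 + 1) (m + 1) := by
          ext; simp only [Finset.mem_Icc, Finset.mem_Ico]; omega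
        rw [hI, ← Finset.sum_Ico_add' _ 0 m 1, Finset.range_eq_Ico]
        exact Finset.sum_congr rfl fun j _ => by rw [Nat.add_sub_add_right]
      have e1 : ∑ x ∈ Finset.range m, c (x.dist m) * inner ℝ (φ (x + 1)) (φ (m + 1))
          = ∑ j ∈ Finset.range m, b (m - j) * inner ℝ (φ (j + 1)) (φ (m + 1)) := by
        refine Finset.sum_congr rfl fun j hj => ?_
        have hj := Finset.mem_range.1 hj
        have : Nat.dist j m = m - j := by unfold Nat.dist; omega
        rw [this, hc]
        simp [show m - j ≠ 0 by omega]
      have e2 : ∑ x ∈ Finset.range m, c (m.dist x) * inner ℝ (φ (m + 1)) (φ (x + 1))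
          = ∑ j ∈ Finset.range m, b (m - j) * inner ℝ (φ (j + 1)) (φ (m + 1)) := by
        rw [← e1]
        exact Finset.sum_congr rfl fun j _ => by rw [Nat.dist_comm, real_inner_comm]
      rw [e, e1, e2]
      simp [hc]
      ring
  have := half m
  linarith

/-! ### Stability of the convolution scheme -/

/-- Cauchy–Schwarz with respect to the weights `w`, whose total mass is at most `L`. -/
theorem norm_sq_sum_smul_le {w v : ℕ → ℝ} {N m : ℕ} (hm : m ≤ N) (hw : ∀ k, 0 ≤ w k)
    (hv : ∀ k < N, |v k| ≤ w k) {L : ℝ} (hL : ∑ k ∈ Finset.range N, w k ≤ L) (x : ℕ → E) :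
    ‖∑ j ∈ Finset.Icc 1 m, v (m - j) • x j‖ ^ 2
      ≤ L * ∑ j ∈ Finset.Icc 1 m, w (m - j) * ‖x j‖ ^ 2 := by
  have h1 : ‖∑ j ∈ Finset.Icc 1 m, v (m - j) • x j‖
      ≤ ∑ j ∈ Finset.Icc 1 m, w (m - j) * ‖x j‖ := by
    refine (norm_sum_le _ _).trans (Finset.sum_le_sum fun j hj => ?_)
    rw [norm_smul, Real.norm_eq_abs]
    have := Finset.mem_Icc.1 hj
    exact mul_le_mul_of_nonneg_right (hv _ (by omega)) (norm_nonneg _)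
  have h2 : ∑ j ∈ Finset.Icc 1 m, w (m - j) ≤ L := by
    refine le_trans ?_ hL
    have : ∑ j ∈ Finset.Icc 1 m, w (m - j) = ∑ k ∈ Finset.range m, w k := by
      refine Finset.sum_nbij' (fun j => m - j) (fun k => m - k) ?_ ?_ ?_ ?_ ?_ <;>
        intro i hi <;> simp only [Finset.mem_Icc, Finset.mem_range] at * <;> omega
    rw [this]
    exact Finset.sum_le_sum_of_subset_of_nonneg (Finset.range_mono hm) fun k _ _ => hw k
  have h3 : (∑ j ∈ Finset.Icc 1 m, w (m - j) * ‖x j‖) ^ 2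
      ≤ (∑ j ∈ Finset.Icc 1 m, w (m - j)) * ∑ j ∈ Finset.Icc 1 m, w (m - j) * ‖x j‖ ^ 2 := by
    refine Finset.sum_sq_le_sum_mul_sum_of_sq_le_mul _ (fun j _ => hw _)
      (fun j _ => mul_nonneg (hw _) (sq_nonneg _)) fun j _ => le_of_eq (by ring)
  calc _ ≤ _ := pow_le_pow_left₀ (norm_nonneg _) h1 2
    _ ≤ _ := h3
    _ ≤ _ := mul_le_mul_of_nonneg_right h2
      (Finset.sum_nonneg fun j _ => mul_nonneg (hw _) (sq_nonneg _))

/-- Substituting the lag `k = m - j` exposes the partial sums of `z`, the form in which Gronwall's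
inequality is applied. -/
theorem sum_sum_convolution (w z : ℕ → ℝ) (n : ℕ) :
    ∑ m ∈ Finset.Icc 1 n, ∑ j ∈ Finset.Icc 1 m, w (m - j) * z j
      = ∑ k ∈ Finset.range n, w k * ∑ j ∈ Finset.Icc 1 (n - k), z j := by
  simp only [Finset.mul_sum]
  rw [Finset.sum_sigma', Finset.sum_sigma']
  refine Finset.sum_nbij' (fun p => ⟨p.1 - p.2, p.2⟩) (fun p => ⟨p.1 + p.2, p.2⟩) ?_ ?_ ?_ ?_ ?_
  · rintro ⟨m, j⟩ h; simp only [Finset.mem_sigma, Finset.mem_Icc, Finset.mem_range] at *; omega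
  · rintro ⟨m, j⟩ h; simp only [Finset.mem_sigma, Finset.mem_Icc, Finset.mem_range] at *; omega
  · rintro ⟨m, j⟩ h
    simp only [Finset.mem_sigma, Finset.mem_Icc] at *
    simp only [Nat.sub_add_cancel h.2.2]
  · rintro ⟨m, j⟩ h; simp
  · rintro ⟨m, j⟩ h; rfl

/-- Discrete Gronwall inequality of convolution type. -/
theorem gronwall_convolution {w S : ℕ → ℝ} {N : ℕ} {L r θ R : ℝ} (hr0 : 0 < r) (hr1 : r ≤ 1)
    (hw : ∀ k, 0 ≤ w k) (hS : ∀ n, 0 ≤ S n) (hL : 0 ≤ L) (hR : 0 ≤ R)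
    (hθ : ∑ k ∈ Finset.range N, w k * r ^ k ≤ θ) (hLθ : L * θ ≤ 1 / 4)
    (h : ∀ n ≤ N, S n ≤ 2 * L * ∑ k ∈ Finset.range n, w k * S (n - k) + 2 * R) :
    S N * r ^ N ≤ 4 * R := by
  -- At an index maximising `S n * r ^ n`, with maximum `M`, the weighted inequality reads `M ≤ 2 L
  -- θ M + 2 R ≤ M / 2 + 2 R`.
  obtain ⟨n, hn, hmax⟩ := Finset.exists_max_image (Finset.range (N + 1)) (fun n => S n * r ^ n)
    ⟨0, by simp⟩
  have hnN : n ≤ N := by have := Finset.mem_range.1 hn; omega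
  set M := S n * r ^ n with hM
  have hM0 : 0 ≤ M := mul_nonneg (hS n) (by positivity)
  refine (hmax N (by simp)).trans ?_
  have h1 : r ^ n * ∑ k ∈ Finset.range n, w k * S (n - k) ≤ θ * M := by
    calc r ^ n * ∑ k ∈ Finset.range n, w k * S (n - k)
        = ∑ k ∈ Finset.range n, (w k * r ^ k) * (S (n - k) * r ^ (n - k)) := by
          rw [Finset.mul_sum]
          refine Finset.sum_congr rfl fun k hk => ?_
          have : r ^ n = r ^ k * r ^ (n - k) := by
            rw [← pow_add]; congr 1; have := Finset.mem_range.1 hk; omega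
          rw [this]; ring
      _ ≤ ∑ k ∈ Finset.range n, (w k * r ^ k) * M := by
          refine Finset.sum_le_sum fun k _ => mul_le_mul_of_nonneg_left
            (hmax (n - k) (by simp; omega)) (mul_nonneg (hw k) (by positivity))
      _ = (∑ k ∈ Finset.range n, w k * r ^ k) * M := by rw [Finset.sum_mul]
      _ ≤ θ * M := by
          refine mul_le_mul_of_nonneg_right (le_trans ?_ hθ) hM0
          exact Finset.sum_le_sum_of_subset_of_nonneg (Finset.range_mono hnN)
            fun k _ _ => mul_nonneg (hw k) (by positivity)
  have h2 : r ^ n * R ≤ R := mul_le_of_le_one_left hR (pow_le_one₀ hr0.le hr1)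
  have h3 := mul_le_mul_of_nonneg_left (h n hnN) (pow_nonneg hr0.le n)
  have h4 := mul_le_mul_of_nonneg_left h1 (by positivity : 0 ≤ 2 * L)
  have h5 := mul_le_mul_of_nonneg_right hLθ hM0
  have h6 : r ^ n * S n = M := by rw [hM]; ring
  nlinarith

/-- Energy argument: summing the tested equation, the two `b` forms are nonnegative and can be
dropped. The `v` term is moved to the right and handled by Gronwall for the partial sums of `‖x n‖ ^
2`. -/
theorem convolution_scheme_stable {b v w : ℕ → ℝ} {N : ℕ} {L r θ l c : ℝ}
    (hr0 : 0 < r) (hr1 : r ≤ 1) (hw : ∀ k, 0 ≤ w k) (hv : ∀ k < N, |v k| ≤ w k)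
    (hL : ∑ k ∈ Finset.range N, w k ≤ L)
    (hθ : ∑ k ∈ Finset.range N, w k * r ^ k ≤ θ) (hLθ : L * θ ≤ 1 / 4)
    (hl : 0 ≤ l) (hc : 0 ≤ c) (x y ρ : ℕ → E)
    (hx : ∀ m ≤ N, 0 ≤ ∑ n ∈ Finset.Icc 1 m, ∑ j ∈ Finset.Icc 1 n,
      b (n - j) * inner ℝ (x j) (x n))
    (hy : ∀ m ≤ N, 0 ≤ ∑ n ∈ Finset.Icc 1 m, ∑ j ∈ Finset.Icc 1 n,
      b (n - j) * inner ℝ (y j) (y n))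
    (h : ∀ n ∈ Finset.Icc 1 N, inner ℝ (x n) (x n)
      + inner ℝ (∑ j ∈ Finset.Icc 1 n, v (n - j) • x j) (x n)
      + l * inner ℝ (∑ j ∈ Finset.Icc 1 n, b (n - j) • x j) (x n)
      + c * inner ℝ (∑ j ∈ Finset.Icc 1 n, b (n - j) • y j) (y n) = inner ℝ (ρ n) (x n)) :
    (∑ n ∈ Finset.Icc 1 N, ‖x n‖ ^ 2) * r ^ N ≤ 4 * ∑ n ∈ Finset.Icc 1 N, ‖ρ n‖ ^ 2 := by
  have hL0 : 0 ≤ L := (Finset.sum_nonneg fun k _ => hw k).trans hL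
  refine gronwall_convolution (S := fun n => ∑ m ∈ Finset.Icc 1 n, ‖x m‖ ^ 2) hr0 hr1 hw
    (fun n => Finset.sum_nonneg fun _ _ => sq_nonneg _) hL0
    (Finset.sum_nonneg fun _ _ => sq_nonneg _) hθ hLθ fun n hn => ?_
  have energy : ∑ m ∈ Finset.Icc 1 n, ‖x m‖ ^ 2
      ≤ ∑ m ∈ Finset.Icc 1 n, (inner ℝ (ρ m) (x m)
        - inner ℝ (∑ j ∈ Finset.Icc 1 m, v (m - j) • x j) (x m)) := by
    have e : ∑ m ∈ Finset.Icc 1 n, (inner ℝ (ρ m) (x m)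
        - inner ℝ (∑ j ∈ Finset.Icc 1 m, v (m - j) • x j) (x m))
        = ∑ m ∈ Finset.Icc 1 n, ‖x m‖ ^ 2
          + l * ∑ m ∈ Finset.Icc 1 n, ∑ j ∈ Finset.Icc 1 m, b (m - j) * inner ℝ (x j) (x m)
          + c * ∑ m ∈ Finset.Icc 1 n, ∑ j ∈ Finset.Icc 1 m,
            b (m - j) * inner ℝ (y j) (y m) := by
      rw [Finset.mul_sum, Finset.mul_sum, ← Finset.sum_add_distrib, ← Finset.sum_add_distrib]
      refine Finset.sum_congr rfl fun m hm => ?_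
      have hm := Finset.mem_Icc.1 hm
      rw [← h m (Finset.mem_Icc.2 ⟨hm.1, hm.2.trans hn⟩), real_inner_self_eq_norm_sq]
      simp only [sum_inner, real_inner_smul_left]
      ring
    rw [e]
    have := mul_nonneg hl (hx n hn)
    have := mul_nonneg hc (hy n hn)
    linarith
  -- Each of the two products gives up a quarter of `‖x m‖ ^ 2`; absorbing the resulting half
  -- produces the factors `2` in the Gronwall hypothesis.
  have young : ∀ m ∈ Finset.Icc 1 n, inner ℝ (ρ m) (x m)
        - inner ℝ (∑ j ∈ Finset.Icc 1 m, v (m - j) • x j) (x m)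
      ≤ 1 / 2 * ‖x m‖ ^ 2 + ‖ρ m‖ ^ 2
        + L * ∑ j ∈ Finset.Icc 1 m, w (m - j) * ‖x j‖ ^ 2 := by
    intro m hm
    have hm := Finset.mem_Icc.1 hm
    have q := norm_sq_sum_smul_le (hm.2.trans hn) hw hv hL x
    have i1 := real_inner_le_norm (ρ m) (x m)
    have i2 := neg_le_of_abs_le
      (abs_real_inner_le_norm (∑ j ∈ Finset.Icc 1 m, v (m - j) • x j) (x m))
    nlinarith [sq_nonneg (‖ρ m‖ - 1 / 2 * ‖x m‖),
      sq_nonneg (‖∑ j ∈ Finset.Icc 1 m, v (m - j) • x j‖ - 1 / 2 * ‖x m‖)]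
  have tot := energy.trans (Finset.sum_le_sum young)
  rw [Finset.sum_add_distrib, Finset.sum_add_distrib, ← Finset.mul_sum, ← Finset.mul_sum,
    sum_sum_convolution w (fun j => ‖x j‖ ^ 2)] at tot
  have mono : ∑ m ∈ Finset.Icc 1 n, ‖ρ m‖ ^ 2 ≤ ∑ m ∈ Finset.Icc 1 N, ‖ρ m‖ ^ 2 :=
    Finset.sum_le_sum_of_subset_of_nonneg (Finset.Icc_subset_Icc_right hn)
      fun _ _ _ => sq_nonneg _
  linarith

end Fejer

/-! ### Second differences of powers -/

/-- AM–GM: the right-hand side is at least `2 ((x + 1) (x - 1)) ^ (s / 2)`, and `(x + 1) (x - 1) ≤ x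
^ 2` with a nonpositive exponent. -/
theorem two_mul_rpow_le_of_nonpos {s x : ℝ} (hs : s ≤ 0) (hx : 1 < x) :
    2 * x ^ s ≤ (x + 1) ^ s + (x - 1) ^ s := by
  have h1 : 0 < x - 1 := by linarith
  have hlog : Real.log (x + 1) + Real.log (x - 1) ≤ 2 * Real.log x := by
    rw [← Real.log_mul (by linarith) h1.ne', two_mul, ← Real.log_mul (by linarith) (by linarith)]
    exact Real.log_le_log (by nlinarith) (by nlinarith)
  rw [Real.rpow_def_of_pos (by linarith), Real.rpow_def_of_pos (by linarith : 0 < x + 1),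
    Real.rpow_def_of_pos h1]
  set A := Real.exp (Real.log (x + 1) * s / 2)
  set B := Real.exp (Real.log (x - 1) * s / 2)
  have eA : Real.exp (Real.log (x + 1) * s) = A * A := by rw [← Real.exp_add]; ring_nf
  have eB : Real.exp (Real.log (x - 1) * s) = B * B := by rw [← Real.exp_add]; ring_nf
  have : Real.exp (Real.log x * s) ≤ A * B := by
    rw [← Real.exp_add]
    exact Real.exp_le_exp.2 (by nlinarith)
  rw [eA, eB]
  nlinarith [sq_nonneg (A - B)]

theorem rpow_add_rpow_le_of_concave {s x : ℝ} (hs0 : 0 ≤ s) (hs1 : s ≤ 1) (hx : 1 ≤ x) :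
    (x + 1) ^ s + (x - 1) ^ s ≤ 2 * x ^ s := by
  have := (Real.concaveOn_rpow hs0 hs1).2 (show x + 1 ∈ Ici 0 by simp; linarith)
    (show x - 1 ∈ Ici 0 by simp; linarith) (by norm_num : (0 : ℝ) ≤ 1 / 2)
    (by norm_num : (0 : ℝ) ≤ 1 / 2) (by norm_num)
  simp only [smul_eq_mul] at this
  rw [show 1 / 2 * (x + 1) + 1 / 2 * (x - 1) = x by ring] at this
  linarith

theorem two_mul_rpow_le_of_convex {s x : ℝ} (hs : 1 ≤ s) (hx : 1 ≤ x) :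
    2 * x ^ s ≤ (x + 1) ^ s + (x - 1) ^ s := by
  have := (convexOn_rpow hs).2 (show x + 1 ∈ Ici 0 by simp; linarith)
    (show x - 1 ∈ Ici 0 by simp; linarith) (by norm_num : (0 : ℝ) ≤ 1 / 2)
    (by norm_num : (0 : ℝ) ≤ 1 / 2) (by norm_num)
  simp only [smul_eq_mul] at this
  rw [show 1 / 2 * (x + 1) + 1 / 2 * (x - 1) = x by ring] at this
  linarith

/-- The second difference of `x ↦ x ^ p`. -/
noncomputable def rpowDiff2 (p x : ℝ) : ℝ := (x + 1) ^ p - 2 * x ^ p + (x - 1) ^ p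

theorem continuousOn_rpowDiff2 {p : ℝ} (hp : 0 ≤ p) : ContinuousOn (rpowDiff2 p) (Ici 1) := by
  unfold rpowDiff2
  have := Real.continuous_rpow_const hp
  fun_prop (disch := assumption)

theorem hasDerivAt_rpowDiff2 (p : ℝ) {x : ℝ} (hx : 1 < x) :
    HasDerivAt (rpowDiff2 p) (p * rpowDiff2 (p - 1) x) x := by
  unfold rpowDiff2
  have h1 := ((hasDerivAt_id x).add_const 1).rpow_const (p := p) (Or.inl (by simp; linarith))
  have h2 := (hasDerivAt_id x).rpow_const (p := p) (Or.inl (by simp; linarith))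
  have h3 := ((hasDerivAt_id x).sub_const 1).rpow_const (p := p) (Or.inl (by simp; linarith))
  refine ((h1.sub (h2.const_mul 2)).add h3).congr_deriv ?_
  simp
  ring

/-- The derivative is `p` times the second difference of the power `p - 1`, which lies in `[0, 1]`
and is therefore concave. -/
theorem antitoneOn_rpowDiff2 {p : ℝ} (hp1 : 1 ≤ p) (hp2 : p ≤ 2) :
    AntitoneOn (rpowDiff2 p) (Ici 1) := by
  refine antitoneOn_of_hasDerivWithinAt_nonpos (convex_Ici 1)
    (continuousOn_rpowDiff2 (by linarith)) (f' := fun x => p * rpowDiff2 (p - 1) x) ?_ ?_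
  · intro x hx
    rw [interior_Ici] at hx
    exact (hasDerivAt_rpowDiff2 p hx).hasDerivWithinAt
  · intro x hx
    rw [interior_Ici] at hx
    have := rpow_add_rpow_le_of_concave (s := p - 1) (x := x) (by linarith) (by linarith)
      (le_of_lt hx)
    have h : rpowDiff2 (p - 1) x ≤ 0 := by unfold rpowDiff2; linarith
    exact mul_nonpos_of_nonneg_of_nonpos (by linarith) h

/-- Differentiating twice leads to the second difference of the power `p - 2 ≤ 0`, which is convex.
-/
theorem convexOn_rpowDiff2 {p : ℝ} (hp1 : 1 ≤ p) (hp2 : p ≤ 2) :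
    ConvexOn ℝ (Ici 1) (rpowDiff2 p) := by
  refine convexOn_of_hasDerivWithinAt2_nonneg (convex_Ici 1)
    (continuousOn_rpowDiff2 (by linarith)) (f' := fun x => p * rpowDiff2 (p - 1) x)
    (f'' := fun x => p * ((p - 1) * rpowDiff2 (p - 1 - 1) x)) ?_ ?_ ?_
  · intro x hx
    rw [interior_Ici] at hx
    exact (hasDerivAt_rpowDiff2 p hx).hasDerivWithinAt
  · intro x hx
    rw [interior_Ici] at hx
    exact ((hasDerivAt_rpowDiff2 (p - 1) hx).const_mul p).hasDerivWithinAt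
  · intro x hx
    rw [interior_Ici] at hx
    have := two_mul_rpow_le_of_nonpos (s := p - 1 - 1) (x := x) (by linarith) hx
    have h : 0 ≤ rpowDiff2 (p - 1 - 1) x := by unfold rpowDiff2; linarith
    exact mul_nonneg (by linarith) (mul_nonneg (by linarith) h)

/-- Divided by `2 ^ p` the claim is `4 ≤ 7 * 2 ^ (-p) + (3 / 2) ^ p`, an equality at `p = 2`. The
right side is convex, so it lies above its tangent at `2`, whose slope is nonpositive. -/
theorem four_mul_two_rpow_le {p : ℝ} (hp : p ≤ 2) : 4 * (2 : ℝ) ^ p ≤ 7 + 3 ^ p := by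
  -- This is the sign of the slope at `p = 2`; it amounts to `3 ^ 9 ≤ 2 ^ 16`.
  have hl : 9 * (Real.log 3 - Real.log 2) ≤ 7 * Real.log 2 := by
    have : Real.log (3 ^ 9) ≤ Real.log (2 ^ 16) :=
      Real.log_le_log (by norm_num) (by norm_num)
    rw [Real.log_pow, Real.log_pow] at this
    push_cast at this
    linarith
  have h3 : (3 : ℝ) ^ p = 2 ^ p * (9 / 4 * Real.exp ((Real.log 3 - Real.log 2) * (p - 2))) := by
    have e9 : (9 : ℝ) / 4 = Real.exp ((Real.log 3 - Real.log 2) * 2) := by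
      rw [sub_mul, Real.exp_sub, mul_comm, mul_comm (Real.log 2), ← Real.log_rpow (by norm_num),
        ← Real.log_rpow (by norm_num), Real.exp_log (by positivity), Real.exp_log (by positivity)]
      norm_num
    rw [e9, ← Real.exp_add, Real.rpow_def_of_pos (by norm_num), Real.rpow_def_of_pos (by norm_num),
      ← Real.exp_add]
    ring_nf
  have h1 : (1 : ℝ) = 2 ^ p * (1 / 4 * Real.exp (-Real.log 2 * (p - 2))) := by
    have e4 : (1 : ℝ) / 4 = Real.exp (-(Real.log 2 * 2)) := by
      rw [Real.exp_neg, mul_comm, ← Real.log_rpow (by norm_num), Real.exp_log (by positivity)]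
      norm_num
    rw [e4, ← Real.exp_add, Real.rpow_def_of_pos (by norm_num), ← Real.exp_add]
    ring_nf
    simp
  have i3 := Real.add_one_le_exp ((Real.log 3 - Real.log 2) * (p - 2))
  have i1 := Real.add_one_le_exp (-Real.log 2 * (p - 2))
  have hpos : (0 : ℝ) < 2 ^ p := by positivity
  have : 4 ≤ 7 * (1 / 4 * Real.exp (-Real.log 2 * (p - 2)))
      + 9 / 4 * Real.exp ((Real.log 3 - Real.log 2) * (p - 2)) := by nlinarith
  nlinarith

/-- The product trapezoidal weights of `t ^ (p - 2)`, up to a constant factor. -/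
noncomputable def powerWeight (p : ℝ) (k : ℕ) : ℝ :=
  ((k : ℝ) + 1) ^ p - 2 * (k : ℝ) ^ p + (max 0 ((k : ℝ) - 1)) ^ p

theorem powerWeight_succ (p : ℝ) (k : ℕ) : powerWeight p (k + 1) = rpowDiff2 p (k + 1) := by
  unfold powerWeight rpowDiff2
  push_cast
  rw [max_eq_right (by simp)]

theorem powerWeight_zero {p : ℝ} (hp : p ≠ 0) : powerWeight p 0 = 1 := by
  simp [powerWeight, hp]

theorem powerWeight_one {p : ℝ} (hp : p ≠ 0) : powerWeight p 1 = 2 ^ p - 2 := by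
  simp only [powerWeight, Nat.cast_one, sub_self, max_self, Real.one_rpow, Real.zero_rpow hp]
  norm_num

theorem powerWeight_two (p : ℝ) : powerWeight p 2 = 3 ^ p - 2 * 2 ^ p + 1 := by
  unfold powerWeight
  norm_num

theorem powerWeight_nonneg {p : ℝ} (hp : 1 ≤ p) (k : ℕ) : 0 ≤ powerWeight p k := by
  rcases k with _ | k
  · rw [powerWeight_zero (by linarith)]; exact zero_le_one
  · rw [powerWeight_succ]
    have := two_mul_rpow_le_of_convex hp (x := (k : ℝ) + 1) (by simp)
    unfold rpowDiff2
    linarith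

theorem sum_powerWeight_nonneg {E : Type*} [NormedAddCommGroup E] [InnerProductSpace ℝ E] {p : ℝ}
    (hp1 : 1 ≤ p) (hp2 : p ≤ 2) (m : ℕ) (φ : ℕ → E) :
    0 ≤ ∑ n ∈ Finset.Icc 1 m, ∑ j ∈ Finset.Icc 1 n, powerWeight p (n - j) * inner ℝ (φ j) (φ n) := by
  have hp0 : p ≠ 0 := by linarith
  have hle : ∀ k : ℕ, (1 : ℝ) ≤ (k : ℝ) + 1 := fun k => by simp
  have h4 : (2 : ℝ) ^ p ≤ 4 := by
    calc (2 : ℝ) ^ p ≤ 2 ^ (2 : ℝ) := Real.rpow_le_rpow_of_exponent_le (by norm_num) hp2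
      _ = 4 := by norm_num
  refine sum_convolution_nonneg (powerWeight_nonneg hp1) (fun k => ?_) ?_ ?_ (fun k => ?_) m φ
  · rw [powerWeight_succ, powerWeight_succ]
    refine antitoneOn_rpowDiff2 hp1 hp2 (hle k) (hle (k + 1)) (by push_cast; linarith)
  · rw [powerWeight_zero hp0, powerWeight_one hp0]
    linarith
  -- Convexity at the doubled diagonal: `2 b₀ - 2 b₁ + b₂ = 7 - 4 * 2 ^ p + 3 ^ p`.
  · rw [powerWeight_zero hp0, powerWeight_one hp0, powerWeight_two]
    linarith [four_mul_two_rpow_le hp2]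
  · rw [powerWeight_succ, powerWeight_succ, powerWeight_succ]
    have := (convexOn_rpowDiff2 hp1 hp2).2 (hle k) (hle (k + 2))
      (by norm_num : (0 : ℝ) ≤ 1 / 2) (by norm_num : (0 : ℝ) ≤ 1 / 2) (by norm_num)
    simp only [smul_eq_mul] at this
    push_cast at this ⊢
    rw [show 1 / 2 * ((k : ℝ) + 1) + 1 / 2 * ((k : ℝ) + 2 + 1) = (k : ℝ) + 1 + 1 by ring] at this
    linarith

/-! ### The quadrature weights as integrals against hat functions -/

/-- The piecewise linear hat function of width `τ` centred at `0`. -/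
noncomputable def hat (τ x : ℝ) : ℝ := max 0 (1 - |x| / τ)

theorem hat_nonneg (τ x : ℝ) : 0 ≤ hat τ x := le_max_left _ _

theorem continuous_hat (τ : ℝ) : Continuous (hat τ) := by unfold hat; fun_prop

theorem hat_eq_zero {τ x : ℝ} (hτ : 0 < τ) (hx : τ ≤ |x|) : hat τ x = 0 :=
  max_eq_left (by rw [sub_nonpos, le_div_iff₀ hτ]; linarith)

/-- The weight of the product trapezoidal rule with kernel `g`. -/
noncomputable def convWeight (g : ℝ → ℝ) (T τ : ℝ) (k : ℕ) : ℝ :=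
  ∫ y in (0 : ℝ)..T, g y * hat τ (k * τ - y)

/-- The right side is the length of the overlap of two intervals of length `τ` starting at `x` and
`y`. -/
theorem mul_hat_eq {τ : ℝ} (hτ : 0 < τ) (x y : ℝ) :
    τ * hat τ (x - y) = max 0 (min (x + τ) (y + τ) - max x y) := by
  unfold hat
  rw [mul_max_of_nonneg _ _ hτ.le, mul_zero, mul_sub, mul_one, mul_div_cancel₀ _ hτ.ne']
  congr 1
  rcases le_total x y with h | h
  · rw [min_eq_left (by linarith), max_eq_right h, abs_of_nonpos (by linarith)]; ring
  · rw [min_eq_right (by linarith), max_eq_left h, abs_of_nonneg (by linarith)]; ring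

/-- Fubini in the lag `y = t - s`: for fixed `y`, the times `t` of the `n`-th cell with `t - y` in
the `j`-th cell form an overlap of two intervals of length `τ`, which has length `τ * hat τ ((n - j)
τ - y)`. In particular the weight depends only on `n - j`. -/
theorem weight_eq_convWeight {g : ℝ → ℝ} {T τ : ℝ} (hτ : 0 < τ) {n j : ℕ} (hj : 1 ≤ j) (hjn : j ≤ n)
    (hn : n * τ ≤ T) (hg : IntervalIntegrable g volume 0 T) :
    weight g τ n j = convWeight g T τ (n - j) := by
  have hT : 0 ≤ T := le_trans (by positivity) hn
  rw [intervalIntegrable_iff_integrableOn_Ioc_of_le hT] at hg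
  set p : ℝ := ((n : ℝ) - 1) * τ with hp
  set q : ℝ := ((j : ℝ) - 1) * τ with hq
  have hnp : (n : ℝ) * τ = p + τ := by rw [hp]; ring
  have hjq : (j : ℝ) * τ = q + τ := by rw [hq]; ring
  have hqp : q ≤ p := by
    have : (j : ℝ) ≤ n := by exact_mod_cast hjn
    rw [hp, hq]; nlinarith
  have hq0 : 0 ≤ q := by
    have : (1 : ℝ) ≤ j := by exact_mod_cast hj
    exact mul_nonneg (by linarith) hτ.le
  unfold weight convWeight
  rw [hnp, hjq, intervalIntegral.integral_of_le (by linarith), intervalIntegral.integral_of_le hT]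
  have inner_eq : ∀ t ∈ Ioc p (p + τ), ∫ s in q..(min t (q + τ)), g (t - s)
      = ∫ y in Ioc 0 T, (Ioc (y + q) (y + q + τ)).indicator (fun _ => g y) t := by
    intro t ht
    have hqt : q < t := lt_of_le_of_lt hqp ht.1
    have hle : t - min t (q + τ) ≤ t - q := by
      have : q ≤ min t (q + τ) := le_min hqt.le (by linarith)
      linarith
    rw [intervalIntegral.integral_comp_sub_left, intervalIntegral.integral_of_le hle,
      ← integral_indicator measurableSet_Ioc, ← integral_indicator measurableSet_Ioc]
    refine integral_congr_ae ?_
    -- The reflection `s ↦ t - s` exchanges open and closed ends of the half-open intervals, so two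
    -- values of `y` are discarded.
    filter_upwards [compl_mem_ae_iff.2 (measure_singleton (t - (q + τ))),
      compl_mem_ae_iff.2 (measure_singleton (t - q))] with y h1 h2
    simp only [mem_compl_iff, mem_singleton_iff] at h1 h2
    have h1' := lt_or_gt_of_ne h1
    have h2' := lt_or_gt_of_ne h2
    have key : y ∈ Ioc (t - min t (q + τ)) (t - q) ↔
        y ∈ Ioc 0 T ∧ t ∈ Ioc (y + q) (y + q + τ) := by
      simp only [mem_Ioc]
      have hmin : t - min t (q + τ) < y ↔ 0 < y ∧ t - (q + τ) < y := by
        rw [sub_lt_comm, lt_min_iff]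
        constructor <;> rintro ⟨h, h'⟩ <;> constructor <;> linarith
      rw [hmin]
      constructor
      · rintro ⟨⟨h3, h4⟩, h5⟩
        refine ⟨⟨h3, by linarith [ht.2]⟩, ?_, by linarith⟩
        rcases h2' with h | h <;> linarith
      · rintro ⟨⟨h3, h4⟩, h5, h6⟩
        refine ⟨⟨h3, ?_⟩, by linarith⟩
        rcases h1' with h | h <;> linarith
    by_cases h : y ∈ Ioc (t - min t (q + τ)) (t - q)
    · rw [indicator_of_mem h, indicator_of_mem (key.1 h).1, indicator_of_mem (key.1 h).2]
    · rw [indicator_of_notMem h]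
      by_cases h3 : y ∈ Ioc 0 T
      · rw [indicator_of_mem h3, indicator_of_notMem fun h4 => h (key.2 ⟨h3, h4⟩)]
      · rw [indicator_of_notMem h3]
  rw [setIntegral_congr_fun measurableSet_Ioc inner_eq]
  have hint : Integrable (Function.uncurry fun (t y : ℝ) =>
      (Ioc (y + q) (y + q + τ)).indicator (fun _ => g y) t)
      ((volume.restrict (Ioc p (p + τ))).prod (volume.restrict (Ioc 0 T))) := by
    have h1 : Integrable (fun z : ℝ × ℝ => g z.2)
        ((volume.restrict (Ioc p (p + τ))).prod (volume.restrict (Ioc 0 T))) := hg.comp_snd _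
    have hm : MeasurableSet {z : ℝ × ℝ | z.2 + q < z.1 ∧ z.1 ≤ z.2 + q + τ} :=
      measurableSet_setOfPred.2 <| (measurableSet_setOfPred.1
        (measurableSet_lt (by fun_prop) (by fun_prop))).and
        (measurableSet_setOfPred.1 (measurableSet_le (by fun_prop) (by fun_prop)))
    refine (h1.indicator hm).congr (Filter.Eventually.of_forall ?_)
    rintro ⟨t, y⟩
    simp only [Function.uncurry, indicator, mem_ofPred_eq, mem_Ioc]
  rw [integral_integral_swap hint, ← integral_const_mul]
  refine setIntegral_congr_fun measurableSet_Ioc fun y _ => ?_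
  rw [integral_indicator measurableSet_Ioc, Measure.restrict_restrict measurableSet_Ioc,
    setIntegral_const, Ioc_inter_Ioc, Real.volume_real_Ioc, smul_eq_mul]
  have hk : ((n - j : ℕ) : ℝ) * τ - y = p - (y + q) := by
    rw [Nat.cast_sub hjn, hp, hq]; ring
  have := mul_hat_eq hτ p (y + q)
  rw [hk, max_comm (_ - _), min_comm, max_comm (y + q), ← this]
  field_simp

/-! ### Partition of unity -/

theorem hat_of_mem_cell {τ : ℝ} (hτ : 0 < τ) {i k : ℕ} {s : ℝ} (h1 : i * τ ≤ s)
    (h2 : s ≤ (i + 1) * τ) :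
    hat τ (k * τ - s) = if k = i then i + 1 - s / τ else if k = i + 1 then s / τ - i else 0 := by
  have e1 : (i : ℝ) ≤ s / τ := by rwa [le_div_iff₀ hτ]
  have e2 : s / τ ≤ i + 1 := by rwa [div_le_iff₀ hτ]
  have e : |(k : ℝ) * τ - s| / τ = |(k : ℝ) - s / τ| := by
    rw [← abs_of_pos hτ, ← abs_div, abs_of_pos hτ, sub_div, mul_div_cancel_right₀ _ hτ.ne']
  unfold hat
  rw [e]
  split_ifs with h h'
  · rw [h, abs_of_nonpos (by linarith), max_eq_right (by linarith)]; ring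
  · rw [h', abs_of_nonneg (by push_cast; linarith), max_eq_right (by push_cast; linarith)]
    push_cast; ring
  · refine max_eq_left ?_
    rcases lt_or_gt_of_ne h with h3 | h3
    · have : (k : ℝ) + 1 ≤ i := by exact_mod_cast h3
      rw [abs_of_nonpos (by linarith)]; linarith
    · have : (i : ℝ) + 2 ≤ k := by exact_mod_cast (by omega : i + 2 ≤ k)
      rw [abs_of_nonneg (by linarith)]; linarith

theorem sum_hat_smul {E : Type*} [NormedAddCommGroup E] [NormedSpace ℝ E] {τ : ℝ} (hτ : 0 < τ)
    {i n : ℕ} {s : ℝ} (h1 : i * τ ≤ s) (h2 : s ≤ (i + 1) * τ) (hin : i < n) (f : ℕ → E) :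
    ∑ k ∈ Finset.range (n + 1), hat τ (k * τ - s) • f k
      = (i + 1 - s / τ) • f i + (s / τ - i) • f (i + 1) := by
  simp only [hat_of_mem_cell hτ h1 h2]
  rw [← Finset.sum_subset (s₁ := {i, i + 1})]
  · rw [Finset.sum_pair (by omega)]
    simp
  · intro k hk
    simp only [Finset.mem_insert, Finset.mem_singleton, Finset.mem_range] at *
    omega
  · intro k _ hk
    simp only [Finset.mem_insert, Finset.mem_singleton, not_or] at hk
    simp [hk.1, hk.2]

/-- The sum is at most the piecewise linear interpolant of the sampled exponential; on the cell
containing `y` this is bounded by its left nodal value, which exceeds `exp (-κ y)` by a factor of at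
most `exp (κ τ)`. -/
theorem sum_hat_mul_exp_le {τ κ y : ℝ} (hτ : 0 < τ) (hκ : 0 ≤ κ) (hy : 0 ≤ y) (N : ℕ) :
    ∑ k ∈ Finset.range N, hat τ (k * τ - y) * Real.exp (-κ * τ) ^ k
      ≤ Real.exp (κ * τ) * Real.exp (-κ * y) := by
  set i := ⌊y / τ⌋₊
  have h1 : i * τ ≤ y := by
    rw [← le_div_iff₀ hτ]; exact Nat.floor_le (by positivity)
  have h2 : y ≤ (i + 1) * τ := by
    rw [← div_le_iff₀ hτ]; exact (Nat.lt_floor_add_one _).le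
  have e1 : (i : ℝ) ≤ y / τ := by rwa [le_div_iff₀ hτ]
  have e2 : y / τ ≤ i + 1 := by rwa [div_le_iff₀ hτ]
  set r := Real.exp (-κ * τ) with hr
  have hr0 : 0 < r := Real.exp_pos _
  have hr1 : r ≤ 1 := Real.exp_le_one_iff.2 (by nlinarith)
  calc ∑ k ∈ Finset.range N, hat τ (k * τ - y) * r ^ k
      ≤ ∑ k ∈ Finset.range (max N (i + 1) + 1), hat τ (k * τ - y) * r ^ k :=
        Finset.sum_le_sum_of_subset_of_nonneg (Finset.range_mono (by omega))
          fun k _ _ => mul_nonneg (hat_nonneg _ _) (by positivity)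
    _ = (i + 1 - y / τ) * r ^ i + (y / τ - i) * r ^ (i + 1) :=
        sum_hat_smul hτ h1 h2 (by omega) fun k => r ^ k
    _ ≤ (i + 1 - y / τ) * r ^ i + (y / τ - i) * r ^ i := by
        have : r ^ (i + 1) ≤ r ^ i := pow_le_pow_of_le_one hr0.le hr1 (by omega)
        nlinarith
    _ = r ^ i := by ring
    _ ≤ _ := by
        rw [hr, ← Real.exp_nat_mul, ← Real.exp_add]
        exact Real.exp_le_exp.2 (by nlinarith)

/-! ### The weights of the kernel `beta` -/

theorem beta_nonneg {a y : ℝ} (ha : 0 < a) (hy : 0 ≤ y) : 0 ≤ beta a y :=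
  div_nonneg (Real.rpow_nonneg hy _) (Real.Gamma_pos_of_pos ha).le

theorem intervalIntegrable_beta {a : ℝ} (ha : 0 < a) (s t : ℝ) :
    IntervalIntegrable (beta a) volume s t := by
  unfold beta
  exact (intervalIntegral.intervalIntegrable_rpow' (by linarith)).div_const _

theorem integral_rpow_mul_pos_part {a x T : ℝ} (ha : 0 < a) (hxT : x ≤ T) (hT : 0 ≤ T) :
    ∫ y in (0 : ℝ)..T, y ^ (a - 1) * max 0 (x - y) = (max 0 x) ^ (a + 1) / (a * (a + 1)) := by
  rcases le_total x 0 with hx | hx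
  · rw [max_eq_left hx, Real.zero_rpow (by linarith), zero_div]
    rw [intervalIntegral.integral_of_le hT]
    refine setIntegral_eq_zero_of_forall_eq_zero fun y hy => ?_
    rw [max_eq_left (by linarith [hy.1]), mul_zero]
  · have hi : ∀ s t : ℝ, IntervalIntegrable (fun y : ℝ => y ^ (a - 1) * max 0 (x - y)) volume s t :=
      fun s t => (intervalIntegral.intervalIntegrable_rpow' (by linarith)).mul_continuousOn
        (by fun_prop)
    rw [← intervalIntegral.integral_add_adjacent_intervals (hi 0 x) (hi x T), max_eq_right hx]
    have z : ∫ y in x..T, y ^ (a - 1) * max 0 (x - y) = 0 := by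
      rw [intervalIntegral.integral_of_le hxT]
      refine setIntegral_eq_zero_of_forall_eq_zero fun y hy => ?_
      rw [max_eq_left (by linarith [hy.1]), mul_zero]
    have e : ∫ y in (0 : ℝ)..x, y ^ (a - 1) * max 0 (x - y)
        = ∫ y in (0 : ℝ)..x, (x * y ^ (a - 1) - y ^ a) := by
      rw [intervalIntegral.integral_of_le hx, intervalIntegral.integral_of_le hx]
      refine setIntegral_congr_fun measurableSet_Ioc fun y hy => ?_
      have : y ^ a = y ^ (a - 1) * y := by
        rw [← Real.rpow_add_one hy.1.ne']; ring_nf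
      rw [max_eq_right (by linarith [hy.2]), this]
      ring
    rw [z, e, intervalIntegral.integral_sub
      ((intervalIntegral.intervalIntegrable_rpow' (by linarith)).const_mul x)
      (intervalIntegral.intervalIntegrable_rpow' (by linarith)),
      intervalIntegral.integral_const_mul, integral_rpow (Or.inl (by linarith)),
      integral_rpow (Or.inl (by linarith))]
    rw [Real.zero_rpow (by linarith), Real.zero_rpow (by linarith)]
    rw [sub_add_cancel, Real.rpow_add_one' hx (by linarith), sub_zero, sub_zero]
    field_simp
    ring

/-- The hat function is `1 / τ` times a second difference of ramps, and integrating `y ^ (a - 1)`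
against a ramp gives a positive part to the power `a + 1`. Hence the weights are second differences
of that power. -/
theorem convWeight_beta {a T τ : ℝ} (ha : 0 < a) (hτ : 0 < τ) {k : ℕ} (hk : (k + 1) * τ ≤ T) :
    convWeight (beta a) T τ k
      = τ ^ a / (a * (a + 1) * Real.Gamma a) * powerWeight (a + 1) k := by
  have hT : 0 ≤ T := le_trans (by positivity) hk
  have hi : ∀ x : ℝ, IntervalIntegrable (fun y : ℝ => y ^ (a - 1) * max 0 (x - y)) volume 0 T :=
    fun x => (intervalIntegral.intervalIntegrable_rpow' (by linarith)).mul_continuousOn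
      (by fun_prop)
  have e : convWeight (beta a) T τ k = 1 / (τ * Real.Gamma a) *
      (((∫ y in (0 : ℝ)..T, y ^ (a - 1) * max 0 ((k + 1) * τ - y))
        - 2 * ∫ y in (0 : ℝ)..T, y ^ (a - 1) * max 0 (k * τ - y))
        + ∫ y in (0 : ℝ)..T, y ^ (a - 1) * max 0 ((k - 1) * τ - y)) := by
    rw [← intervalIntegral.integral_const_mul, ← intervalIntegral.integral_sub (hi _)
      ((hi _).const_mul 2), ← intervalIntegral.integral_add ((hi _).sub ((hi _).const_mul 2)) (hi _),
      ← intervalIntegral.integral_const_mul]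
    refine intervalIntegral.integral_congr fun y _ => ?_
    have hh : hat τ (k * τ - y) = 1 / τ * (max 0 ((k + 1) * τ - y) - 2 * max 0 (k * τ - y)
        + max 0 ((k - 1) * τ - y)) := by
      rw [eq_comm, one_div, inv_mul_eq_iff_eq_mul₀ hτ.ne']
      unfold hat
      rw [mul_max_of_nonneg _ _ hτ.le, mul_zero, mul_sub, mul_one, mul_div_cancel₀ _ hτ.ne']
      have a1 : ((k : ℝ) + 1) * τ = k * τ + τ := by ring
      have a2 : ((k : ℝ) - 1) * τ = k * τ - τ := by ring
      rw [a1, a2]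
      generalize (k : ℝ) * τ = x
      rcases le_total x y with h | h
      · rw [abs_of_nonpos (by linarith), max_eq_left (b := x - y) (by linarith),
          max_eq_left (b := x - τ - y) (by linarith)]
        ring_nf
      · rw [abs_of_nonneg (by linarith), max_eq_right (b := x - y) (by linarith),
          max_eq_right (b := x + τ - y) (by linarith)]
        rcases le_total (x - τ) y with h' | h'
        · rw [max_eq_left (b := x - τ - y) (by linarith),
            max_eq_right (b := τ - (x - y)) (by linarith)]
          ring
        · rw [max_eq_right (b := x - τ - y) (by linarith),
            max_eq_left (b := τ - (x - y)) (by linarith)]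
          ring
    have hG := (Real.Gamma_pos_of_pos ha).ne'
    simp only [beta, hh]
    field_simp
  have hG := (Real.Gamma_pos_of_pos ha).ne'
  have m1 : max 0 (((k : ℝ) + 1) * τ) = (k + 1) * τ := max_eq_right (by positivity)
  have m2 : max 0 ((k : ℝ) * τ) = k * τ := max_eq_right (by positivity)
  have m3 : max 0 (((k : ℝ) - 1) * τ) = max 0 ((k : ℝ) - 1) * τ := by
    rw [max_mul_of_nonneg _ _ hτ.le, zero_mul]
  rw [e, integral_rpow_mul_pos_part ha hk hT, integral_rpow_mul_pos_part ha (by nlinarith) hT,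
    integral_rpow_mul_pos_part ha (by nlinarith) hT, m1, m2, m3,
    Real.mul_rpow (by positivity) hτ.le, Real.mul_rpow (by positivity) hτ.le,
    Real.mul_rpow (le_max_left _ _) hτ.le, Real.rpow_add_one hτ.ne', powerWeight]
  field_simp

theorem convWeight_beta_nonneg {a T τ : ℝ} (ha : 0 < a) (hT : 0 ≤ T) (k : ℕ) :
    0 ≤ convWeight (beta a) T τ k :=
  intervalIntegral.integral_nonneg hT fun _ hy => mul_nonneg (beta_nonneg ha hy.1) (hat_nonneg _ _)

theorem sum_convWeight_beta_nonneg {E : Type*} [NormedAddCommGroup E] [InnerProductSpace ℝ E]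
    {a T τ : ℝ} (ha : 0 < a) (ha1 : a ≤ 1) (hτ : 0 < τ) {m : ℕ} (hm : m * τ ≤ T) (φ : ℕ → E) :
    0 ≤ ∑ n ∈ Finset.Icc 1 m, ∑ j ∈ Finset.Icc 1 n,
      convWeight (beta a) T τ (n - j) * inner ℝ (φ j) (φ n) := by
  have hG := Real.Gamma_pos_of_pos ha
  have e : ∑ n ∈ Finset.Icc 1 m, ∑ j ∈ Finset.Icc 1 n,
      convWeight (beta a) T τ (n - j) * inner ℝ (φ j) (φ n)
      = τ ^ a / (a * (a + 1) * Real.Gamma a) * ∑ n ∈ Finset.Icc 1 m, ∑ j ∈ Finset.Icc 1 n,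
        powerWeight (a + 1) (n - j) * inner ℝ (φ j) (φ n) := by
    simp only [Finset.mul_sum]
    refine Finset.sum_congr rfl fun n hn => Finset.sum_congr rfl fun j hj => ?_
    have hn := Finset.mem_Icc.1 hn
    have hj := Finset.mem_Icc.1 hj
    rw [convWeight_beta ha hτ, mul_assoc]
    have : ((n - j : ℕ) : ℝ) + 1 ≤ m := by exact_mod_cast (by omega : n - j + 1 ≤ m)
    nlinarith
  rw [e]
  exact mul_nonneg (by positivity) (sum_powerWeight_nonneg (by linarith) (by linarith) m φ)

theorem intervalIntegrable_mul_hat {g : ℝ → ℝ} {T : ℝ} (hg : IntervalIntegrable g volume 0 T)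
    (τ x : ℝ) : IntervalIntegrable (fun y => g y * hat τ (x - y)) volume 0 T :=
  hg.mul_continuousOn ((continuous_hat τ).comp (by fun_prop)).continuousOn

theorem abs_convWeight_le {g : ℝ → ℝ} {a C T : ℝ} (τ : ℝ) (ha : 0 < a) (hT : 0 ≤ T)
    (h : ∀ y ∈ Ioo 0 T, |g y| ≤ C * beta a y) (k : ℕ) :
    |convWeight g T τ k| ≤ C * convWeight (beta a) T τ k := by
  unfold convWeight
  rw [← intervalIntegral.integral_const_mul, ← Real.norm_eq_abs]
  refine intervalIntegral.norm_integral_le_of_norm_le hT ?_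
    ((intervalIntegrable_mul_hat (intervalIntegrable_beta ha 0 T) τ _).const_mul C)
  filter_upwards [compl_mem_ae_iff.2 (measure_singleton T)] with y hy hyT
  rw [norm_mul, Real.norm_eq_abs, Real.norm_eq_abs, abs_of_nonneg (hat_nonneg _ _), ← mul_assoc]
  exact mul_le_mul_of_nonneg_right (h y ⟨hyT.1, lt_of_le_of_ne hyT.2 hy⟩) (hat_nonneg _ _)

theorem sum_convWeight_beta_mul_exp_le {a T τ κ : ℝ} (ha : 0 < a) (hT : 0 ≤ T) (hτ : 0 < τ)
    (hκ : 0 ≤ κ) (N : ℕ) :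
    ∑ k ∈ Finset.range N, convWeight (beta a) T τ k * Real.exp (-κ * τ) ^ k
      ≤ Real.exp (κ * τ) * ∫ y in (0 : ℝ)..T, beta a y * Real.exp (-κ * y) := by
  have hi := intervalIntegrable_beta ha 0 T
  simp only [convWeight, ← intervalIntegral.integral_mul_const]
  rw [← intervalIntegral.integral_finsetSum fun k _ =>
    (intervalIntegrable_mul_hat hi τ _).mul_const _, ← intervalIntegral.integral_const_mul]
  have hsum := IntervalIntegrable.sum (Finset.range N) fun (k : ℕ) _ =>
    (intervalIntegrable_mul_hat hi τ (k * τ)).mul_const (Real.exp (-κ * τ) ^ k)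
  refine intervalIntegral.integral_mono_on hT (by simpa only [Finset.sum_fn] using hsum)
    ((hi.mul_continuousOn (by fun_prop)).const_mul _) fun y hy => ?_
  simp only [mul_assoc]
  rw [← Finset.mul_sum]
  calc _ ≤ beta a y * (Real.exp (κ * τ) * Real.exp (-κ * y)) :=
        mul_le_mul_of_nonneg_left (sum_hat_mul_exp_le hτ hκ hy.1 N) (beta_nonneg ha hy.1)
    _ = _ := by ring

theorem integral_beta {a T : ℝ} (ha : 0 < a) :
    ∫ y in (0 : ℝ)..T, beta a y = T ^ a / (a * Real.Gamma a) := by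
  unfold beta
  rw [intervalIntegral.integral_div, integral_rpow (Or.inl (by linarith)), sub_add_cancel,
    Real.zero_rpow ha.ne']
  field_simp
  simp

theorem sum_convWeight_beta_le {a T τ : ℝ} (ha : 0 < a) (hT : 0 ≤ T) (hτ : 0 < τ) (N : ℕ) :
    ∑ k ∈ Finset.range N, convWeight (beta a) T τ k ≤ T ^ a / (a * Real.Gamma a) := by
  have := sum_convWeight_beta_mul_exp_le ha hT hτ le_rfl N
  simpa [integral_beta ha] using this

/-- The Laplace transform of `β_a` at `κ` is `κ ^ (-a)`, and truncating a nonnegative integrand only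
decreases the integral. -/
theorem integral_beta_mul_exp_le {a T κ : ℝ} (ha : 0 < a) (hT : 0 ≤ T) (hκ : 0 < κ) :
    ∫ y in (0 : ℝ)..T, beta a y * Real.exp (-κ * y) ≤ (1 / κ) ^ a := by
  have hG := Real.Gamma_pos_of_pos ha
  have e := Real.integral_rpow_mul_exp_neg_mul_Ioi ha hκ
  have hint : IntegrableOn (fun t : ℝ => t ^ (a - 1) * Real.exp (-(κ * t))) (Ioi 0) := by
    -- A nonintegrable function has integral `0` by convention, whereas the Gamma integral is
    -- positive.
    by_contra h
    rw [integral_undef h] at e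
    have : 0 < (1 / κ) ^ a * Real.Gamma a := by positivity
    linarith
  rw [intervalIntegral.integral_of_le hT]
  have h1 : ∫ y in Ioc 0 T, beta a y * Real.exp (-κ * y)
      = 1 / Real.Gamma a * ∫ y in Ioc 0 T, y ^ (a - 1) * Real.exp (-(κ * y)) := by
    rw [← integral_const_mul]
    refine integral_congr_ae (Filter.Eventually.of_forall fun y => ?_)
    simp only [beta, neg_mul]
    ring
  rw [h1]
  have h2 : ∫ y in Ioc 0 T, y ^ (a - 1) * Real.exp (-(κ * y)) ≤ (1 / κ) ^ a * Real.Gamma a := by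
    rw [← e]
    refine setIntegral_mono_set hint ?_ Ioc_subset_Ioi_self.eventuallyLE
    refine (ae_restrict_iff' measurableSet_Ioi).2 (Filter.Eventually.of_forall fun y hy => ?_)
    exact mul_nonneg (Real.rpow_nonneg (le_of_lt hy) _) (Real.exp_pos _).le
  calc _ ≤ 1 / Real.Gamma a * ((1 / κ) ^ a * Real.Gamma a) :=
        mul_le_mul_of_nonneg_left h2 (by positivity)
    _ = _ := by field_simp

/-! ### The kernel `q'` -/

theorem intervalIntegrable_betaKernel {p q : ℝ} (hp : 0 < p) (hq : 0 < q) :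
    IntervalIntegrable (fun u : ℝ => (1 - u) ^ (p - 1) * u ^ (q - 1)) volume 0 1 := by
  have h := (Complex.betaIntegral_convergent (u := (q : ℂ)) (v := (p : ℂ)) (by simpa)
    (by simpa)).norm
  refine h.congr_ae ?_
  rw [uIoc_of_le zero_le_one]
  filter_upwards [ae_restrict_mem measurableSet_Ioc,
    ae_restrict_of_ae (compl_mem_ae_iff.2 (measure_singleton (1 : ℝ)))] with u hu hu1
  have h0 : 0 < 1 - u := sub_pos.2 (lt_of_le_of_ne hu.2 hu1)
  have e : (1 : ℂ) - (u : ℂ) = ((1 - u : ℝ) : ℂ) := by push_cast; ring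
  rw [norm_mul, e, Complex.norm_cpow_eq_rpow_re_of_pos hu.1, Complex.norm_cpow_eq_rpow_re_of_pos h0]
  simp [mul_comm]

/-- The reciprocal of Gamma is entire, so working with it avoids all questions about poles. -/
theorem contDiff_inv_Gamma : ContDiff ℝ 1 fun x : ℝ => (Real.Gamma x)⁻¹ := by
  have h : ContDiff ℂ 1 fun s : ℂ => (Complex.Gamma s)⁻¹ :=
    Complex.differentiable_one_div_Gamma.contDiff
  have h2 : ContDiff ℝ 1 fun x : ℝ => Complex.reCLM (Complex.Gamma (Complex.ofRealCLM x))⁻¹ :=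
    Complex.reCLM.contDiff.comp ((h.restrict_scalars ℝ).comp Complex.ofRealCLM.contDiff)
  convert h2 using 2 with x
  simp only [Complex.ofRealCLM_apply, Complex.Gamma_ofReal, ← Complex.ofReal_inv]
  rfl

theorem exists_lipschitz_inv_Gamma (c d : ℝ) :
    ∃ L, 0 ≤ L ∧ ∀ x ∈ Icc c d, ∀ y ∈ Icc c d,
      |(Real.Gamma x)⁻¹ - (Real.Gamma y)⁻¹| ≤ L * |x - y| := by
  obtain ⟨L, hL⟩ := isCompact_Icc.exists_bound_of_continuousOn
    (contDiff_inv_Gamma.continuous_deriv le_rfl).continuousOn (s := Icc c d)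
  refine ⟨max L 0, le_max_right _ _, fun x hx y hy => ?_⟩
  exact (convex_Icc c d).norm_image_sub_le_of_norm_deriv_le
    (fun z _ => (contDiff_inv_Gamma.differentiable one_ne_zero) z)
    (fun z hz => (hL z hz).trans (le_max_left _ _)) hy hx

theorem BlackScholesFEM.MemW1Infty.exists_lipschitz {T : ℝ} {g : ℝ → ℝ} (hg : MemW1Infty T g) :
    ∃ M, 0 ≤ M ∧ ∀ s ∈ Icc 0 T, ∀ t ∈ Icc 0 T, |g t - g s| ≤ M * |t - s| := by
  obtain ⟨g', hd, M, hM⟩ := hg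
  refine ⟨max M 0, le_max_right _ _, ?_⟩
  have main : ∀ s ∈ Icc 0 T, ∀ t ∈ Icc 0 T, s ≤ t → |g t - g s| ≤ max M 0 * |t - s| := by
    intro s hs t ht hst
    rw [(hd s hs t ht hst).2, ← Real.norm_eq_abs]
    refine intervalIntegral.norm_integral_le_of_norm_le_const_ae ?_
    rw [ae_restrict_iff' measurableSet_Ioo] at hM
    rw [uIoc_of_le hst]
    filter_upwards [hM, compl_mem_ae_iff.2 (measure_singleton T)] with y hy hyT hyst
    exact (hy ⟨lt_of_le_of_lt hs.1 hyst.1, lt_of_le_of_ne (hyst.2.trans ht.2) hyT⟩).trans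
      (le_max_left _ _)
  intro s hs t ht
  rcases le_total s t with h | h
  · exact main s hs t ht h
  · rw [abs_sub_comm, abs_sub_comm t]; exact main t ht s hs h

theorem exists_abs_log_le {ε : ℝ} (hε : 0 < ε) (T : ℝ) :
    ∃ C, 0 ≤ C ∧ ∀ x ∈ Ioc 0 T, |Real.log x| ≤ C * x ^ (-ε) := by
  rcases le_total T 0 with hT | hT
  · exact ⟨0, le_rfl, fun x hx => absurd (hx.1.trans_le hx.2) (not_lt.2 hT)⟩
  refine ⟨(T ^ (2 * ε) + 1) / ε, by positivity, fun x hx => ?_⟩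
  have hx0 := hx.1
  have h1 := Real.log_le_rpow_div hx0.le hε
  have h2 := Real.log_le_rpow_div (inv_nonneg.2 hx0.le) hε
  rw [Real.log_inv, Real.inv_rpow hx0.le, ← Real.rpow_neg hx0.le] at h2
  have h3 : x ^ ε ≤ T ^ (2 * ε) * x ^ (-ε) := by
    have : x ^ ε = x ^ (2 * ε) * x ^ (-ε) := by rw [← Real.rpow_add hx0]; ring_nf
    rw [this]
    exact mul_le_mul_of_nonneg_right (Real.rpow_le_rpow hx0.le hx.2 (by positivity))
      (by positivity)
  have h4 : 0 < x ^ ε := by positivity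
  have h5 : 0 < x ^ (-ε) := by positivity
  have h6 : 0 ≤ T ^ (2 * ε) * x ^ (-ε) := by positivity
  rw [div_mul_eq_mul_div, abs_le]
  constructor
  · rw [neg_le]
    refine h2.trans ((div_le_div_iff_of_pos_right hε).2 ?_)
    linarith
  · refine h1.trans ((div_le_div_iff_of_pos_right hε).2 ?_)
    linarith

/-- The bounded factor `t ^ α(0) k(t)` of the variable-exponent kernel. -/
noncomputable def kernFactor (α : ℝ → ℝ) (x : ℝ) : ℝ :=
  x ^ (α 0 - α x) * (Real.Gamma (1 - α x))⁻¹

theorem abs_exp_sub_exp_le {u v B : ℝ} (hu : u ≤ B) (hv : v ≤ B) :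
    |Real.exp u - Real.exp v| ≤ Real.exp B * |u - v| := by
  refine (convex_Iic B).norm_image_sub_le_of_norm_deriv_le
    (fun z _ => Real.differentiable_exp z) (fun z hz => ?_) hv hu
  rw [Real.deriv_exp, Real.norm_eq_abs, Real.abs_exp]
  exact Real.exp_le_exp.2 hz

theorem BlackScholesFEM.AdmissibleExponent.zero_mem {T : ℝ} (hT : 0 < T) {α : ℝ → ℝ} (hα : AdmissibleExponent T α) :
    0 < α 0 ∧ α 0 < 1 := by
  have h0 : (0 : ℝ) ∈ Icc 0 T := ⟨le_rfl, hT.le⟩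
  obtain ⟨s, hs, h⟩ := hα.le
  exact ⟨hα.pos 0 h0, (h 0 h0).trans_lt hs⟩

/-- Write the power as `exp (e x)` with `e x = log x * (α 0 - α x)`. Since `α` is Lipschitz, `α 0 -
α x` is `O(x)` and compensates the logarithm, so `e` is bounded; its increments are controlled by
`|log x|`, hence by a multiple of `x ^ (α 0 - 1)`. The reciprocal Gamma factor is Lipschitz. -/
theorem exists_kernFactor_bound {T : ℝ} (hT : 0 < T) {α : ℝ → ℝ} (hα : AdmissibleExponent T α) :
    ∃ C, 0 ≤ C ∧ (∀ x ∈ Ioc 0 T, |kernFactor α x| ≤ C) ∧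
      ∀ y ∈ Ioc 0 T, ∀ x ∈ Ioc 0 T, y ≤ x →
        |kernFactor α x - kernFactor α y| ≤ C * y ^ (α 0 - 1) * (x - y) := by
  obtain ⟨ha0, ha1⟩ := hα.zero_mem hT
  obtain ⟨M, hM0, hM⟩ := MemW1Infty.exists_lipschitz hα.memW
  obtain ⟨s, hs, hαs⟩ := hα.le
  obtain ⟨G, hG0, hG⟩ := exists_lipschitz_inv_Gamma (1 - s) 1
  obtain ⟨G', hG'⟩ := isCompact_Icc.exists_bound_of_continuousOn
    contDiff_inv_Gamma.continuous.continuousOn (s := Icc (1 - s) 1)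
  obtain ⟨D, hD0, hD⟩ := exists_abs_log_le (ε := 1 - α 0) (by linarith) T
  rw [neg_sub] at hD
  have h0 : (0 : ℝ) ∈ Icc 0 T := ⟨le_rfl, hT.le⟩
  have hIcc : ∀ x ∈ Ioc 0 T, x ∈ Icc 0 T := fun x hx => ⟨hx.1.le, hx.2⟩
  have hmem : ∀ x ∈ Ioc 0 T, 1 - α x ∈ Icc (1 - s) 1 := fun x hx =>
    ⟨by linarith [hαs x (hIcc x hx)], by linarith [hα.pos x (hIcc x hx)]⟩
  have hG'0 : 0 ≤ G' := (norm_nonneg _).trans (hG' _ (hmem T ⟨hT, le_rfl⟩))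
  set B := M * (D * T ^ α 0) with hB
  set e : ℝ → ℝ := fun x => Real.log x * (α 0 - α x) with he
  have eB : ∀ x ∈ Ioc 0 T, e x ≤ B := by
    intro x hx
    refine (le_abs_self _).trans ?_
    have h1 := hM x (hIcc x hx) 0 h0
    have h2 := hD x hx
    rw [zero_sub, abs_neg, abs_of_pos hx.1] at h1
    have h3 : x ^ (α 0 - 1) * x ≤ T ^ α 0 := by
      rw [← Real.rpow_add_one hx.1.ne', sub_add_cancel]
      exact Real.rpow_le_rpow hx.1.le hx.2 ha0.le
    calc |e x| = |Real.log x| * |α 0 - α x| := abs_mul _ _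
      _ ≤ (D * x ^ (α 0 - 1)) * (M * x) := by
        have := hx.1
        exact mul_le_mul h2 h1 (abs_nonneg _) (by positivity)
      _ = M * (D * (x ^ (α 0 - 1) * x)) := by ring
      _ ≤ B := by rw [hB]; gcongr
  have erep : ∀ x ∈ Ioc 0 T, kernFactor α x = Real.exp (e x) * (Real.Gamma (1 - α x))⁻¹ :=
    fun x hx => by rw [kernFactor, Real.rpow_def_of_pos hx.1]
  have elip : ∀ y ∈ Ioc 0 T, ∀ x ∈ Ioc 0 T, y ≤ x →
      |e x - e y| ≤ M * (T ^ (1 - α 0) + D) * y ^ (α 0 - 1) * (x - y) := by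
    intro y hy x hx hyx
    have hy0 := hy.1
    have hpow : x ^ (α 0 - 1) ≤ y ^ (α 0 - 1) :=
      Real.rpow_le_rpow_of_nonpos hy.1 hyx (by linarith)
    have h1 : |α 0 - α y| ≤ M * y := by
      have := hM y (hIcc y hy) 0 h0
      rwa [zero_sub, abs_neg, abs_of_pos hy.1] at this
    have h2 : |α y - α x| ≤ M * (x - y) := by
      have := hM x (hIcc x hx) y (hIcc y hy)
      rwa [abs_sub_comm y, abs_of_nonneg (sub_nonneg.2 hyx)] at this
    have h3 : |Real.log x| ≤ D * y ^ (α 0 - 1) :=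
      (hD x hx).trans (mul_le_mul_of_nonneg_left hpow hD0)
    have h4 : |Real.log x - Real.log y| ≤ (x - y) / y := by
      rw [abs_of_nonneg (sub_nonneg.2 (Real.log_le_log hy.1 hyx)),
        ← Real.log_div hx.1.ne' hy.1.ne']
      refine (Real.log_le_sub_one_of_pos (div_pos hx.1 hy.1)).trans (le_of_eq ?_)
      field_simp
    have h5 : 1 ≤ T ^ (1 - α 0) * y ^ (α 0 - 1) := by
      calc (1 : ℝ) = y ^ (1 - α 0) * y ^ (α 0 - 1) := by
            rw [← Real.rpow_add hy.1]; simp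
        _ ≤ _ := mul_le_mul_of_nonneg_right
            (Real.rpow_le_rpow hy.1.le hy.2 (by linarith)) (by positivity)
    have hxy : 0 ≤ x - y := sub_nonneg.2 hyx
    -- In this splitting the increment of the logarithm, at most `(x - y) / y`, meets `|α 0 - α y| ≤
    -- M y`, so the singular factor `1 / y` cancels.
    calc |e x - e y| = |(α 0 - α y) * (Real.log x - Real.log y) + (α y - α x) * Real.log x| := by
          simp only [he]; ring_nf
      _ ≤ |α 0 - α y| * |Real.log x - Real.log y| + |α y - α x| * |Real.log x| := by
          rw [← abs_mul, ← abs_mul]; exact abs_add_le _ _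
      _ ≤ (M * y) * ((x - y) / y) + (M * (x - y)) * (D * y ^ (α 0 - 1)) := by gcongr
      _ = (M * (x - y)) * (1 + D * y ^ (α 0 - 1)) := by field_simp
      _ ≤ (M * (x - y)) * (T ^ (1 - α 0) * y ^ (α 0 - 1) + D * y ^ (α 0 - 1)) := by gcongr
      _ = _ := by ring
  refine ⟨Real.exp B * G' + Real.exp B * (M * (T ^ (1 - α 0) + D)) * G'
    + Real.exp B * (G * M * T ^ (1 - α 0)), by positivity, fun x hx => ?_, fun y hy x hx hyx => ?_⟩
  · rw [erep x hx, abs_mul, Real.abs_exp]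
    have h1 : |(Real.Gamma (1 - α x))⁻¹| ≤ G' := hG' _ (hmem x hx)
    have h2 := Real.exp_le_exp.2 (eB x hx)
    have h3 : Real.exp (e x) * |(Real.Gamma (1 - α x))⁻¹| ≤ Real.exp B * G' := by gcongr
    have h4 : 0 ≤ Real.exp B * (M * (T ^ (1 - α 0) + D)) * G' := by positivity
    have h5 : 0 ≤ Real.exp B * (G * M * T ^ (1 - α 0)) := by positivity
    linarith
  · have hy0 := hy.1
    have hxy : 0 ≤ x - y := sub_nonneg.2 hyx
    have h1 : |(Real.Gamma (1 - α x))⁻¹| ≤ G' := hG' _ (hmem x hx)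
    have h2 : |(Real.Gamma (1 - α x))⁻¹ - (Real.Gamma (1 - α y))⁻¹| ≤ G * (M * (x - y)) := by
      refine (hG _ (hmem x hx) _ (hmem y hy)).trans (mul_le_mul_of_nonneg_left ?_ hG0)
      have := hM x (hIcc x hx) y (hIcc y hy)
      rw [abs_sub_comm y, abs_of_nonneg hxy] at this
      rwa [sub_sub_sub_cancel_left]
    have h3 := abs_exp_sub_exp_le (eB x hx) (eB y hy)
    have h4 := elip y hy x hx hyx
    have h5 : 1 ≤ T ^ (1 - α 0) * y ^ (α 0 - 1) := by
      calc (1 : ℝ) = y ^ (1 - α 0) * y ^ (α 0 - 1) := by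
            rw [← Real.rpow_add hy.1]; simp
        _ ≤ _ := mul_le_mul_of_nonneg_right
            (Real.rpow_le_rpow hy.1.le hy.2 (by linarith)) (by positivity)
    have h6 := Real.exp_le_exp.2 (eB y hy)
    rw [erep x hx, erep y hy]
    calc |Real.exp (e x) * (Real.Gamma (1 - α x))⁻¹ - Real.exp (e y) * (Real.Gamma (1 - α y))⁻¹|
        = |(Real.exp (e x) - Real.exp (e y)) * (Real.Gamma (1 - α x))⁻¹
          + Real.exp (e y) * ((Real.Gamma (1 - α x))⁻¹ - (Real.Gamma (1 - α y))⁻¹)| := by ring_nf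
      _ ≤ |Real.exp (e x) - Real.exp (e y)| * |(Real.Gamma (1 - α x))⁻¹|
          + Real.exp (e y) * |(Real.Gamma (1 - α x))⁻¹ - (Real.Gamma (1 - α y))⁻¹| := by
          refine (abs_add_le _ _).trans (le_of_eq ?_)
          rw [abs_mul, abs_mul, Real.abs_exp]
      _ ≤ (Real.exp B * (M * (T ^ (1 - α 0) + D) * y ^ (α 0 - 1) * (x - y))) * G'
          + Real.exp B * (G * (M * (x - y))) := by
          gcongr
          exact h3.trans (by gcongr)
      -- The added last term is nonnegative; it lets one constant serve both the uniform bound and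
      -- the increment bound.
      _ ≤ (Real.exp B * (M * (T ^ (1 - α 0) + D) * y ^ (α 0 - 1) * (x - y))) * G'
          + Real.exp B * (G * (M * (x - y))) * (T ^ (1 - α 0) * y ^ (α 0 - 1))
          + (Real.exp B * G') * y ^ (α 0 - 1) * (x - y) := by
          have : 0 ≤ Real.exp B * (G * (M * (x - y))) := by positivity
          have h7 : 0 ≤ (Real.exp B * G') * y ^ (α 0 - 1) * (x - y) := by positivity
          nlinarith
      _ = _ := by ring

theorem continuousOn_kernFactor {T : ℝ} {α : ℝ → ℝ} (hα : AdmissibleExponent T α) :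
    ContinuousOn (kernFactor α) (Ioc 0 T) := by
  obtain ⟨M, hM0, hM⟩ := MemW1Infty.exists_lipschitz hα.memW
  have hc : ContinuousOn α (Ioc 0 T) := by
    refine (LipschitzOnWith.of_dist_le_mul (K := ⟨M, hM0⟩) fun x hx y hy => ?_).continuousOn
    rw [Real.dist_eq, Real.dist_eq]
    exact hM y ⟨hy.1.le, hy.2⟩ x ⟨hx.1.le, hx.2⟩
  unfold kernFactor
  refine ContinuousOn.mul (continuousOn_id.rpow (continuousOn_const.sub hc)
    fun x hx => Or.inl hx.1.ne') ?_
  exact contDiff_inv_Gamma.continuous.comp_continuousOn (continuousOn_const.sub hc)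

/-- Substituting `s = t u`, the powers `t ^ (α 0 - 1)`, `t ^ (-α 0)` and `t` cancel. All dependence
on `t` now sits in the factor `kernFactor α (t * u)`, whose increments are under control. -/
theorem qfun_eq {α : ℝ → ℝ} {t : ℝ} (ht : 0 < t) :
    qfun α t = (Real.Gamma (α 0))⁻¹ *
      ∫ u in (0 : ℝ)..1, (1 - u) ^ (α 0 - 1) * u ^ ((1 - α 0) - 1) * kernFactor α (t * u) := by
  have h := intervalIntegral.mul_integral_comp_mul_left (a := 0) (b := 1)
    (f := fun s => beta (α 0) (t - s) * kern α s) t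
  rw [mul_zero, mul_one] at h
  unfold qfun conv
  simp only [smul_eq_mul]
  rw [← h, ← intervalIntegral.integral_const_mul, ← intervalIntegral.integral_const_mul,
    intervalIntegral.integral_of_le zero_le_one, intervalIntegral.integral_of_le zero_le_one]
  refine setIntegral_congr_fun measurableSet_Ioc fun u hu => ?_
  have hu0 : 0 < u := hu.1
  have h1 : t - t * u = t * (1 - u) := by ring
  have e1 : t ^ (α 0 - 1) * t ^ (1 - α 0) = 1 := by rw [← Real.rpow_add ht]; simp
  have e2 : (t * u) ^ (-α (t * u)) = t ^ (1 - α 0) * u ^ (1 - α 0 - 1) * (t * u) ^ (α 0 - α (t * u))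
      / t := by
    have : t ^ (1 - α 0) = t ^ (1 - α 0 - 1) * t := by
      rw [← Real.rpow_add_one ht.ne', sub_add_cancel]
    rw [this, mul_right_comm _ t, ← Real.mul_rpow ht.le hu0.le, mul_right_comm, mul_div_cancel_right₀
      _ ht.ne', ← Real.rpow_add (by positivity)]
    ring_nf
  simp only [beta, kern, kernFactor, h1]
  rw [Real.mul_rpow ht.le (by linarith [hu.2]), e2]
  have e3 : t * t⁻¹ = 1 := mul_inv_cancel₀ ht.ne'
  set Y := (1 - u) ^ (α 0 - 1)
  set X := u ^ (1 - α 0 - 1)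
  set Z := (t * u) ^ (α 0 - α (t * u))
  linear_combination (t ^ (α 0 - 1) * t ^ (1 - α 0) * X * Y * Z * (Real.Gamma (α 0))⁻¹ *
    (Real.Gamma (1 - α (t * u)))⁻¹) * e3 + (X * Y * Z * (Real.Gamma (α 0))⁻¹ *
    (Real.Gamma (1 - α (t * u)))⁻¹) * e1

/-- The increment bound for `kernFactor` at `s u` and `t u` contributes `u ^ (α 0 - 1) * u`, which
cancels the singular weight `u ^ (-α 0)`. Thus `|q t - q s|` is at most a constant times `s ^ (α 0 -
1) * (t - s)` for `s ≤ t`. -/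
theorem exists_abs_deriv_qfun_le {T : ℝ} (hT : 0 < T) {α : ℝ → ℝ} (hα : AdmissibleExponent T α) :
    ∃ C, 0 ≤ C ∧ ∀ t ∈ Ioo 0 T, |deriv (qfun α) t| ≤ C * beta (α 0) t := by
  obtain ⟨ha0, ha1⟩ := hα.zero_mem hT
  obtain ⟨C, hC0, hC, hlip⟩ := exists_kernFactor_bound hT hα
  have hG := Real.Gamma_pos_of_pos ha0
  have hint : ∀ t ∈ Ioc 0 T, IntervalIntegrable (fun u : ℝ =>
      (1 - u) ^ (α 0 - 1) * u ^ ((1 - α 0) - 1) * kernFactor α (t * u)) volume 0 1 := by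
    intro t ht
    have hmaps : MapsTo (fun u => t * u) (Ioc 0 1) (Ioc 0 T) := fun u hu =>
      ⟨mul_pos ht.1 hu.1, (mul_le_of_le_one_right ht.1.le hu.2).trans ht.2⟩
    have hb := intervalIntegrable_betaKernel ha0 (sub_pos.2 ha1)
    rw [intervalIntegrable_iff_integrableOn_Ioc_of_le zero_le_one] at hb ⊢
    refine Integrable.mul_bdd (c := C) hb ?_ ?_
    · exact ((continuousOn_kernFactor hα).comp (by fun_prop) hmaps).aestronglyMeasurable
        measurableSet_Ioc
    · filter_upwards [ae_restrict_mem measurableSet_Ioc] with u hu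
      exact hC _ (hmaps hu)
  have hI := intervalIntegral.intervalIntegrable_rpow' (a := 0) (b := 1) (r := α 0 - 1)
    (by linarith)
  have hI' : IntervalIntegrable (fun u : ℝ => (1 - u) ^ (α 0 - 1)) volume 0 1 := by
    have := (hI.comp_sub_left 1).symm
    simpa using this
  set J := ∫ u in (0 : ℝ)..1, (1 - u) ^ (α 0 - 1) with hJ
  have hJ0 : 0 ≤ J := intervalIntegral.integral_nonneg zero_le_one
    fun u hu => Real.rpow_nonneg (by linarith [hu.2]) _
  have key : ∀ s ∈ Ioc 0 T, ∀ t ∈ Ioc 0 T, s ≤ t →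
      |qfun α t - qfun α s| ≤ (Real.Gamma (α 0))⁻¹ * (C * J) * s ^ (α 0 - 1) * (t - s) := by
    intro s hs t ht hst
    have hs0 := hs.1
    have ht0 := ht.1
    rw [qfun_eq hs.1, qfun_eq ht.1, ← mul_sub, ← intervalIntegral.integral_sub (hint t ht) (hint s hs),
      abs_mul, abs_of_pos (inv_pos.2 hG), mul_assoc, mul_assoc]
    refine mul_le_mul_of_nonneg_left ?_ (inv_pos.2 hG).le
    rw [show C * J * (s ^ (α 0 - 1) * (t - s)) = (C * s ^ (α 0 - 1) * (t - s)) * J by ring, hJ,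
      ← intervalIntegral.integral_const_mul, ← Real.norm_eq_abs]
    refine intervalIntegral.norm_integral_le_of_norm_le zero_le_one
      (Filter.Eventually.of_forall fun u hu => ?_) (hI'.const_mul _)
    have hu0 := hu.1
    have h1 := hlip (s * u) ⟨by positivity, (mul_le_of_le_one_right hs.1.le hu.2).trans hs.2⟩
      (t * u) ⟨by positivity, (mul_le_of_le_one_right ht.1.le hu.2).trans ht.2⟩ (by gcongr)
    have h1u : 0 ≤ 1 - u := by linarith [hu.2]
    rw [← mul_sub, norm_mul, Real.norm_eq_abs, Real.norm_eq_abs, abs_of_nonneg (by positivity)]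
    calc _ ≤ (1 - u) ^ (α 0 - 1) * u ^ (1 - α 0 - 1)
          * (C * (s * u) ^ (α 0 - 1) * (t * u - s * u)) :=
          mul_le_mul_of_nonneg_left h1 (by positivity)
      _ = C * s ^ (α 0 - 1) * (t - s) * (1 - u) ^ (α 0 - 1)
          * (u ^ (1 - α 0 - 1) * u ^ (α 0 - 1) * u) := by
          rw [Real.mul_rpow hs.1.le hu0.le]; ring
      _ = _ := by
          rw [← Real.rpow_add hu0, ← Real.rpow_add_one hu0.ne',
            show 1 - α 0 - 1 + (α 0 - 1) + 1 = 0 by ring, Real.rpow_zero, mul_one]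
  -- Near `t` both points of an increment exceed `t / 2`, which costs the factor `(1 / 2) ^ (α 0 -
  -- 1)`. A local Lipschitz bound at `t` controls `deriv` even without differentiability, where its
  -- value is `0`.
  refine ⟨C * J * (2 : ℝ)⁻¹ ^ (α 0 - 1), by positivity, fun t ht => ?_⟩
  have ht0 := ht.1
  rw [← Real.norm_eq_abs]
  refine norm_deriv_le_of_lip' (mul_nonneg (by positivity) (beta_nonneg ha0 ht.1.le)) ?_
  filter_upwards [Ioo_mem_nhds (half_lt_self ht.1) ht.2] with x hx
  have hx0 : 0 < x := (half_pos ht.1).trans hx.1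
  have hpow : ∀ y, t / 2 ≤ y → y ^ (α 0 - 1) ≤ (2 : ℝ)⁻¹ ^ (α 0 - 1) * t ^ (α 0 - 1) := by
    intro y hy
    rw [← Real.mul_rpow (by norm_num) ht.1.le]
    exact Real.rpow_le_rpow_of_nonpos (by positivity) (by linarith) (by linarith)
  have fin : ∀ y, t / 2 ≤ y → ∀ d, 0 ≤ d →
      (Real.Gamma (α 0))⁻¹ * (C * J) * y ^ (α 0 - 1) * d
      ≤ C * J * (2 : ℝ)⁻¹ ^ (α 0 - 1) * beta (α 0) t * d := by
    intro y hy d hd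
    calc _ ≤ (Real.Gamma (α 0))⁻¹ * (C * J) * ((2 : ℝ)⁻¹ ^ (α 0 - 1) * t ^ (α 0 - 1)) * d := by
          gcongr
          exact hpow y hy
      _ = _ := by unfold beta; ring
  rw [Real.norm_eq_abs, Real.norm_eq_abs]
  rcases le_total x t with h | h
  · rw [abs_sub_comm, abs_sub_comm x, abs_of_nonneg (sub_nonneg.2 h)]
    exact (key x ⟨hx0, hx.2.le⟩ t ⟨ht.1, ht.2.le⟩ h).trans (fin x hx.1.le _ (sub_nonneg.2 h))
  · rw [abs_of_nonneg (sub_nonneg.2 h)]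
    exact (key t ⟨ht.1, ht.2.le⟩ x ⟨hx0, hx.2.le⟩ h).trans
      (fin t (by linarith) _ (sub_nonneg.2 h))

/-! ### Linear interpolation in time -/

section Interpolation

variable {E : Type*} [NormedAddCommGroup E] [NormedSpace ℝ E]

/-- The error of linear interpolation on `[p, q]`, in terms of the oscillation of the derivative. -/
theorem norm_sub_linear_interp_le [CompleteSpace E] {u v : ℝ → E} {p q B : ℝ} (hpq : p < q)
    (hv : IntervalIntegrable v volume p q)
    (hu : ∀ x ∈ Icc p q, u x - u p = ∫ y in p..x, v y)
    (hB : ∀ x ∈ Icc p q, ‖v x - v p‖ ≤ B) {s : ℝ} (hs : s ∈ Icc p q) :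
    ‖u s - (((q - s) / (q - p)) • u p + ((s - p) / (q - p)) • u q)‖ ≤ 2 * (q - p) * B := by
  -- Subtracting the affine function with slope `v p` does not change the interpolation error.
  set z : ℝ → E := fun x => u x - u p - (x - p) • v p with hz
  have hzB : ∀ x ∈ Icc p q, ‖z x‖ ≤ B * (x - p) := by
    intro x hx
    have hvx : IntervalIntegrable v volume p x := hv.mono_set (by
      rw [uIcc_of_le hx.1, uIcc_of_le hpq.le]; exact Icc_subset_Icc_right hx.2)
    have e : z x = ∫ y in p..x, (v y - v p) := by
      rw [intervalIntegral.integral_sub hvx (by simp), intervalIntegral.integral_const, ← hu x hx]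
    rw [e]
    refine (intervalIntegral.norm_integral_le_of_norm_le_const fun y hy => ?_).trans
      (le_of_eq (by rw [abs_of_nonneg (sub_nonneg.2 hx.1)]))
    rw [uIoc_of_le hx.1] at hy
    exact hB y ⟨hy.1.le, hy.2.trans hx.2⟩
  have hqp : 0 < q - p := sub_pos.2 hpq
  have e : u s - (((q - s) / (q - p)) • u p + ((s - p) / (q - p)) • u q)
      = z s - ((s - p) / (q - p)) • z q := by
    have h1 : (q - s) / (q - p) = 1 - (s - p) / (q - p) := by field_simp; ring
    have h2 : (s - p) = ((s - p) / (q - p)) * (q - p) := by field_simp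
    simp only [hz]
    rw [h1, smul_sub, smul_sub, smul_smul, ← h2]
    module
  have hB0 : 0 ≤ B := (norm_nonneg _).trans (hB s hs)
  have hθ0 : 0 ≤ (s - p) / (q - p) := div_nonneg (sub_nonneg.2 hs.1) hqp.le
  have hθ1 : (s - p) / (q - p) ≤ 1 := (div_le_one hqp).2 (by linarith [hs.2])
  have h1 := hzB s hs
  have h2 := hzB q ⟨hpq.le, le_rfl⟩
  rw [e]
  calc _ ≤ ‖z s‖ + (s - p) / (q - p) * ‖z q‖ := by
        refine (norm_sub_le _ _).trans (le_of_eq ?_)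
        rw [norm_smul, Real.norm_of_nonneg hθ0]
    _ ≤ B * (s - p) + 1 * (B * (q - p)) := by gcongr
    _ ≤ _ := by nlinarith [hs.2]

end Interpolation

/-! ### Functions of time with a weak singularity at the origin -/

section TimeRegularity

variable {E : Type*} [NormedAddCommGroup E] [NormedSpace ℝ E]

/-- `ω(0) = 0` and `t ‖ω''(t)‖ + ‖ω'(t)‖ ≤ K t ^ (a - 1)`. -/
structure SingularAtZero (T a K : ℝ) (ω ω₁ ω₂ : ℝ → E) : Prop where
  zero : ω 0 = 0
  deriv₁ : IsTimeDerivOn (Icc 0 T) ω ω₁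
  deriv₂ : IsTimeDerivOn (Ioc 0 T) ω₁ ω₂
  bound : ∀ᵐ t ∂(volume.restrict (Ioc 0 T)), t * ‖ω₂ t‖ + ‖ω₁ t‖ ≤ K * t ^ (a - 1)

namespace SingularAtZero

variable {T a K : ℝ} {ω ω₁ ω₂ : ℝ → E}

theorem norm_le (h : SingularAtZero T a K ω ω₁ ω₂) (ha : 0 < a) {s : ℝ} (hs : s ∈ Icc 0 T) :
    ‖ω s‖ ≤ K / a * s ^ a := by
  have h0 : (0 : ℝ) ∈ Icc 0 T := ⟨le_rfl, hs.1.trans hs.2⟩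
  have e := (h.deriv₁ 0 h0 s hs hs.1).2
  rw [h.zero, sub_zero] at e
  rw [e]
  have hb := (ae_restrict_iff' measurableSet_Ioc).1 h.bound
  have hi : IntervalIntegrable (fun y : ℝ => K * y ^ (a - 1)) volume 0 s :=
    (intervalIntegral.intervalIntegrable_rpow' (by linarith)).const_mul K
  refine (intervalIntegral.norm_integral_le_of_norm_le hs.1 ?_ hi).trans (le_of_eq ?_)
  · filter_upwards [hb] with y hy hys
    have h1 := hy ⟨hys.1, hys.2.trans hs.2⟩
    have : 0 ≤ y * ‖ω₂ y‖ := mul_nonneg hys.1.le (norm_nonneg _)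
    linarith
  · rw [intervalIntegral.integral_const_mul, integral_rpow (Or.inl (by linarith)), sub_add_cancel,
      Real.zero_rpow ha.ne', sub_zero]
    ring

theorem norm_deriv_sub_le (h : SingularAtZero T a K ω ω₁ ω₂) (ha : a ≤ 1) (hK : 0 ≤ K) {p x : ℝ}
    (hp : 0 < p) (hpx : p ≤ x) (hx : x ≤ T) : ‖ω₁ x - ω₁ p‖ ≤ K * p ^ (a - 2) * (x - p) := by
  rw [(h.deriv₂ p ⟨hp, hpx.trans hx⟩ x ⟨hp.trans_le hpx, hx⟩ hpx).2]
  have hb := (ae_restrict_iff' measurableSet_Ioc).1 h.bound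
  refine (intervalIntegral.norm_integral_le_of_norm_le_const_ae (C := K * p ^ (a - 2)) ?_).trans
    (le_of_eq (by rw [abs_of_nonneg (sub_nonneg.2 hpx)]))
  rw [uIoc_of_le hpx]
  filter_upwards [hb] with y hy hys
  have hy0 : 0 < y := hp.trans hys.1
  have h1 := hy ⟨hy0, hys.2.trans hx⟩
  have h2 : y ^ (a - 1) = y ^ (a - 2) * y := by
    rw [← Real.rpow_add_one hy0.ne']; ring_nf
  have h3 : y ^ (a - 2) ≤ p ^ (a - 2) := Real.rpow_le_rpow_of_nonpos hp hys.1.le (by linarith)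
  have h4 : y * ‖ω₂ y‖ ≤ y * (K * y ^ (a - 2)) := by
    rw [h2] at h1
    have := norm_nonneg (ω₁ y)
    linarith
  exact (le_of_mul_le_mul_left h4 hy0).trans (mul_le_mul_of_nonneg_left h3 hK)

theorem continuousOn (h : SingularAtZero T a K ω ω₁ ω₂) (hT : 0 ≤ T) :
    ContinuousOn ω (Icc 0 T) := by
  have h0 : (0 : ℝ) ∈ Icc 0 T := ⟨le_rfl, hT⟩
  have hi := (h.deriv₁ 0 h0 T ⟨hT, le_rfl⟩ hT).1
  have hc := intervalIntegral.continuousOn_primitive_interval' hi left_mem_uIcc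
  rw [uIcc_of_le hT] at hc
  refine hc.congr fun x hx => ?_
  simp only [← (h.deriv₁ 0 h0 x hx hx.1).2, h.zero, sub_zero]

/-- The error of piecewise linear interpolation on a uniform time grid. -/
theorem norm_sub_interp_le [CompleteSpace E] (h : SingularAtZero T a K ω ω₁ ω₂) (ha0 : 0 < a) (ha1 : a ≤ 1)
    (hK : 0 ≤ K) {τ : ℝ} (hτ : 0 < τ) {i : ℕ} (hi : (i + 1) * τ ≤ T) {s : ℝ} (hs0 : 0 < s)
    (h1 : i * τ ≤ s) (h2 : s ≤ (i + 1) * τ) :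
    ‖ω s - ((i + 1 - s / τ) • ω (i * τ) + (s / τ - i) • ω ((i + 1 : ℕ) * τ))‖
      ≤ (8 * K + 2 * K / a) * τ ^ ((1 + 3 * a) / 2) * s ^ (-((1 + a) / 2)) := by
  push_cast
  obtain ⟨p, hp⟩ : ∃ p : ℝ, p = i * τ := ⟨_, rfl⟩
  have hq : ((i : ℝ) + 1) * τ = p + τ := by rw [hp]; ring
  rw [hq] at hi h2 ⊢
  rw [← hp] at h1 ⊢
  have e1 : (i : ℝ) + 1 - s / τ = (p + τ - s) / (p + τ - p) := by
    rw [hp, add_sub_cancel_left]; field_simp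
  have e2 : s / τ - i = (s - p) / (p + τ - p) := by
    rw [hp, add_sub_cancel_left]; field_simp
  have hθ0 : 0 ≤ (s - p) / (p + τ - p) := by
    rw [add_sub_cancel_left]; exact div_nonneg (by linarith) hτ.le
  have hθ1 : (s - p) / (p + τ - p) ≤ 1 := by
    rw [add_sub_cancel_left]; exact (div_le_one hτ).2 (by linarith)
  rw [e1, e2]
  -- On the first cell `ω'` may be unbounded at `0`, so `ω s` and `ω τ` are estimated separately by
  -- `K / a * τ ^ a`. On later cells the bound on `ω''` applies.
  rcases Nat.eq_zero_or_pos i with hi0 | hi0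
  · have hp0 : p = 0 := by rw [hp, hi0]; simp
    subst hp0
    simp only [zero_add, sub_zero] at hi h2 hθ0 hθ1 ⊢
    rw [h.zero, smul_zero, zero_add]
    have b1 := h.norm_le ha0 (s := s) ⟨hs0.le, by linarith⟩
    have b2 := h.norm_le ha0 (s := τ) ⟨hτ.le, by linarith⟩
    have hsτ : s ^ a ≤ τ ^ a := Real.rpow_le_rpow hs0.le (by linarith) ha0.le
    have hpow : τ ^ a ≤ τ ^ ((1 + 3 * a) / 2) * s ^ (-((1 + a) / 2)) := by
      calc τ ^ a = τ ^ ((1 + 3 * a) / 2) * τ ^ (-((1 + a) / 2)) := by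
            rw [← Real.rpow_add hτ]; ring_nf
        _ ≤ _ := mul_le_mul_of_nonneg_left
            (Real.rpow_le_rpow_of_nonpos hs0 (by linarith) (by linarith)) (by positivity)
    have hKa : 0 ≤ K / a := by positivity
    calc _ ≤ ‖ω s‖ + s / τ * ‖ω τ‖ := by
          refine (norm_sub_le _ _).trans (le_of_eq ?_)
          rw [norm_smul, Real.norm_of_nonneg hθ0]
      _ ≤ K / a * τ ^ a + 1 * (K / a * τ ^ a) := by
          have := b1.trans (mul_le_mul_of_nonneg_left hsτ hKa)
          gcongr
      _ = (2 * K / a) * τ ^ a := by ring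
      _ ≤ (2 * K / a) * (τ ^ ((1 + 3 * a) / 2) * s ^ (-((1 + a) / 2))) := by gcongr
      _ ≤ (8 * K + 2 * K / a) * (τ ^ ((1 + 3 * a) / 2) * s ^ (-((1 + a) / 2))) := by
          gcongr
          linarith
      _ = _ := by ring
  · have hi1 : (1 : ℝ) ≤ i := by exact_mod_cast hi0
    have hτp : τ ≤ p := by rw [hp]; nlinarith
    have hp0 : 0 < p := hτ.trans_le hτp
    have hpm : p ∈ Icc 0 T := ⟨hp0.le, by linarith⟩
    have hqm : p + τ ∈ Icc 0 T := ⟨by linarith, hi⟩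
    have main := norm_sub_linear_interp_le (u := ω) (v := ω₁) (B := K * p ^ (a - 2) * τ)
      (by linarith : p < p + τ) (h.deriv₁ p hpm _ hqm (by linarith)).1
      (fun x hx => (h.deriv₁ p hpm x ⟨by linarith [hx.1], by linarith [hx.2]⟩ hx.1).2)
      (fun x hx => (h.norm_deriv_sub_le ha1 hK hp0 hx.1 (by linarith [hx.2])).trans
        (mul_le_mul_of_nonneg_left (by linarith [hx.2]) (by positivity))) ⟨h1, h2⟩
    refine main.trans ?_
    -- For `i ≥ 1` one has `s ≤ p + τ ≤ 2 p`; the factor `2 ^ (2 - a)` is rounded up to `4`.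
    have hps : p ^ (a - 2) ≤ 4 * s ^ (a - 2) := by
      calc p ^ (a - 2) ≤ (s / 2) ^ (a - 2) :=
            Real.rpow_le_rpow_of_nonpos (by positivity) (by linarith) (by linarith)
        _ = 2 ^ (2 - a) * s ^ (a - 2) := by
            rw [Real.div_rpow hs0.le (by norm_num), div_eq_mul_inv, ← Real.rpow_neg (by norm_num),
              mul_comm]
            ring_nf
        _ ≤ 2 ^ (2 : ℝ) * s ^ (a - 2) := by
            gcongr
            · norm_num
            · linarith
        _ = _ := by norm_num
    -- The surplus power `τ ^ (3 / 2 * (1 - a))` is traded for the same power of `s`, using `τ ≤ s`.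
    have hpow : τ ^ 2 * s ^ (a - 2) ≤ τ ^ ((1 + 3 * a) / 2) * s ^ (-((1 + a) / 2)) := by
      have f1 : τ ^ 2 = τ ^ ((1 + 3 * a) / 2) * τ ^ (3 / 2 * (1 - a)) := by
        rw [← Real.rpow_add hτ, ← Real.rpow_natCast]; ring_nf
      have f2 : s ^ (-((1 + a) / 2)) = s ^ (3 / 2 * (1 - a)) * s ^ (a - 2) := by
        rw [← Real.rpow_add hs0]; ring_nf
      have f3 : τ ^ (3 / 2 * (1 - a)) ≤ s ^ (3 / 2 * (1 - a)) :=
        Real.rpow_le_rpow hτ.le (by linarith) (by linarith)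
      rw [f1, f2, mul_assoc]
      gcongr
    calc 2 * (p + τ - p) * (K * p ^ (a - 2) * τ) = 2 * K * (τ ^ 2 * p ^ (a - 2)) := by ring
      _ ≤ 2 * K * (τ ^ 2 * (4 * s ^ (a - 2))) := by gcongr
      _ = 8 * K * (τ ^ 2 * s ^ (a - 2)) := by ring
      _ ≤ 8 * K * (τ ^ ((1 + 3 * a) / 2) * s ^ (-((1 + a) / 2))) := by gcongr
      _ ≤ (8 * K + 2 * K / a) * (τ ^ ((1 + 3 * a) / 2) * s ^ (-((1 + a) / 2))) := by
          gcongr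
          have : 0 ≤ 2 * K / a := by positivity
          linarith
      _ = _ := by ring

end SingularAtZero

end TimeRegularity

/-! ### Consistency of the convolution quadrature -/

/-- Scaling `s = t u` extracts the power of `t`; the remaining Beta integral is a constant and is
left unevaluated. -/
theorem beta_conv_rpow {a c t : ℝ} (ha : 0 < a) (hc : c < 1) (ht : 0 < t) :
    IntervalIntegrable (fun s => beta a (t - s) * s ^ (-c)) volume 0 t ∧
      ∫ s in (0 : ℝ)..t, beta a (t - s) * s ^ (-c)
        = (∫ u in (0 : ℝ)..1, (1 - u) ^ (a - 1) * u ^ ((1 - c) - 1)) / Real.Gamma a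
          * t ^ (a - c) := by
  have e : ∀ u ∈ Ioc (0 : ℝ) 1, beta a (t - t * u) * (t * u) ^ (-c)
      = t ^ (a - c) / t / Real.Gamma a * ((1 - u) ^ (a - 1) * u ^ ((1 - c) - 1)) := by
    intro u hu
    have h1 : t - t * u = t * (1 - u) := by ring
    have h2 : t ^ (a - c) / t = t ^ (a - 1) * t ^ (-c) := by
      rw [← Real.rpow_add ht, ← Real.rpow_sub_one ht.ne']; ring_nf
    rw [beta, h1, Real.mul_rpow ht.le (by linarith [hu.2]), Real.mul_rpow ht.le hu.1.le, h2]
    ring_nf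
  constructor
  · have h0 := IntervalIntegrable.comp_mul_left_iff (a := 0) (b := t)
      (f := fun s => beta a (t - s) * s ^ (-c)) ht.ne'
    rw [zero_div, div_self ht.ne'] at h0
    refine h0.1 (((intervalIntegrable_betaKernel ha (sub_pos.2 hc)).const_mul
      (t ^ (a - c) / t / Real.Gamma a)).congr ?_)
    rw [uIoc_of_le zero_le_one]
    exact fun u hu => (e u hu).symm
  · have h := intervalIntegral.mul_integral_comp_mul_left (a := 0) (b := 1)
      (f := fun s => beta a (t - s) * s ^ (-c)) t
    rw [mul_zero, mul_one] at h
    rw [← h, intervalIntegral.integral_of_le zero_le_one, intervalIntegral.integral_of_le zero_le_one,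
      setIntegral_congr_fun measurableSet_Ioc e, integral_const_mul]
    field_simp

/-- Reflecting `y = t_n - s` turns the weight into an integral against the nodal hat function at
`t_j`, so a weighted sum of nodal values is a convolution with their interpolant. The hat vanishes
for lags beyond `t_n` because `j ≥ 1`. -/
theorem convWeight_eq_integral {g : ℝ → ℝ} {T τ : ℝ} (hτ : 0 < τ) {n j : ℕ} (hj : 1 ≤ j)
    (hjn : j ≤ n) (hn : n * τ ≤ T) (hg : IntervalIntegrable g volume 0 T) :
    convWeight g T τ (n - j) = ∫ s in (0 : ℝ)..(n * τ), g (n * τ - s) * hat τ (j * τ - s) := by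
  have hn0 : 0 ≤ (n : ℝ) * τ := by positivity
  have hsub := intervalIntegrable_mul_hat hg τ ((n - j : ℕ) * τ)
  have m1 : (n : ℝ) * τ ∈ uIcc 0 T := by rw [uIcc_of_le (hn0.trans hn)]; exact ⟨hn0, hn⟩
  have h1 := hsub.mono_set (uIcc_subset_uIcc left_mem_uIcc m1)
  have h2 := hsub.mono_set (uIcc_subset_uIcc m1 right_mem_uIcc)
  have z : ∫ y in (n * τ)..T, g y * hat τ ((n - j : ℕ) * τ - y) = 0 := by
    rw [intervalIntegral.integral_of_le hn]
    refine setIntegral_eq_zero_of_forall_eq_zero fun y hy => ?_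
    rw [hat_eq_zero hτ, mul_zero]
    have : (1 : ℝ) ≤ j := by exact_mod_cast hj
    rw [Nat.cast_sub hjn, abs_of_nonpos (by nlinarith [hy.1])]
    nlinarith [hy.1]
  rw [convWeight, ← intervalIntegral.integral_add_adjacent_intervals h1 h2, z, add_zero]
  have h3 := intervalIntegral.integral_comp_sub_left (a := 0) (b := n * τ)
    (fun y => g y * hat τ ((n - j : ℕ) * τ - y)) (n * τ)
  rw [sub_self, sub_zero] at h3
  rw [← h3]
  refine intervalIntegral.integral_congr fun s _ => ?_
  have : ((n - j : ℕ) : ℝ) * τ - (n * τ - s) = -(j * τ - s) := by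
    rw [Nat.cast_sub hjn]; ring
  rw [this, hat, hat, abs_neg]

/-- By concavity of `y ↦ y ^ a` (Bernoulli's inequality), `a τ y ^ (a - 1) ≤ y ^ a - (y - τ) ^ a`,
and this telescopes. -/
theorem sum_mul_rpow_le {a τ : ℝ} (ha0 : 0 < a) (ha1 : a ≤ 1) (hτ : 0 < τ) (n : ℕ) :
    τ * ∑ k ∈ Finset.Icc 1 n, ((k : ℝ) * τ) ^ (a - 1) ≤ (n * τ) ^ a / a := by
  induction n with
  | zero => simp [Real.zero_rpow ha0.ne']
  | succ n ih =>
    rw [Finset.sum_Icc_succ_top (by omega), mul_add]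
    set y : ℝ := ((n + 1 : ℕ) : ℝ) * τ with hy
    have hy0 : 0 < y := by positivity
    have hny : (n : ℝ) * τ = y * (1 + -(τ / y)) := by
      rw [mul_add, mul_neg, mul_div_cancel₀ _ hy0.ne', hy]; push_cast; ring
    have hτy : τ / y ≤ 1 := by
      rw [div_le_one hy0, hy]; push_cast; nlinarith [(Nat.cast_nonneg n : (0 : ℝ) ≤ n)]
    have b := rpow_one_add_le_one_add_mul_self (s := -(τ / y)) (by linarith) ha0.le ha1
    have e : y ^ a = y ^ (a - 1) * y := by rw [← Real.rpow_add_one hy0.ne', sub_add_cancel]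
    have key : (n * τ) ^ a ≤ y ^ a - a * (τ * y ^ (a - 1)) := by
      rw [hny, Real.mul_rpow hy0.le (by linarith)]
      calc _ ≤ y ^ a * (1 + a * -(τ / y)) := mul_le_mul_of_nonneg_left b (by positivity)
        _ = _ := by rw [e]; field_simp; ring
    calc _ ≤ (n * τ) ^ a / a + τ * y ^ (a - 1) := by linarith
      _ ≤ (y ^ a - a * (τ * y ^ (a - 1))) / a + τ * y ^ (a - 1) := by gcongr
      _ = _ := by field_simp; ring

section Consistency

variable {E : Type*} [NormedAddCommGroup E] [NormedSpace ℝ E]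
  {T a K : ℝ} {ω ω₁ ω₂ : ℝ → E}

theorem intervalIntegrable_conv {g : ℝ → ℝ} {t : ℝ} (ht : t ∈ Icc 0 T)
    (hg : IntervalIntegrable g volume 0 T) (hω : ContinuousOn ω (Icc 0 T)) :
    IntervalIntegrable (fun s => g (t - s) • ω s) volume 0 t := by
  have h1 : IntervalIntegrable g volume 0 t := hg.mono_set (by
    rw [uIcc_of_le ht.1, uIcc_of_le (ht.1.trans ht.2)]; exact Icc_subset_Icc_right ht.2)
  have h2 := (h1.comp_sub_left t).symm
  rw [sub_self, sub_zero, intervalIntegrable_iff_integrableOn_Icc_of_le ht.1] at h2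
  rw [intervalIntegrable_iff_integrableOn_Icc_of_le ht.1]
  exact h2.smul_continuousOn (hω.mono (Icc_subset_Icc_right ht.2)) isCompact_Icc

/-- The quadrature error of the convolution weights applied to a function with a weak singularity
at `0`. -/
theorem norm_conv_sub_sum_weight_le [CompleteSpace E] {g : ℝ → ℝ} {Cg : ℝ} (h : SingularAtZero T a K ω ω₁ ω₂)
    (ha0 : 0 < a) (ha1 : a < 1) (hK : 0 ≤ K) (hg : IntervalIntegrable g volume 0 T)
    (hCg : ∀ y ∈ Ioo 0 T, |g y| ≤ Cg * beta a y) {τ : ℝ} (hτ : 0 < τ) {n : ℕ} (hn1 : 1 ≤ n)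
    (hn : n * τ ≤ T) :
    ‖conv g ω (n * τ) - ∑ j ∈ Finset.Icc 1 n, weight g τ n j • ω (j * τ)‖
      ≤ Cg * ((8 * K + 2 * K / a) * τ ^ ((1 + 3 * a) / 2))
        * ((∫ u in (0 : ℝ)..1, (1 - u) ^ (a - 1) * u ^ ((1 - (1 + a) / 2) - 1)) / Real.Gamma a
          * (n * τ) ^ ((a - 1) / 2)) := by
  have hn0 : (0 : ℝ) < n := by exact_mod_cast hn1
  have ht : 0 < (n : ℝ) * τ := by positivity
  have htT : (n : ℝ) * τ ∈ Icc 0 T := ⟨ht.le, hn⟩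
  have hω := h.continuousOn (ht.le.trans hn)
  have hgt : IntervalIntegrable (fun s => g (n * τ - s)) volume 0 (n * τ) := by
    have := ((hg.mono_set (uIcc_subset_uIcc left_mem_uIcc (by
      rwa [uIcc_of_le (ht.le.trans hn)]))).comp_sub_left (n * τ)).symm
    rwa [sub_self, sub_zero] at this
  have hterm : ∀ j : ℕ, IntervalIntegrable
      (fun s => (g (n * τ - s) * hat τ (j * τ - s)) • ω (j * τ)) volume 0 (n * τ) := by
    intro j
    have := hgt.mul_continuousOn (g := fun s => hat τ (j * τ - s))
      ((continuous_hat τ).comp (by fun_prop)).continuousOn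
    exact ⟨this.1.smul_const _, this.2.smul_const _⟩
  have hsum : ∑ j ∈ Finset.Icc 1 n, weight g τ n j • ω (j * τ)
      = ∫ s in (0 : ℝ)..(n * τ), ∑ j ∈ Finset.Icc 1 n,
        (g (n * τ - s) * hat τ (j * τ - s)) • ω (j * τ) := by
    rw [intervalIntegral.integral_finsetSum fun j _ => hterm j]
    refine Finset.sum_congr rfl fun j hj => ?_
    have hj := Finset.mem_Icc.1 hj
    rw [intervalIntegral.integral_smul_const, weight_eq_convWeight hτ hj.1 hj.2 hn hg,
      convWeight_eq_integral hτ hj.1 hj.2 hn hg]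
  have hsumi := IntervalIntegrable.sum (Finset.Icc 1 n) fun j _ => hterm j
  rw [Finset.sum_fn] at hsumi
  -- The exponent `(1 + a) / 2` is below `1`, hence integrable at `0`, and leaves `t ^ ((a - 1) /
  -- 2)`, whose square has bounded Riemann sums.
  obtain ⟨kint, kval⟩ := beta_conv_rpow ha0 (by linarith : (1 + a) / 2 < 1) ht
  rw [show a - (1 + a) / 2 = (a - 1) / 2 by ring] at kval
  rw [hsum, conv, ← intervalIntegral.integral_sub (intervalIntegrable_conv htT hg hω) hsumi, ← kval,
    ← intervalIntegral.integral_const_mul]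
  refine intervalIntegral.norm_integral_le_of_norm_le ht.le ?_ (kint.const_mul _)
  filter_upwards [compl_mem_ae_iff.2 (measure_singleton ((n : ℝ) * τ))] with s hs hst
  have hslt : s < n * τ := lt_of_le_of_ne hst.2 hs
  set i := ⌊s / τ⌋₊
  have h1 : i * τ ≤ s := by
    rw [← le_div_iff₀ hτ]; exact Nat.floor_le (div_nonneg hst.1.le hτ.le)
  have h2 : s ≤ (i + 1) * τ := by
    rw [← div_le_iff₀ hτ]; exact (Nat.lt_floor_add_one _).le
  have hin : i < n := by
    have : (i : ℝ) * τ < n * τ := h1.trans_lt hslt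
    exact_mod_cast lt_of_mul_lt_mul_right this hτ.le
  have hiT : ((i : ℝ) + 1) * τ ≤ T := by
    have : (i : ℝ) + 1 ≤ n := by exact_mod_cast hin
    nlinarith
  have e : g (n * τ - s) • ω s - ∑ j ∈ Finset.Icc 1 n,
      (g (n * τ - s) * hat τ (j * τ - s)) • ω (j * τ) = g (n * τ - s) • (ω s -
        ((i + 1 - s / τ) • ω (i * τ) + (s / τ - i) • ω ((i + 1 : ℕ) * τ))) := by
    rw [← sum_hat_smul hτ h1 h2 hin fun k : ℕ => ω (k * τ), smul_sub, Finset.smul_sum]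
    congr 1
    -- The node `j = 0`, absent from the scheme, may be added because `ω 0 = 0`; with it the hat sum
    -- is the full interpolant.
    rw [Finset.range_eq_Ico, Finset.sum_eq_sum_Ico_succ_bot (by omega)]
    simp only [Nat.cast_zero, zero_mul, h.zero, smul_zero, zero_add, mul_smul]
    rfl
  rw [e, norm_smul, Real.norm_eq_abs]
  have hns : (n : ℝ) * τ - s ∈ Ioo 0 T := ⟨by linarith, by linarith [hst.1]⟩
  have b1 := hCg _ hns
  have b2 := h.norm_sub_interp_le ha0 ha1.le hK hτ hiT hst.1 h1 h2
  calc _ ≤ (Cg * beta a (n * τ - s)) *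
        ((8 * K + 2 * K / a) * τ ^ ((1 + 3 * a) / 2) * s ^ (-((1 + a) / 2))) :=
        mul_le_mul b1 b2 (norm_nonneg _) ((abs_nonneg _).trans b1)
    _ = _ := by ring

end Consistency

section WeakDerivative

open scoped ContDiff

/-! ### Weak derivatives in one dimension -/

/-- Integration by parts for an absolutely continuous primitive. The base point stays at `a` while
the interval is free, so the identity can be used cell by cell. -/
theorem integral_primitive_mul_deriv {w φ : ℝ → ℝ} {a b p q : ℝ} (c : ℝ)
    (hw : IntervalIntegrable w volume a b) (hp : p ∈ uIcc a b) (hq : q ∈ uIcc a b)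
    (hφ : ContDiff ℝ 1 φ) :
    ∫ x in p..q, (c + ∫ y in a..x, w y) * deriv φ x
      = (c + ∫ y in a..q, w y) * φ q - (c + ∫ y in a..p, w y) * φ p - ∫ x in p..q, w x * φ x := by
  have hsub : uIcc p q ⊆ uIcc a b := uIcc_subset_uIcc hp hq
  have hW : AbsolutelyContinuousOnInterval (fun x => c + ∫ y in a..x, w y) p q :=
    ((contDiff_const (c := c)).contDiffOn.absolutelyContinuousOnInterval.add
      (hw.absolutelyContinuousOnInterval_intervalIntegral left_mem_uIcc)).mono hsub
  rw [hW.integral_mul_deriv_eq_deriv_mul hφ.contDiffOn.absolutelyContinuousOnInterval]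
  congr 1
  refine intervalIntegral.integral_congr_ae ?_
  filter_upwards [hw.ae_hasDerivAt_integral] with x hx hxm
  rw [((hx (hsub (uIoc_subset_uIcc hxm)) a left_mem_uIcc).const_add c).deriv]

theorem exists_Icc_of_isCompact_subset_Ioo {a b : ℝ} (hab : a < b) {S : Set ℝ} (hS : IsCompact S)
    (h : S ⊆ Ioo a b) : ∃ a' b', a < a' ∧ b' < b ∧ S ⊆ Icc a' b' := by
  rcases S.eq_empty_or_nonempty with rfl | hne
  · exact ⟨(a + b) / 2, (a + b) / 2, by linarith, by linarith, empty_subset _⟩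
  · exact ⟨sInf S, sSup S, (h (hS.sInf_mem hne)).1, (h (hS.sSup_mem hne)).2,
      fun x hx => ⟨csInf_le hS.bddBelow hx, le_csSup hS.bddAbove hx⟩⟩

/-- A test function with vanishing integral is the derivative of a test function. -/
theorem exists_test_primitive {a b : ℝ} (hab : a < b) {θ : ℝ → ℝ} (hθ : ContDiff ℝ ∞ θ)
    (hc : HasCompactSupport θ) (hs : tsupport θ ⊆ Ioo a b) (h0 : ∫ x, θ x = 0) :
    ∃ φ : ℝ → ℝ, ContDiff ℝ ∞ φ ∧ HasCompactSupport φ ∧ tsupport φ ⊆ Ioo a b ∧ deriv φ = θ := by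
  obtain ⟨a', b', ha, hb, hab'⟩ := exists_Icc_of_isCompact_subset_Ioo hab hc hs
  have hz : ∀ x, x ∉ Icc a' b' → θ x = 0 := fun x hx =>
    image_eq_zero_of_notMem_tsupport fun h => hx (hab' h)
  have hint : ∀ x y, IntervalIntegrable θ volume x y := fun x y =>
    hθ.continuous.intervalIntegrable x y
  have hd : ∀ x, HasDerivAt (fun x => ∫ y in a'..x, θ y) (θ x) x := fun x =>
    intervalIntegral.integral_hasDerivAt_right (hint _ _)
      (hθ.continuous.stronglyMeasurableAtFilter _ _) hθ.continuous.continuousAt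
  have hderiv : deriv (fun x => ∫ y in a'..x, θ y) = θ := funext fun x => (hd x).deriv
  have hsupp : Function.support (fun x => ∫ y in a'..x, θ y) ⊆ Icc a' b' := by
    intro x hx
    by_contra hxm
    refine hx ?_
    rw [mem_Icc, not_and_or, not_le, not_le] at hxm
    rcases hxm with h | h
    · dsimp only
      rw [intervalIntegral.integral_of_ge h.le, neg_eq_zero, integral_Ioc_eq_integral_Ioo]
      exact setIntegral_eq_zero_of_forall_eq_zero fun y hy => hz y fun hy' =>
        absurd hy'.1 (not_le.2 hy.2)
    · dsimp only
      rcases le_total a' x with hax | hax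
      · rw [intervalIntegral.integral_of_le hax, ← integral_Icc_eq_integral_Ioc,
          setIntegral_eq_integral_of_forall_compl_eq_zero, h0]
        intro y hy
        exact hz y fun hy' => hy ⟨hy'.1, hy'.2.trans h.le⟩
      · rw [intervalIntegral.integral_of_ge hax, neg_eq_zero]
        exact setIntegral_eq_zero_of_forall_eq_zero fun y hy => hz y fun hy' =>
          absurd (h.trans hy.1) (not_lt.2 hy'.2)
  refine ⟨_, ?_, HasCompactSupport.of_support_subset_isCompact isCompact_Icc hsupp,
    (closure_minimal hsupp isClosed_Icc).trans (Icc_subset_Ioo ha hb), hderiv⟩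
  rw [contDiff_infty_iff_deriv, hderiv]
  exact ⟨fun x => (hd x).differentiableAt, hθ⟩

/-- The du Bois-Reymond lemma. -/
theorem exists_ae_eq_const_of_integral_mul_deriv_eq_zero {a b : ℝ} (hab : a < b) {f : ℝ → ℝ}
    (hf : IntegrableOn f (Ioo a b))
    (h : ∀ φ : ℝ → ℝ, ContDiff ℝ ∞ φ → HasCompactSupport φ → tsupport φ ⊆ Ioo a b →
      ∫ x in Ioo a b, f x * deriv φ x = 0) :
    ∃ c, f =ᵐ[volume.restrict (Ioo a b)] fun _ => c := by
  -- A bump `χ` of integral one: for a test function `ψ` of integral `I`, the difference `ψ - I χ`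
  -- has integral zero and is the derivative of a test function. The constant is then forced to be
  -- `∫ f χ`.
  let β : ContDiffBump ((a + b) / 2) := ⟨(b - a) / 8, (b - a) / 4, by linarith, by linarith⟩
  set χ : ℝ → ℝ := β.normed volume with hχ
  have χs : ContDiff ℝ ∞ χ := β.contDiff_normed
  have χc : HasCompactSupport χ := β.hasCompactSupport_normed
  have χt : tsupport χ ⊆ Ioo a b := by
    rw [hχ, β.tsupport_normed_eq, Real.closedBall_eq_Icc]
    have : β.rOut = (b - a) / 4 := rfl
    rw [this]
    exact Icc_subset_Ioo (by linarith) (by linarith)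
  have χ1 : ∫ x, χ x = 1 := β.integral_normed
  have hfm : ∀ ψ : ℝ → ℝ, Continuous ψ → HasCompactSupport ψ →
      Integrable (fun x => f x * ψ x) (volume.restrict (Ioo a b)) := by
    intro ψ hψ hψc
    obtain ⟨B, hB⟩ := hψ.bounded_above_of_compact_support hψc
    exact Integrable.mul_bdd hf hψ.aestronglyMeasurable (Filter.Eventually.of_forall hB)
  set c := ∫ x in Ioo a b, f x * χ x with hc
  refine ⟨c, ?_⟩
  have main := isOpen_Ioo.ae_eq_zero_of_integral_contDiff_smul_eq_zero
    (f := fun x => f x - c) (μ := volume) (U := Ioo a b)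
    ((hf.sub (integrable_const c)).locallyIntegrableOn) ?_
  · rw [Filter.EventuallyEq, ae_restrict_iff' measurableSet_Ioo]
    filter_upwards [main] with x hx hxm
    linarith [hx hxm]
  intro ψ ψs ψc ψt
  set I := ∫ x, ψ x with hI
  have θs : ContDiff ℝ ∞ (fun x => ψ x - I * χ x) := ψs.sub (contDiff_const.mul χs)
  have ψi : Integrable ψ := ψs.continuous.integrable_of_hasCompactSupport ψc
  have χi : Integrable χ := χs.continuous.integrable_of_hasCompactSupport χc
  have θc : HasCompactSupport (fun x => ψ x - I * χ x) := ψc.sub χc.mul_left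
  have θt : tsupport (fun x => ψ x - I * χ x) ⊆ Ioo a b := by
    refine (tsupport_sub ψ (fun x => I * χ x)).trans (union_subset ψt ?_)
    exact (closure_mono (Function.support_mul_subset_right _ _)).trans χt
  obtain ⟨φ, φs, φc, φt, φd⟩ := exists_test_primitive hab θs θc θt (by
    rw [integral_sub ψi (χi.const_mul I), integral_const_mul, χ1, mul_one, sub_self])
  have h1 := h φ φs φc φt
  rw [φd] at h1
  have h2 : ∫ x in Ioo a b, f x * (ψ x - I * χ x) = (∫ x in Ioo a b, f x * ψ x) - I * c := by
    rw [hc, ← integral_const_mul, ← integral_sub (hfm ψ ψs.continuous ψc)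
      ((hfm χ χs.continuous χc).const_mul I)]
    exact integral_congr_ae (Filter.Eventually.of_forall fun x => by ring)
  have hψ0 : ∀ x, x ∉ Ioo a b → ψ x = 0 := fun x hx =>
    image_eq_zero_of_notMem_tsupport fun hh => hx (ψt hh)
  have h3 : ∫ x in Ioo a b, ψ x = I :=
    setIntegral_eq_integral_of_forall_compl_eq_zero hψ0
  rw [← setIntegral_eq_integral_of_forall_compl_eq_zero (s := Ioo a b)
    (fun x hx => by rw [hψ0 x hx, zero_smul])]
  have h4 : ∫ x in Ioo a b, ψ x • (f x - c)
      = (∫ x in Ioo a b, f x * ψ x) - c * ∫ x in Ioo a b, ψ x := by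
    rw [← integral_const_mul, ← integral_sub (hfm ψ ψs.continuous ψc)
      (ψi.integrableOn.const_mul c)]
    exact integral_congr_ae (Filter.Eventually.of_forall fun x => by simp only [smul_eq_mul]; ring)
  rw [h4, h3]
  linarith

theorem integrableOn_L2 {a b : ℝ} (u : L2 a b) : IntegrableOn u (Ioo a b) :=
  (Lp.memLp u).integrable one_le_two

theorem intervalIntegrable_L2 {a b : ℝ} (hab : a ≤ b) (u : L2 a b) :
    IntervalIntegrable u volume a b := by
  rw [intervalIntegrable_iff_integrableOn_Ioo_of_le hab]
  exact integrableOn_L2 u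

/-- A function with a weak derivative is a primitive of it. -/
theorem BlackScholesFEM.IsWeakDeriv.exists_ae_eq_primitive {a b : ℝ} (hab : a < b) {u v : L2 a b}
    (h : IsWeakDeriv u v) :
    ∃ c, u =ᵐ[volume.restrict (Ioo a b)] fun x => c + ∫ y in a..x, v y := by
  have hv := intervalIntegrable_L2 hab.le v
  have hVc : ContinuousOn (fun x => ∫ y in a..x, v y) (Icc a b) := by
    have := intervalIntegral.continuousOn_primitive_interval' hv left_mem_uIcc
    rwa [uIcc_of_le hab.le] at this
  have hVi : IntegrableOn (fun x => ∫ y in a..x, v y) (Ioo a b) :=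
    (hVc.integrableOn_compact isCompact_Icc).mono_set Ioo_subset_Icc_self
  -- The difference of `u` and the primitive of `v` has zero weak derivative.
  have key : ∀ φ : ℝ → ℝ, ContDiff ℝ ∞ φ → HasCompactSupport φ → tsupport φ ⊆ Ioo a b →
      ∫ x in Ioo a b, (⇑u - fun x => ∫ y in a..x, v y) x * deriv φ x = 0 := by
    intro φ φs φc φt
    have φa : φ a = 0 := image_eq_zero_of_notMem_tsupport fun hh => lt_irrefl _ (φt hh).1
    have φb : φ b = 0 := image_eq_zero_of_notMem_tsupport fun hh => lt_irrefl _ (φt hh).2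
    have ibp := integral_primitive_mul_deriv 0 hv left_mem_uIcc right_mem_uIcc
      (φs.of_le (by simp))
    simp only [φa, φb, mul_zero, sub_zero, zero_sub, zero_add] at ibp
    rw [intervalIntegral.integral_of_le hab.le, intervalIntegral.integral_of_le hab.le,
      integral_Ioc_eq_integral_Ioo, integral_Ioc_eq_integral_Ioo] at ibp
    have d := φs.continuous_deriv (by simp)
    obtain ⟨B, hB⟩ := d.bounded_above_of_compact_support φc.deriv
    have i1 := Integrable.mul_bdd (integrableOn_L2 u) d.aestronglyMeasurable
      (Filter.Eventually.of_forall hB)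
    have i2 := Integrable.mul_bdd hVi d.aestronglyMeasurable (Filter.Eventually.of_forall hB)
    simp only [Pi.sub_apply, sub_mul]
    rw [integral_sub i1 i2, ibp, h φ φs φc φt, sub_self]
  obtain ⟨c, hc⟩ := exists_ae_eq_const_of_integral_mul_deriv_eq_zero hab
    ((integrableOn_L2 u).sub hVi) key
  refine ⟨c, ?_⟩
  filter_upwards [hc] with x hx
  simp only [Pi.sub_apply] at hx
  linarith

/-- The `C¹` representative of an `H²`-function with zero boundary values. -/
theorem BlackScholesFEM.ZeroBoundary.exists_representative {a b : ℝ} (hab : a < b) {u : H2 a b}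
    (hu : ZeroBoundary u) :
    ∃ c₀ c₁ : ℝ, let g₁ := fun x => c₁ + ∫ y in a..x, dxx u y
      let g := fun x => c₀ + ∫ y in a..x, g₁ y
      g a = 0 ∧ g b = 0 ∧ toL2 u =ᵐ[volume.restrict (Ioo a b)] g := by
  obtain ⟨c₁, h₁⟩ := u.2.2.exists_ae_eq_primitive hab
  obtain ⟨c₀, h₀⟩ := u.2.1.exists_ae_eq_primitive hab
  refine ⟨c₀, c₁, ?_⟩
  intro g₁ g
  have hw := intervalIntegrable_L2 hab.le (dxx u)
  have hg₁ : ContinuousOn g₁ (Icc a b) := by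
    have := intervalIntegral.continuousOn_primitive_interval' hw left_mem_uIcc
    rw [uIcc_of_le hab.le] at this
    exact continuousOn_const.add this
  have hg₁i : IntervalIntegrable g₁ volume a b := by
    rw [intervalIntegrable_iff_integrableOn_Icc_of_le hab.le]
    exact hg₁.integrableOn_compact isCompact_Icc
  have hg : ContinuousOn g (Icc a b) := by
    have := intervalIntegral.continuousOn_primitive_interval' hg₁i left_mem_uIcc
    rw [uIcc_of_le hab.le] at this
    exact continuousOn_const.add this
  have hug : toL2 u =ᵐ[volume.restrict (Ioo a b)] g := by
    have h₁' := (ae_restrict_iff' measurableSet_Ioo).1 h₁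
    filter_upwards [h₀, ae_restrict_mem measurableSet_Ioo] with x hx hxm
    refine hx.trans ?_
    congr 1
    refine intervalIntegral.integral_congr_ae ?_
    filter_upwards [h₁'] with y hy hyx
    rw [uIoc_of_le hxm.1.le] at hyx
    exact hy ⟨hyx.1, hyx.2.trans_lt hxm.2⟩
  -- Two continuous functions that agree almost everywhere on `[a, b]` agree at the endpoints too,
  -- so `g` inherits the zero boundary values.
  obtain ⟨k, hk, ka, kb, huk⟩ := hu
  have hgk : g =ᵐ[volume.restrict (Icc a b)] k := by
    rw [← Measure.restrict_congr_set Ioo_ae_eq_Icc]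
    exact hug.symm.trans huk
  have := Measure.eqOn_Icc_of_ae_eq volume hab.ne hgk hg hk
  exact ⟨(this ⟨le_rfl, hab.le⟩).trans ka, (this ⟨hab.le, le_rfl⟩).trans kb, hug⟩

end WeakDerivative

/-! ### Piecewise linear finite elements -/

namespace BlackScholesFEM.Mesh

variable {a b : ℝ}

/-- The nodes of a partition, indexed by `ℕ`. -/
def pt (P : Mesh a b) (i : ℕ) : ℝ := P.node ⟨min i P.M, by omega⟩

theorem pt_of_le (P : Mesh a b) {i : ℕ} (hi : i ≤ P.M) : P.pt i = P.node ⟨i, by omega⟩ := by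
  unfold pt
  congr
  omega

theorem pt_zero (P : Mesh a b) : P.pt 0 = a := by
  rw [P.pt_of_le (Nat.zero_le _)]; exact P.node_zero

theorem pt_last (P : Mesh a b) : P.pt P.M = b := by
  rw [P.pt_of_le le_rfl]; exact P.node_last

theorem pt_monotone (P : Mesh a b) : Monotone P.pt := by
  intro i j hij
  refine P.strictMono.monotone ?_
  simp only [Fin.mk_le_mk]
  omega

theorem pt_lt (P : Mesh a b) {i : ℕ} (hi : i < P.M) : P.pt i < P.pt (i + 1) := by
  refine P.strictMono ?_
  simp only [Fin.mk_lt_mk]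
  omega

theorem pt_mem (P : Mesh a b) (i : ℕ) : P.pt i ∈ Icc a b := by
  constructor
  · exact P.pt_zero.symm.le.trans (P.pt_monotone (Nat.zero_le i))
  · have : P.pt i = P.pt (min i P.M) := by unfold pt; congr 2; omega
    rw [this]
    exact (P.pt_monotone (min_le_right _ _)).trans P.pt_last.le

theorem pt_succ_sub_le_diam (P : Mesh a b) {i : ℕ} (hi : i < P.M) :
    P.pt (i + 1) - P.pt i ≤ P.diam := by
  rw [P.pt_of_le hi, P.pt_of_le hi.le]
  exact le_ciSup (f := P.cell) (Set.finite_range _).bddAbove ⟨i, hi⟩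

theorem exists_mem_cell (P : Mesh a b) {x : ℝ} (hx : x ∈ Ioo a b) :
    ∃ k < P.M, x ∈ Ico (P.pt k) (P.pt (k + 1)) := by
  have key : ∀ m : ℕ, x < P.pt m → ∃ k < m, x ∈ Ico (P.pt k) (P.pt (k + 1)) := by
    intro m
    induction m with
    | zero => intro h; rw [P.pt_zero] at h; exact absurd hx.1 (not_lt.2 h.le)
    | succ m ih =>
      intro h
      rcases lt_or_ge x (P.pt m) with h' | h'
      · obtain ⟨k, hk, hkx⟩ := ih h'
        exact ⟨k, by omega, hkx⟩
      · exact ⟨m, by omega, h', h⟩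
  exact key P.M (by rw [P.pt_last]; exact hx.2)

theorem mem_femSpace_iff (P : Mesh a b) {v : ℝ → ℝ} :
    v ∈ P.femSpace ↔ ContinuousOn v (Icc a b) ∧ v a = 0 ∧ v b = 0 ∧
      ∀ k < P.M, ∃ c d : ℝ, ∀ x ∈ Icc (P.pt k) (P.pt (k + 1)), v x = c + d * x := by
  refine and_congr_right fun _ => and_congr_right fun _ => and_congr_right fun _ => ?_
  constructor
  · intro h k hk
    rw [P.pt_of_le hk, P.pt_of_le hk.le]
    exact h ⟨k, hk⟩
  · intro h i
    have := h i i.2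
    rwa [P.pt_of_le i.2, P.pt_of_le i.2.le] at this

theorem hasDerivAt_of_affine {v : ℝ → ℝ} {p q c d : ℝ} (h : ∀ x ∈ Icc p q, v x = c + d * x) {x : ℝ}
    (hx : x ∈ Ioo p q) : HasDerivAt v d x := by
  have h1 : HasDerivAt (fun x => c + d * x) d x := by
    simpa using ((hasDerivAt_id x).const_mul d).const_add c
  refine h1.congr_of_eventuallyEq ?_
  filter_upwards [Ioo_mem_nhds hx.1 hx.2] with y hy
  exact h y (Ioo_subset_Icc_self hy)

theorem sub_mem_femSpace (P : Mesh a b) {v w : ℝ → ℝ} (hv : v ∈ P.femSpace) (hw : w ∈ P.femSpace) :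
    v - w ∈ P.femSpace := by
  obtain ⟨v1, v2, v3, v4⟩ := hv
  obtain ⟨w1, w2, w3, w4⟩ := hw
  refine ⟨v1.sub w1, by simp [v2, w2], by simp [v3, w3], fun i => ?_⟩
  obtain ⟨c, d, h⟩ := v4 i
  obtain ⟨c', d', h'⟩ := w4 i
  refine ⟨c - c', d - d', fun x hx => ?_⟩
  rw [Pi.sub_apply, h x hx, h' x hx]
  ring

theorem ae_mem_open_cell (P : Mesh a b) :
    ∀ᵐ x ∂(volume.restrict (Ioo a b)), ∃ k < P.M, x ∈ Ioo (P.pt k) (P.pt (k + 1)) := by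
  have hc : ∀ᵐ x ∂(volume : Measure ℝ), x ∉ range P.pt :=
    (Set.countable_range P.pt).ae_notMem _
  filter_upwards [ae_restrict_of_ae hc, ae_restrict_mem measurableSet_Ioo] with x hx hxm
  obtain ⟨k, hk, h1, h2⟩ := P.exists_mem_cell hxm
  exact ⟨k, hk, lt_of_le_of_ne h1 fun h => hx ⟨k, h⟩, h2⟩

theorem ae_differentiableAt (P : Mesh a b) {v : ℝ → ℝ} (hv : v ∈ P.femSpace) :
    ∀ᵐ x ∂(volume.restrict (Ioo a b)), DifferentiableAt ℝ v x := by
  filter_upwards [P.ae_mem_open_cell] with x hx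
  obtain ⟨k, hk, hxk⟩ := hx
  obtain ⟨c, d, h⟩ := (P.mem_femSpace_iff.1 hv).2.2.2 k hk
  exact (hasDerivAt_of_affine h hxk).differentiableAt

theorem memLp_of_mem_femSpace (P : Mesh a b) {v : ℝ → ℝ} (hv : v ∈ P.femSpace) :
    MemLp v 2 (volume.restrict (Ioo a b)) := by
  obtain ⟨B, hB⟩ := isCompact_Icc.exists_bound_of_continuousOn hv.1
  refine MemLp.of_bound ((hv.1.mono Ioo_subset_Icc_self).aestronglyMeasurable measurableSet_Ioo) B ?_
  filter_upwards [ae_restrict_mem measurableSet_Ioo] with x hx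
  exact hB x (Ioo_subset_Icc_self hx)

theorem memLp_deriv_of_mem_femSpace (P : Mesh a b) {v : ℝ → ℝ} (hv : v ∈ P.femSpace) :
    MemLp (deriv v) 2 (volume.restrict (Ioo a b)) := by
  have h4 := (P.mem_femSpace_iff.1 hv).2.2.2
  choose! c d h using h4
  refine MemLp.of_bound (measurable_deriv v).aestronglyMeasurable
    (∑ k ∈ Finset.range P.M, |d k|) ?_
  filter_upwards [P.ae_mem_open_cell] with x hx
  obtain ⟨k, hk, hxk⟩ := hx
  rw [(hasDerivAt_of_affine (h k hk) hxk).deriv]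
  exact Finset.single_le_sum (f := fun k => |d k|) (fun _ _ => abs_nonneg _) (Finset.mem_range.2 hk)

/-- The slope of the piecewise linear interpolant on a cell. -/
noncomputable def slope (P : Mesh a b) (g : ℝ → ℝ) (k : ℕ) : ℝ :=
  (g (P.pt (k + 1)) - g (P.pt k)) / (P.pt (k + 1) - P.pt k)

/-- The piecewise linear interpolant of `g` at the nodes. -/
noncomputable def interp (P : Mesh a b) (g : ℝ → ℝ) (x : ℝ) : ℝ :=
  g a + ∑ i ∈ Finset.range P.M, P.slope g i * (max (P.pt i) (min x (P.pt (i + 1))) - P.pt i)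

theorem slope_mul (P : Mesh a b) (g : ℝ → ℝ) {k : ℕ} (hk : k < P.M) :
    P.slope g k * (P.pt (k + 1) - P.pt k) = g (P.pt (k + 1)) - g (P.pt k) :=
  div_mul_cancel₀ _ (sub_pos.2 (P.pt_lt hk)).ne'

theorem interp_eq (P : Mesh a b) (g : ℝ → ℝ) {k : ℕ} (hk : k < P.M) {x : ℝ}
    (hx : x ∈ Icc (P.pt k) (P.pt (k + 1))) :
    P.interp g x = g (P.pt k) + P.slope g k * (x - P.pt k) := by
  -- Clamping `x` to cell `i` yields the whole increment of `g` for cells to the left of `x`, a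
  -- partial one on its own cell and nothing to the right; the left part telescopes.
  have e : ∀ i ∈ Finset.range P.M, P.slope g i * (max (P.pt i) (min x (P.pt (i + 1))) - P.pt i)
      = if i < k then g (P.pt (i + 1)) - g (P.pt i)
        else if i = k then P.slope g k * (x - P.pt k) else 0 := by
    intro i hi
    have hi := Finset.mem_range.1 hi
    split_ifs with h1 h2
    · have h3 : P.pt (i + 1) ≤ P.pt k := P.pt_monotone h1
      rw [min_eq_right (h3.trans hx.1), max_eq_right (P.pt_lt hi).le, P.slope_mul g hi]
    · subst h2
      rw [min_eq_left hx.2, max_eq_right hx.1]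
    · have h3 : P.pt (k + 1) ≤ P.pt i := P.pt_monotone (by omega)
      rw [max_eq_left ((min_le_left _ _).trans (hx.2.trans h3)), sub_self, mul_zero]
  rw [interp, Finset.sum_congr rfl e,
    ← Finset.sum_subset (Finset.range_mono (by omega : k + 1 ≤ P.M)) ?_, Finset.sum_range_succ,
    Finset.sum_congr rfl fun i hi => if_pos (Finset.mem_range.1 hi),
    Finset.sum_range_sub fun i => g (P.pt i), P.pt_zero]
  · rw [if_neg (lt_irrefl k), if_pos rfl]
    ring
  · intro i _ hi
    rw [Finset.mem_range] at hi
    rw [if_neg (by omega), if_neg (by omega)]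

theorem interp_mem_femSpace (P : Mesh a b) (hab : a < b) {g : ℝ → ℝ} (ha : g a = 0)
    (hb : g b = 0) : P.interp g ∈ P.femSpace := by
  have hM : 0 < P.M := by
    by_contra h
    have h0 : P.M = 0 := by omega
    have := P.pt_last
    rw [h0, P.pt_zero] at this
    exact hab.ne this
  refine P.mem_femSpace_iff.2 ⟨?_, ?_, ?_, fun k hk => ?_⟩
  · unfold interp
    fun_prop
  · have := P.interp_eq g hM (x := a) ⟨P.pt_zero.le, (P.pt_mem _).1⟩
    rw [this, P.pt_zero, ha]
    simp
  · have h1 : P.M - 1 + 1 = P.M := by omega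
    have := P.interp_eq g (k := P.M - 1) (by omega) (x := b) ⟨(P.pt_mem _).2, by
      rw [h1, P.pt_last]⟩
    rw [this]
    have h2 := P.slope_mul g (k := P.M - 1) (by omega)
    rw [h1, P.pt_last, hb] at h2
    linarith
  · refine ⟨g (P.pt k) - P.slope g k * P.pt k, P.slope g k, fun x hx => ?_⟩
    rw [P.interp_eq g hk hx]
    ring

theorem integral_eq_sum_cells (P : Mesh a b) (hab : a ≤ b) {f : ℝ → ℝ}
    (hf : IntegrableOn f (Ioo a b)) :
    ∫ x in Ioo a b, f x = ∑ k ∈ Finset.range P.M, ∫ x in (P.pt k)..(P.pt (k + 1)), f x := by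
  have hi : IntervalIntegrable f volume a b := by
    rwa [intervalIntegrable_iff_integrableOn_Ioo_of_le hab]
  rw [intervalIntegral.sum_integral_adjacent_intervals, P.pt_zero, P.pt_last,
    intervalIntegral.integral_of_le hab, integral_Ioc_eq_integral_Ioo]
  intro k _
  refine hi.mono_set (uIcc_subset_uIcc ?_ ?_) <;> rw [uIcc_of_le hab] <;> exact P.pt_mem _

theorem intervalIntegrable_cell (P : Mesh a b) (hab : a ≤ b) {f : ℝ → ℝ}
    (hf : IntegrableOn f (Ioo a b)) (k : ℕ) :
    IntervalIntegrable f volume (P.pt k) (P.pt (k + 1)) := by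
  rw [← intervalIntegrable_iff_integrableOn_Ioo_of_le hab] at hf
  refine hf.mono_set (uIcc_subset_uIcc ?_ ?_) <;> rw [uIcc_of_le hab] <;> exact P.pt_mem _

/-- Nodal interpolation is the Ritz projection in one space dimension. -/
theorem integral_deriv_interp_mul_deriv (P : Mesh a b) (hab : a ≤ b) {w : ℝ → ℝ} (c₀ c₁ : ℝ)
    (hw : MemLp w 2 (volume.restrict (Ioo a b))) {v : ℝ → ℝ} (hv : v ∈ P.femSpace) {g g₁ : ℝ → ℝ}
    (hg₁ : g₁ = fun x => c₁ + ∫ y in a..x, w y) (hg : g = fun x => c₀ + ∫ y in a..x, g₁ y)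
    (hz : P.interp g ∈ P.femSpace) :
    ∫ x in Ioo a b, deriv (P.interp g) x * deriv v x = -∫ x in Ioo a b, w x * v x := by
  have hwi : IntegrableOn w (Ioo a b) := hw.integrable one_le_two
  have hwi' : IntervalIntegrable w volume a b := by
    rwa [intervalIntegrable_iff_integrableOn_Ioo_of_le hab]
  have hg₁c : ContinuousOn g₁ (uIcc a b) := by
    rw [hg₁]
    exact continuousOn_const.add
      (intervalIntegral.continuousOn_primitive_interval' hwi' left_mem_uIcc)
  have hg₁i : IntervalIntegrable g₁ volume a b := hg₁c.intervalIntegrable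
  have hmem : ∀ k, P.pt k ∈ uIcc a b := fun k => by rw [uIcc_of_le hab]; exact P.pt_mem k
  have i1 : IntegrableOn (fun x => deriv (P.interp g) x * deriv v x) (Ioo a b) :=
    (P.memLp_deriv_of_mem_femSpace hz).integrable_mul (P.memLp_deriv_of_mem_femSpace hv)
  have i2 : IntegrableOn (fun x => w x * v x) (Ioo a b) :=
    hw.integrable_mul (P.memLp_of_mem_femSpace hv)
  -- On a cell `v'` is a constant `d`, so only the mean of the derivative matters, and the
  -- interpolant and `g` have the same increment there. Integrating `g₁ v'` by parts gives nodal
  -- terms that telescope and vanish at `a` and `b`.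
  have cell : ∀ k ∈ Finset.range P.M,
      ∫ x in (P.pt k)..(P.pt (k + 1)), deriv (P.interp g) x * deriv v x
        = (g₁ (P.pt (k + 1)) * v (P.pt (k + 1)) - g₁ (P.pt k) * v (P.pt k))
          - ∫ x in (P.pt k)..(P.pt (k + 1)), w x * v x := by
    intro k hk
    have hk := Finset.mem_range.1 hk
    have hlt := P.pt_lt hk
    obtain ⟨c, d, h⟩ := (P.mem_femSpace_iff.1 hv).2.2.2 k hk
    have hI : ∀ x ∈ Icc (P.pt k) (P.pt (k + 1)),
        P.interp g x = (g (P.pt k) - P.slope g k * P.pt k) + P.slope g k * x := fun x hx => by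
      rw [P.interp_eq g hk hx]; ring
    have e1 : ∫ x in (P.pt k)..(P.pt (k + 1)), deriv (P.interp g) x * deriv v x
        = ∫ _x in (P.pt k)..(P.pt (k + 1)), P.slope g k * d := by
      refine intervalIntegral.integral_congr_ae ?_
      filter_upwards [compl_mem_ae_iff.2 (measure_singleton (P.pt (k + 1)))] with x hx hxm
      rw [uIoc_of_le hlt.le] at hxm
      have hxo : x ∈ Ioo (P.pt k) (P.pt (k + 1)) := ⟨hxm.1, lt_of_le_of_ne hxm.2 hx⟩
      rw [(hasDerivAt_of_affine hI hxo).deriv, (hasDerivAt_of_affine h hxo).deriv]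
    have e2 : ∫ x in (P.pt k)..(P.pt (k + 1)), w x * v x
        = ∫ x in (P.pt k)..(P.pt (k + 1)), w x * (c + d * x) := by
      refine intervalIntegral.integral_congr fun x hx => ?_
      rw [uIcc_of_le hlt.le] at hx
      simp only [h x hx]
    have ibp := integral_primitive_mul_deriv c₁ hwi' (hmem k) (hmem (k + 1))
      (φ := fun x => c + d * x) (by fun_prop)
    have hd : deriv (fun x : ℝ => c + d * x) = fun _ => d := by
      funext x
      simp
    rw [hd] at ibp
    have e3 : g (P.pt (k + 1)) - g (P.pt k) = ∫ x in (P.pt k)..(P.pt (k + 1)), g₁ x := by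
      rw [hg, add_sub_add_left_eq_sub]
      exact intervalIntegral.integral_interval_sub_left
        (hg₁i.mono_set (uIcc_subset_uIcc left_mem_uIcc (hmem _)))
        (hg₁i.mono_set (uIcc_subset_uIcc left_mem_uIcc (hmem _)))
    have e4 := P.slope_mul g hk
    rw [e1, e2, intervalIntegral.integral_const, smul_eq_mul,
      h _ (left_mem_Icc.2 hlt.le), h _ (right_mem_Icc.2 hlt.le)]
    rw [intervalIntegral.integral_mul_const] at ibp
    rw [e3, hg₁] at e4
    rw [hg₁]
    linear_combination ibp + d * e4
  rw [P.integral_eq_sum_cells hab i1, P.integral_eq_sum_cells hab i2, Finset.sum_congr rfl cell,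
    Finset.sum_sub_distrib, Finset.sum_range_sub fun k => g₁ (P.pt k) * v (P.pt k), P.pt_last,
    P.pt_zero, hv.2.1, hv.2.2.1]
  ring

/-- Cauchy–Schwarz against the constant `1`, obtained by expanding the square of `(q - p) |w| - B`.
-/
theorem sq_integral_abs_le {p q : ℝ} (hpq : p ≤ q) {w : ℝ → ℝ}
    (hw : IntervalIntegrable w volume p q) (hw2 : IntervalIntegrable (fun x => w x ^ 2) volume p q) :
    (∫ x in p..q, |w x|) ^ 2 ≤ (q - p) * ∫ x in p..q, w x ^ 2 := by
  set B := ∫ x in p..q, |w x| with hB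
  have h : 0 ≤ ∫ x in p..q, ((q - p) * |w x| - B) ^ 2 :=
    intervalIntegral.integral_nonneg hpq fun x _ => sq_nonneg _
  have e : ∫ x in p..q, ((q - p) * |w x| - B) ^ 2
      = (q - p) ^ 2 * (∫ x in p..q, w x ^ 2) - 2 * (q - p) * B * B + (q - p) * B ^ 2 := by
    have : ∀ x, ((q - p) * |w x| - B) ^ 2
        = (q - p) ^ 2 * w x ^ 2 - 2 * (q - p) * B * |w x| + B ^ 2 := fun x => by
      rw [← sq_abs (w x)]; ring
    simp only [this]
    rw [intervalIntegral.integral_add ((hw2.const_mul _).sub (hw.abs.const_mul _)) (by simp),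
      intervalIntegral.integral_sub (hw2.const_mul _) (hw.abs.const_mul _),
      intervalIntegral.integral_const_mul, intervalIntegral.integral_const_mul,
      intervalIntegral.integral_const, smul_eq_mul, ← hB]
  rw [e] at h
  rcases hpq.eq_or_lt with hpq' | hpq'
  · have : B = 0 := by rw [hB, hpq', intervalIntegral.integral_same]
    rw [this, hpq']; simp
  · have hpos : 0 < q - p := sub_pos.2 hpq'
    have : 0 ≤ (q - p) * ((q - p) * (∫ x in p..q, w x ^ 2) - B ^ 2) := by nlinarith
    have := nonneg_of_mul_nonneg_right this hpos
    linarith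

/-- On a cell `[p, q]` the oscillation of `g₁` is at most `∫ |w|`, so the error is pointwise at most
`2 (q - p) ∫ |w|`. Cauchy–Schwarz and integration over the cell give the factor `(2 (q - p) ^ 2) ^
2`. -/
theorem integral_sq_sub_interp_le (P : Mesh a b) (hab : a ≤ b) {w : ℝ → ℝ} (c₀ c₁ : ℝ)
    (hw : MemLp w 2 (volume.restrict (Ioo a b))) {g g₁ : ℝ → ℝ}
    (hg₁ : g₁ = fun x => c₁ + ∫ y in a..x, w y) (hg : g = fun x => c₀ + ∫ y in a..x, g₁ y) :
    ∫ x in Ioo a b, (g x - P.interp g x) ^ 2 ≤ (2 * P.diam ^ 2) ^ 2 * ∫ x in Ioo a b, w x ^ 2 := by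
  have hwi : IntegrableOn w (Ioo a b) := hw.integrable one_le_two
  have hw2 : IntegrableOn (fun x => w x ^ 2) (Ioo a b) := hw.integrable_sq
  have hwi' : IntervalIntegrable w volume a b := by
    rwa [intervalIntegrable_iff_integrableOn_Ioo_of_le hab]
  have hg₁c : ContinuousOn g₁ (uIcc a b) := by
    rw [hg₁]
    exact continuousOn_const.add
      (intervalIntegral.continuousOn_primitive_interval' hwi' left_mem_uIcc)
  have hg₁i : IntervalIntegrable g₁ volume a b := hg₁c.intervalIntegrable
  have hgc : ContinuousOn g (Icc a b) := by
    rw [hg, ← uIcc_of_le hab]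
    exact continuousOn_const.add
      (intervalIntegral.continuousOn_primitive_interval' hg₁i left_mem_uIcc)
  have hmem : ∀ k, P.pt k ∈ uIcc a b := fun k => by rw [uIcc_of_le hab]; exact P.pt_mem k
  have hic : Continuous (P.interp g) := by unfold interp; fun_prop
  have hint : IntegrableOn (fun x => (g x - P.interp g x) ^ 2) (Ioo a b) :=
    (((hgc.sub hic.continuousOn).pow 2).integrableOn_compact isCompact_Icc).mono_set
      Ioo_subset_Icc_self
  rw [P.integral_eq_sum_cells hab hint, P.integral_eq_sum_cells hab hw2, Finset.mul_sum]
  refine Finset.sum_le_sum fun k hk => ?_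
  have hk := Finset.mem_range.1 hk
  have hlt := P.pt_lt hk
  set p := P.pt k with hp
  set q := P.pt (k + 1) with hq
  have hwpq : IntervalIntegrable w volume p q := P.intervalIntegrable_cell hab hwi k
  have hw2pq : IntervalIntegrable (fun x => w x ^ 2) volume p q :=
    P.intervalIntegrable_cell hab hw2 k
  set B := ∫ x in p..q, |w x| with hB
  have hsubset : ∀ x ∈ Icc p q, x ∈ uIcc a b := fun x hx => by
    rw [uIcc_of_le hab]; exact ⟨(P.pt_mem k).1.trans hx.1, hx.2.trans (P.pt_mem _).2⟩
  have hosc : ∀ x ∈ Icc p q, ‖g₁ x - g₁ p‖ ≤ B := by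
    intro x hx
    have hpx : IntervalIntegrable w volume p x := hwpq.mono_set (by
      rw [uIcc_of_le hx.1, uIcc_of_le hlt.le]; exact Icc_subset_Icc_right hx.2)
    have e : g₁ x - g₁ p = ∫ y in p..x, w y := by
      rw [hg₁, add_sub_add_left_eq_sub]
      exact intervalIntegral.integral_interval_sub_left
        (hwi'.mono_set (uIcc_subset_uIcc left_mem_uIcc (hsubset x hx)))
        (hwi'.mono_set (uIcc_subset_uIcc left_mem_uIcc (hmem k)))
    rw [e]
    refine (intervalIntegral.norm_integral_le_integral_norm hx.1).trans ?_
    exact intervalIntegral.integral_mono_interval le_rfl hx.1 hx.2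
      (Filter.Eventually.of_forall fun y => abs_nonneg _) hwpq.abs
  have hprim : ∀ x ∈ Icc p q, g x - g p = ∫ y in p..x, g₁ y := by
    intro x hx
    rw [hg, add_sub_add_left_eq_sub]
    exact intervalIntegral.integral_interval_sub_left
      (hg₁i.mono_set (uIcc_subset_uIcc left_mem_uIcc (hsubset x hx)))
      (hg₁i.mono_set (uIcc_subset_uIcc left_mem_uIcc (hmem k)))
  have hpt : ∀ x ∈ Icc p q, (g x - P.interp g x) ^ 2
      ≤ (2 * (q - p)) ^ 2 * ((q - p) * ∫ x in p..q, w x ^ 2) := by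
    intro x hx
    have h1 := norm_sub_linear_interp_le hlt
      (hg₁i.mono_set (uIcc_subset_uIcc (hmem k) (hmem (k + 1)))) hprim hosc hx
    have e : ((q - x) / (q - p)) • g p + ((x - p) / (q - p)) • g q = P.interp g x := by
      have hne : q - p ≠ 0 := (sub_pos.2 hlt).ne'
      rw [P.interp_eq g hk hx, slope, ← hp, ← hq, smul_eq_mul, smul_eq_mul]
      field_simp
      ring
    rw [e, Real.norm_eq_abs] at h1
    calc (g x - P.interp g x) ^ 2 = |g x - P.interp g x| ^ 2 := (sq_abs _).symm
      _ ≤ (2 * (q - p) * B) ^ 2 := pow_le_pow_left₀ (abs_nonneg _) h1 2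
      _ = (2 * (q - p)) ^ 2 * B ^ 2 := by ring
      _ ≤ _ := mul_le_mul_of_nonneg_left (sq_integral_abs_le hlt.le hwpq hw2pq) (sq_nonneg _)
  have hW : 0 ≤ ∫ x in p..q, w x ^ 2 :=
    intervalIntegral.integral_nonneg hlt.le fun x _ => sq_nonneg _
  have hd := P.pt_succ_sub_le_diam hk
  have hqp : 0 ≤ q - p := (sub_pos.2 hlt).le
  calc ∫ x in p..q, (g x - P.interp g x) ^ 2
      ≤ ∫ _x in p..q, (2 * (q - p)) ^ 2 * ((q - p) * ∫ x in p..q, w x ^ 2) :=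
        intervalIntegral.integral_mono_on hlt.le (P.intervalIntegrable_cell hab hint k) (by simp) hpt
    _ = (2 * (q - p) ^ 2) ^ 2 * ∫ x in p..q, w x ^ 2 := by
        rw [intervalIntegral.integral_const, smul_eq_mul]; ring
    _ ≤ _ := by gcongr

end BlackScholesFEM.Mesh

/-! ### Functions as elements of `L²` -/

section MkL2

variable {a b : ℝ}

open Classical in
/-- The class in `L²(a, b)` of a square-integrable function, and `0` for other functions. -/
noncomputable def mkL2 (a b : ℝ) (f : ℝ → ℝ) : L2 a b :=
  if h : MemLp f 2 (volume.restrict (Ioo a b)) then h.toLp f else 0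

theorem coeFn_mkL2 {f : ℝ → ℝ} (h : MemLp f 2 (volume.restrict (Ioo a b))) :
    mkL2 a b f =ᵐ[volume.restrict (Ioo a b)] f := by
  rw [mkL2, dif_pos h]
  exact h.coeFn_toLp

theorem l2Inner_coe_left (u : L2 a b) {g : ℝ → ℝ} (hg : MemLp g 2 (volume.restrict (Ioo a b))) :
    l2Inner a b u g = inner ℝ u (mkL2 a b g) := by
  rw [l2Inner, integral_mul_eq_inner u hg, mkL2, dif_pos hg, real_inner_comm]

theorem l2Inner_eq_inner {f g : ℝ → ℝ} (hf : MemLp f 2 (volume.restrict (Ioo a b)))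
    (hg : MemLp g 2 (volume.restrict (Ioo a b))) :
    l2Inner a b f g = inner ℝ (mkL2 a b f) (mkL2 a b g) := by
  rw [← l2Inner_coe_left _ hg]
  refine integral_congr_ae ?_
  filter_upwards [coeFn_mkL2 hf] with x hx
  rw [hx]

theorem mkL2_congr {f : ℝ → ℝ} (hf : MemLp f 2 (volume.restrict (Ioo a b))) {u : L2 a b}
    (h : u =ᵐ[volume.restrict (Ioo a b)] f) : mkL2 a b f = u :=
  Lp.ext ((coeFn_mkL2 hf).trans h.symm)

theorem mkL2_sub {f g : ℝ → ℝ} (hf : MemLp f 2 (volume.restrict (Ioo a b)))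
    (hg : MemLp g 2 (volume.restrict (Ioo a b))) :
    mkL2 a b (f - g) = mkL2 a b f - mkL2 a b g :=
  mkL2_congr (hf.sub hg) ((Lp.coeFn_sub _ _).trans ((coeFn_mkL2 hf).sub (coeFn_mkL2 hg)))

theorem memLp_sum_smul {ι : Type*} (s : Finset ι) (c : ι → ℝ) {f : ι → ℝ → ℝ}
    (hf : ∀ j ∈ s, MemLp (f j) 2 (volume.restrict (Ioo a b))) :
    MemLp (∑ j ∈ s, c j • f j) 2 (volume.restrict (Ioo a b)) :=
  memLp_finsetSum' s fun j hj => (hf j hj).const_smul (c j)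

theorem mkL2_sum_smul {ι : Type*} (s : Finset ι) (c : ι → ℝ) {f : ι → ℝ → ℝ}
    (hf : ∀ j ∈ s, MemLp (f j) 2 (volume.restrict (Ioo a b))) :
    mkL2 a b (∑ j ∈ s, c j • f j) = ∑ j ∈ s, c j • mkL2 a b (f j) := by
  classical
  induction s using Finset.induction_on with
  | empty =>
    rw [Finset.sum_empty, Finset.sum_empty]
    exact mkL2_congr MemLp.zero (Lp.coeFn_zero _ _ _)
  | insert i s hi ih =>
    have h1 := hf i (Finset.mem_insert_self i s)
    have h2 : ∀ j ∈ s, MemLp (f j) 2 (volume.restrict (Ioo a b)) :=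
      fun j hj => hf j (Finset.mem_insert_of_mem hj)
    have h3 := memLp_sum_smul s c h2
    rw [Finset.sum_insert hi, Finset.sum_insert hi, ← ih h2]
    refine mkL2_congr ((h1.const_smul (c i)).add h3) ?_
    exact (Lp.coeFn_add _ _).trans (((Lp.coeFn_smul _ _).trans
      ((coeFn_mkL2 h1).const_smul (c i))).add (coeFn_mkL2 h3))

theorem l2Norm_sub_sq (u : L2 a b) {f : ℝ → ℝ} (hf : MemLp f 2 (volume.restrict (Ioo a b))) :
    l2Norm a b (fun x => u x - f x) ^ 2 = ‖u - mkL2 a b f‖ ^ 2 := by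
  have hm : MemLp (fun x => u x - f x) 2 (volume.restrict (Ioo a b)) := (Lp.memLp u).sub hf
  have e : mkL2 a b (fun x => u x - f x) = u - mkL2 a b f :=
    mkL2_congr hm ((Lp.coeFn_sub _ _).trans ((Filter.EventuallyEq.refl _ _).sub (coeFn_mkL2 hf)))
  rw [l2Norm, l2Inner_eq_inner hm hm, e, real_inner_self_eq_norm_sq, Real.sq_sqrt (sq_nonneg _)]

theorem norm_sq_L2 (u : L2 a b) : ‖u‖ ^ 2 = ∫ x in Ioo a b, u x ^ 2 := by
  rw [← real_inner_self_eq_norm_sq, L2.inner_def]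
  exact integral_congr_ae (Filter.Eventually.of_forall fun x => by simp [sq])

end MkL2

/-! ### The maps `H² → L²` -/

section H2Maps

variable {a b : ℝ}

/-- The inclusion `H² → L²` as a continuous linear map. -/
noncomputable def toL2CLM (a b : ℝ) : H2 a b →L[ℝ] L2 a b :=
  (PiLp.proj 2 (fun _ : Fin 3 => L2 a b) 0).comp (H2 a b).subtypeL

/-- The second weak derivative as a continuous linear map. -/
noncomputable def dxxCLM (a b : ℝ) : H2 a b →L[ℝ] L2 a b :=
  (PiLp.proj 2 (fun _ : Fin 3 => L2 a b) 2).comp (H2 a b).subtypeL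

theorem toL2CLM_apply (u : H2 a b) : toL2CLM a b u = toL2 u := rfl

theorem dxxCLM_apply (u : H2 a b) : dxxCLM a b u = dxx u := rfl

theorem norm_toL2_le (u : H2 a b) : ‖toL2 u‖ ≤ ‖u‖ := PiLp.norm_apply_le _ 0

theorem norm_dxx_le (u : H2 a b) : ‖dxx u‖ ≤ ‖u‖ := PiLp.norm_apply_le _ 2

end H2Maps

/-! ### The Ritz projection -/

/-- Finite element functions are differentiable only off the nodes, so `deriv` is additive merely
almost everywhere, which suffices in `L²`. -/
theorem deriv_sub_ae_eq {a b : ℝ} (P : Mesh a b) {v w : ℝ → ℝ} (hv : v ∈ P.femSpace)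
    (hw : w ∈ P.femSpace) :
    mkL2 a b (deriv (v - w)) = mkL2 a b (deriv v) - mkL2 a b (deriv w) := by
  have h1 := P.memLp_deriv_of_mem_femSpace hv
  have h2 := P.memLp_deriv_of_mem_femSpace hw
  rw [← mkL2_sub h1 h2]
  refine mkL2_congr (P.memLp_deriv_of_mem_femSpace (P.sub_mem_femSpace hv hw)) ?_
  refine (coeFn_mkL2 (h1.sub h2)).trans ?_
  filter_upwards [P.ae_differentiableAt hv, P.ae_differentiableAt hw] with x hx hy
  rw [deriv_sub hx hy, Pi.sub_apply]

/-- The projection is the nodal interpolant of the `C¹` representative. Its defining property is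
written with `-∂ₓ²u` tested against `v`, the form in which the equation for `ω` supplies the
diffusion term. -/
theorem exists_ritz {a b : ℝ} (hab : a < b) (P : Mesh a b) {u : H2 a b} (hu : ZeroBoundary u) :
    ∃ z ∈ P.femSpace, ‖toL2 u - mkL2 a b z‖ ≤ 2 * P.diam ^ 2 * ‖u‖ ∧
      ∀ v ∈ P.femSpace, inner ℝ (mkL2 a b (deriv z)) (mkL2 a b (deriv v))
        = -inner ℝ (dxx u) (mkL2 a b v) := by
  obtain ⟨c₀, c₁, ha, hb, hug⟩ := hu.exists_representative hab
  set g₁ : ℝ → ℝ := fun x => c₁ + ∫ y in a..x, dxx u y with hg₁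
  set g : ℝ → ℝ := fun x => c₀ + ∫ y in a..x, g₁ y with hg
  have hz := P.interp_mem_femSpace hab ha hb
  have hw := Lp.memLp (dxx u)
  refine ⟨P.interp g, hz, ?_, fun v hv => ?_⟩
  · refine le_trans ?_ (mul_le_mul_of_nonneg_left (norm_dxx_le u) (by positivity))
    refine (sq_le_sq₀ (norm_nonneg _) (by positivity)).1 ?_
    rw [mul_pow, norm_sq_L2, norm_sq_L2]
    refine le_trans (le_of_eq ?_) (P.integral_sq_sub_interp_le hab.le c₀ c₁ hw hg₁ hg)
    refine integral_congr_ae ?_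
    filter_upwards [Lp.coeFn_sub (toL2 u) (mkL2 a b (P.interp g)), hug,
      coeFn_mkL2 (P.memLp_of_mem_femSpace hz)] with x h1 h2 h3
    rw [h1, Pi.sub_apply, h2, h3]
  · rw [← l2Inner_eq_inner (P.memLp_deriv_of_mem_femSpace hz) (P.memLp_deriv_of_mem_femSpace hv),
      ← l2Inner_coe_left _ (P.memLp_of_mem_femSpace hv)]
    exact P.integral_deriv_interp_mul_deriv hab.le c₀ c₁ hw hv hg₁ hg hz

/-! ### Consistency and stability of the scheme -/

theorem intervalIntegrable_of_abs_le_beta {g : ℝ → ℝ} {a C T : ℝ} (ha : 0 < a) (hT : 0 ≤ T)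
    (hm : Measurable g) (h : ∀ y ∈ Ioo 0 T, |g y| ≤ C * beta a y) :
    IntervalIntegrable g volume 0 T := by
  have hi := (intervalIntegrable_beta ha 0 T).const_mul C
  rw [intervalIntegrable_iff_integrableOn_Ioo_of_le hT] at hi ⊢
  refine Integrable.mono' hi hm.aestronglyMeasurable ?_
  filter_upwards [ae_restrict_mem measurableSet_Ioo] with y hy
  exact h y hy

/-- The weights of `g` are dominated by those of `C β_a`, whose sum is at most the integral of `β_a`
over `[0, T]`, uniformly in `τ`. -/
theorem norm_sum_weight_smul_le {E : Type*} [NormedAddCommGroup E] [NormedSpace ℝ E] {g : ℝ → ℝ}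
    {a C T τ X : ℝ} (ha : 0 < a) (hT : 0 ≤ T) (hτ : 0 < τ) (hC : 0 ≤ C) (hX : 0 ≤ X)
    (hg : IntervalIntegrable g volume 0 T) (h : ∀ y ∈ Ioo 0 T, |g y| ≤ C * beta a y) {n : ℕ}
    (hn : n * τ ≤ T) {x : ℕ → E} (hx : ∀ j ∈ Finset.Icc 1 n, ‖x j‖ ≤ X) :
    ‖∑ j ∈ Finset.Icc 1 n, weight g τ n j • x j‖ ≤ C * (T ^ a / (a * Real.Gamma a)) * X := by
  have e : ∑ j ∈ Finset.Icc 1 n, convWeight (beta a) T τ (n - j)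
      = ∑ k ∈ Finset.range n, convWeight (beta a) T τ k := by
    refine Finset.sum_nbij' (fun j => n - j) (fun k => n - k) ?_ ?_ ?_ ?_ ?_ <;>
      intro i hi <;> simp only [Finset.mem_Icc, Finset.mem_range] at * <;> omega
  calc _ ≤ ∑ j ∈ Finset.Icc 1 n, C * convWeight (beta a) T τ (n - j) * X := by
        refine (norm_sum_le _ _).trans (Finset.sum_le_sum fun j hj => ?_)
        have hj' := Finset.mem_Icc.1 hj
        rw [norm_smul, weight_eq_convWeight hτ hj'.1 hj'.2 hn hg, Real.norm_eq_abs]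
        exact mul_le_mul (abs_convWeight_le τ ha hT h _) (hx j hj) (norm_nonneg _)
          (mul_nonneg hC (convWeight_beta_nonneg ha hT _))
    _ = C * (∑ k ∈ Finset.range n, convWeight (beta a) T τ k) * X := by
        rw [← Finset.sum_mul, ← Finset.mul_sum, e]
    _ ≤ _ := by
        gcongr
        exact sum_convWeight_beta_le ha hT hτ n

theorem conv_clm {a b T : ℝ} {g : ℝ → ℝ} {ω : ℝ → H2 a b} (L : H2 a b →L[ℝ] L2 a b) {t : ℝ}
    (ht : t ∈ Icc 0 T) (hg : IntervalIntegrable g volume 0 T) (hω : ContinuousOn ω (Icc 0 T)) :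
    conv g (fun s => L (ω s)) t = L (conv g ω t) := by
  unfold conv
  rw [← L.intervalIntegral_comp_comm (intervalIntegrable_conv ht hg hω)]
  simp only [map_smul]

/-- Decay rate and step size restriction for the stability estimate. -/
theorem exists_decay_rate {a : ℝ} (ha : 0 < a) {C B : ℝ} (hC : 0 ≤ C) (hB : 0 ≤ B) :
    ∃ κ > 0, C * B * (C * (Real.exp 1 * (1 / κ) ^ a)) ≤ 1 / 4 := by
  set X := C * B * C * Real.exp 1 with hX
  have hX0 : 0 ≤ X := by positivity
  -- This `κ` satisfies `κ ^ a = 4 X + 1`, and `X / (4 X + 1) ≤ 1 / 4`.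
  refine ⟨(4 * X + 1) ^ (1 / a), by positivity, ?_⟩
  have e : (1 / (4 * X + 1) ^ (1 / a)) ^ a = 1 / (4 * X + 1) := by
    rw [Real.div_rpow zero_le_one (by positivity), Real.one_rpow, ← Real.rpow_mul (by positivity),
      one_div_mul_cancel ha.ne', Real.rpow_one]
  rw [e]
  calc _ = X / (4 * X + 1) := by rw [hX]; ring
    _ ≤ _ := by rw [div_le_div_iff₀ (by positivity) (by norm_num)]; linarith

/-- The stability estimate for the fully discrete scheme. -/
theorem sum_norm_sq_le_of_scheme {E : Type*} [NormedAddCommGroup E] [InnerProductSpace ℝ E]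
    {g : ℝ → ℝ} {a C T κ τ l c : ℝ} (ha : 0 < a) (ha1 : a ≤ 1) (hT : 0 ≤ T) (hC : 0 ≤ C)
    (hg : IntervalIntegrable g volume 0 T) (hgC : ∀ y ∈ Ioo 0 T, |g y| ≤ C * beta a y)
    (hκ : 0 < κ)
    (hκC : C * (T ^ a / (a * Real.Gamma a)) * (C * (Real.exp 1 * (1 / κ) ^ a)) ≤ 1 / 4)
    (hτ : 0 < τ) (hτκ : τ ≤ 1 / κ) (hl : 0 ≤ l) (hc : 0 ≤ c) {N : ℕ} (hN : N * τ = T)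
    (x y ρ : ℕ → E)
    (h : ∀ n ∈ Finset.Icc 1 N, inner ℝ (x n) (x n)
      + inner ℝ (∑ j ∈ Finset.Icc 1 n, weight g τ n j • x j) (x n)
      + l * inner ℝ (∑ j ∈ Finset.Icc 1 n, weight (beta a) τ n j • x j) (x n)
      + c * inner ℝ (∑ j ∈ Finset.Icc 1 n, weight (beta a) τ n j • y j) (y n)
        = inner ℝ (ρ n) (x n)) :
    ∑ n ∈ Finset.Icc 1 N, ‖x n‖ ^ 2
      ≤ 4 * Real.exp (κ * T) * ∑ n ∈ Finset.Icc 1 N, ‖ρ n‖ ^ 2 := by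
  have hG := Real.Gamma_pos_of_pos ha
  have hmT : ∀ m ≤ N, (m : ℝ) * τ ≤ T := fun m hm => by
    rw [← hN]
    exact mul_le_mul_of_nonneg_right (by exact_mod_cast hm) hτ.le
  have hw : ∀ (f : ℝ → ℝ) (_ : IntervalIntegrable f volume 0 T) (z : ℕ → E), ∀ n ∈ Finset.Icc 1 N,
      ∑ j ∈ Finset.Icc 1 n, weight f τ n j • z j
        = ∑ j ∈ Finset.Icc 1 n, convWeight f T τ (n - j) • z j := by
    intro f hf z n hn
    refine Finset.sum_congr rfl fun j hj => ?_
    have hj := Finset.mem_Icc.1 hj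
    rw [weight_eq_convWeight hτ hj.1 hj.2 (hmT n (Finset.mem_Icc.1 hn).2) hf]
  have hβ := intervalIntegrable_beta ha 0 T
  have hθ : ∑ k ∈ Finset.range N, C * convWeight (beta a) T τ k * Real.exp (-κ * τ) ^ k
      ≤ C * (Real.exp 1 * (1 / κ) ^ a) := by
    simp only [mul_assoc C]
    rw [← Finset.mul_sum]
    refine mul_le_mul_of_nonneg_left ?_ hC
    -- The restriction `τ ≤ 1 / κ` enters here, to replace `exp (κ τ)` by `exp 1`.
    refine (sum_convWeight_beta_mul_exp_le ha hT hτ hκ.le N).trans ?_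
    refine mul_le_mul (Real.exp_le_exp.2 ?_) (integral_beta_mul_exp_le ha hT hκ)
      (intervalIntegral.integral_nonneg hT fun y hy =>
        mul_nonneg (beta_nonneg ha hy.1) (Real.exp_pos _).le) (Real.exp_pos _).le
    rwa [le_div_iff₀ hκ, mul_comm] at hτκ
  have hL : ∑ k ∈ Finset.range N, C * convWeight (beta a) T τ k
      ≤ C * (T ^ a / (a * Real.Gamma a)) := by
    rw [← Finset.mul_sum]
    exact mul_le_mul_of_nonneg_left (sum_convWeight_beta_le ha hT hτ N) hC
  have main := convolution_scheme_stable (b := convWeight (beta a) T τ) (v := convWeight g T τ)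
    (w := fun k => C * convWeight (beta a) T τ k) (N := N) (r := Real.exp (-κ * τ)) (l := l) (c := c)
    (Real.exp_pos _) (Real.exp_le_one_iff.2 (by nlinarith))
    (fun k => mul_nonneg hC (convWeight_beta_nonneg ha hT k))
    (fun k _ => abs_convWeight_le τ ha hT hgC k) hL hθ hκC hl hc x y ρ
    (fun m hm => sum_convWeight_beta_nonneg ha ha1 hτ (hmT m hm) x)
    (fun m hm => sum_convWeight_beta_nonneg ha ha1 hτ (hmT m hm) y)
    (fun n hn => by rw [← hw g hg x n hn, ← hw _ hβ x n hn, ← hw _ hβ y n hn]; exact h n hn)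
  have e : Real.exp (-κ * τ) ^ N = (Real.exp (κ * T))⁻¹ := by
    rw [← Real.exp_nat_mul, ← Real.exp_neg, ← hN]; ring_nf
  rw [e, mul_inv_le_iff₀ (Real.exp_pos _)] at main
  linarith

/-- The equation for `ξⁿ = zⁿ - Wⁿ`, the difference of the Ritz projection and the discrete
solution, and the bound for its right-hand side. -/
theorem exists_error_equation {a b T σ r : ℝ} (hT : 0 < T) {α : ℝ → ℝ}
    (hα : AdmissibleExponent T α) {K C : ℝ} (hK : 0 < K) (hC : 0 ≤ C)
    (hq : ∀ y ∈ Ioo 0 T, |deriv (qfun α) y| ≤ C * beta (α 0) y) {F : ℝ → L2 a b}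
    {ω ω₁ ω₂ : ℝ → H2 a b} (hsol : IsSolution a b T σ r α F ω)
    (hω : SingularAtZero T (α 0) K ω ω₁ ω₂) {N : ℕ} (hN : 1 ≤ N) {P : Mesh a b}
    {W : ℕ → ℝ → ℝ} (hW : IsDiscreteSolution T σ r α F N P W) {z : ℕ → ℝ → ℝ} {H : ℝ}
    (hH : 0 ≤ H) (hz : ∀ n ∈ Finset.Icc 1 N, z n ∈ P.femSpace)
    (hη : ∀ n ∈ Finset.Icc 1 N, ‖toL2 (ω (n * (T / N))) - mkL2 a b (z n)‖ ≤ H)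
    (hR : ∀ n ∈ Finset.Icc 1 N, ∀ v ∈ P.femSpace,
      inner ℝ (mkL2 a b (deriv (z n))) (mkL2 a b (deriv v))
        = -inner ℝ (dxx (ω (n * (T / N)))) (mkL2 a b v)) :
    ∃ ρ : ℕ → L2 a b,
      (∀ n ∈ Finset.Icc 1 N, ∀ v ∈ P.femSpace,
        inner ℝ (mkL2 a b (z n - W n)) (mkL2 a b v)
          + inner ℝ (∑ j ∈ Finset.Icc 1 n, weight (deriv (qfun α)) (T / N) n j •
              mkL2 a b (z j - W j)) (mkL2 a b v)
          + lam σ r * inner ℝ (∑ j ∈ Finset.Icc 1 n, weight (beta (α 0)) (T / N) n j •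
              mkL2 a b (z j - W j)) (mkL2 a b v)
          + 1 / 2 * σ ^ 2 * inner ℝ (∑ j ∈ Finset.Icc 1 n, weight (beta (α 0)) (T / N) n j •
              mkL2 a b (deriv (z j - W j))) (mkL2 a b (deriv v))
          = inner ℝ (ρ n) (mkL2 a b v)) ∧
      ∀ n ∈ Finset.Icc 1 N, ‖ρ n‖ ≤
        (1 + (C + lam σ r) * (T ^ α 0 / (α 0 * Real.Gamma (α 0)))) * H
        + (C + lam σ r + 1 / 2 * σ ^ 2) * (((8 * K + 2 * K / α 0) *
          ((∫ u in (0 : ℝ)..1, (1 - u) ^ (α 0 - 1) * u ^ ((1 - (1 + α 0) / 2) - 1))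
            / Real.Gamma (α 0))) *
          ((T / N) ^ ((1 + 3 * α 0) / 2) * (n * (T / N)) ^ ((α 0 - 1) / 2))) := by
  obtain ⟨ha0, ha1⟩ := hα.zero_mem hT
  have hN0 : (0 : ℝ) < N := by exact_mod_cast hN
  set τ := T / N with hτdef
  have hτ : 0 < τ := by positivity
  have hNτ : N * τ = T := by rw [hτdef]; field_simp
  have hl : 0 ≤ lam σ r := by unfold lam; positivity
  have hnT : ∀ n ∈ Finset.Icc 1 N, (n : ℝ) * τ ≤ T := fun n hn => by
    rw [← hNτ]
    exact mul_le_mul_of_nonneg_right (by exact_mod_cast (Finset.mem_Icc.1 hn).2) hτ.le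
  have hnpos : ∀ n ∈ Finset.Icc 1 N, (0 : ℝ) < n * τ := fun n hn => by
    have : (0 : ℝ) < n := by exact_mod_cast (Finset.mem_Icc.1 hn).1
    positivity
  have hsub : ∀ n ∈ Finset.Icc 1 N, ∀ j ∈ Finset.Icc 1 n, j ∈ Finset.Icc 1 N :=
    fun n hn j hj => Finset.mem_Icc.2 ⟨(Finset.mem_Icc.1 hj).1,
      (Finset.mem_Icc.1 hj).2.trans (Finset.mem_Icc.1 hn).2⟩
  have hqi : IntervalIntegrable (deriv (qfun α)) volume 0 T :=
    intervalIntegrable_of_abs_le_beta ha0 hT.le (measurable_deriv _) hq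
  have hβi := intervalIntegrable_beta ha0 0 T
  have hβ1 : ∀ y ∈ Ioo 0 T, |beta (α 0) y| ≤ 1 * beta (α 0) y := fun y hy => by
    rw [one_mul, abs_of_nonneg (beta_nonneg ha0 hy.1.le)]
  have hωc := hω.continuousOn hT.le
  set wq := weight (deriv (qfun α)) τ with hwq
  set wb := weight (beta (α 0)) τ with hwb
  set η : ℕ → L2 a b := fun n => toL2 (ω (n * τ)) - mkL2 a b (z n) with hηdef
  -- The quadrature defects are formed in `H²`, so that one estimate bounds both their `L²` norm and
  -- that of their second derivative.
  set Dq : ℕ → H2 a b := fun n => conv (deriv (qfun α)) ω (n * τ)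
    - ∑ j ∈ Finset.Icc 1 n, wq n j • ω (j * τ) with hDq
  set Db : ℕ → H2 a b := fun n => conv (beta (α 0)) ω (n * τ)
    - ∑ j ∈ Finset.Icc 1 n, wb n j • ω (j * τ) with hDb
  set c : ℝ := 1 / 2 * σ ^ 2 with hc
  have hc0 : 0 ≤ c := by positivity
  -- Inserting `ξ = ω - η - W` and subtracting the scheme from the equation leaves minus the
  -- projection errors and defects. No gradient of `η` remains, thanks to the Ritz property.
  refine ⟨fun n => -(η n + ∑ j ∈ Finset.Icc 1 n, wq n j • η j
    + lam σ r • ∑ j ∈ Finset.Icc 1 n, wb n j • η j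
    + toL2 (Dq n) + lam σ r • toL2 (Db n) - c • dxx (Db n)), ?_, ?_⟩
  · intro n hn v hv
    have ht : (n : ℝ) * τ ∈ Icc 0 T := ⟨(hnpos n hn).le, hnT n hn⟩
    have hvm := P.memLp_of_mem_femSpace hv
    have hvd := P.memLp_deriv_of_mem_femSpace hv
    have hWm : ∀ j ∈ Finset.Icc 1 n, W j ∈ P.femSpace := fun j hj => hW.mem j (hsub n hn j hj)
    have hzm : ∀ j ∈ Finset.Icc 1 n, z j ∈ P.femSpace := fun j hj => hz j (hsub n hn j hj)
    have hnn : n ∈ Finset.Icc 1 n := Finset.mem_Icc.2 ⟨(Finset.mem_Icc.1 hn).1, le_rfl⟩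
    have scheme := hW.scheme n hn v hv
    have hWL : ∀ j ∈ Finset.Icc 1 n, MemLp (W j) 2 (volume.restrict (Ioo a b)) :=
      fun j hj => P.memLp_of_mem_femSpace (hWm j hj)
    have hWL' : ∀ j ∈ Finset.Icc 1 n, MemLp (deriv (W j)) 2 (volume.restrict (Ioo a b)) :=
      fun j hj => P.memLp_deriv_of_mem_femSpace (hWm j hj)
    rw [l2Inner_eq_inner (hWL n hnn) hvm, l2Inner_eq_inner (memLp_sum_smul _ _ hWL) hvm,
      l2Inner_eq_inner (memLp_sum_smul _ _ hWL) hvm,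
      l2Inner_eq_inner (memLp_sum_smul _ _ hWL') hvd, mkL2_sum_smul _ _ hWL, mkL2_sum_smul _ _ hWL,
      mkL2_sum_smul _ _ hWL', l2Inner_coe_left _ hvm] at scheme
    have pde := hsol.equation (n * τ) ⟨hnpos n hn, hnT n hn⟩
    have cq : conv (deriv (qfun α)) (fun s => toL2 (ω s)) (n * τ)
        = toL2 (Dq n) + ∑ j ∈ Finset.Icc 1 n, wq n j • toL2 (ω (j * τ)) := by
      have e := conv_clm (toL2CLM a b) ht hqi hωc
      simp only [toL2CLM_apply] at e
      rw [e, ← sub_eq_iff_eq_add, hDq]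
      simp only [← toL2CLM_apply, map_sub, map_sum, map_smul]
    have cb : conv (beta (α 0)) (fun s => toL2 (ω s)) (n * τ)
        = toL2 (Db n) + ∑ j ∈ Finset.Icc 1 n, wb n j • toL2 (ω (j * τ)) := by
      have e := conv_clm (toL2CLM a b) ht hβi hωc
      simp only [toL2CLM_apply] at e
      rw [e, ← sub_eq_iff_eq_add, hDb]
      simp only [← toL2CLM_apply, map_sub, map_sum, map_smul]
    have cd : conv (beta (α 0)) (fun s => dxx (ω s)) (n * τ)
        = dxx (Db n) + ∑ j ∈ Finset.Icc 1 n, wb n j • dxx (ω (j * τ)) := by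
      have e := conv_clm (dxxCLM a b) ht hβi hωc
      simp only [dxxCLM_apply] at e
      rw [e, ← sub_eq_iff_eq_add, hDb]
      simp only [← dxxCLM_apply, map_sub, map_sum, map_smul]
    rw [cq, cb, cd] at pde
    have ritz : inner ℝ (∑ j ∈ Finset.Icc 1 n, wb n j • mkL2 a b (deriv (z j)))
        (mkL2 a b (deriv v))
        = -inner ℝ (∑ j ∈ Finset.Icc 1 n, wb n j • dxx (ω (j * τ))) (mkL2 a b v) := by
      rw [sum_inner, sum_inner, ← Finset.sum_neg_distrib]
      refine Finset.sum_congr rfl fun j hj => ?_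
      rw [real_inner_smul_left, real_inner_smul_left, hR j (hsub n hn j hj) v hv]
      ring
    have split : ∀ w : ℕ → ℕ → ℝ, ∑ j ∈ Finset.Icc 1 n, w n j • mkL2 a b (z j - W j)
        = ∑ j ∈ Finset.Icc 1 n, w n j • toL2 (ω (j * τ)) - ∑ j ∈ Finset.Icc 1 n, w n j • η j
          - ∑ j ∈ Finset.Icc 1 n, w n j • mkL2 a b (W j) := by
      intro w
      rw [← Finset.sum_sub_distrib, ← Finset.sum_sub_distrib]
      refine Finset.sum_congr rfl fun j hj => ?_
      rw [mkL2_sub (P.memLp_of_mem_femSpace (hzm j hj)) (hWL j hj), hηdef]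
      module
    have splitd : ∑ j ∈ Finset.Icc 1 n, wb n j • mkL2 a b (deriv (z j - W j))
        = ∑ j ∈ Finset.Icc 1 n, wb n j • mkL2 a b (deriv (z j))
          - ∑ j ∈ Finset.Icc 1 n, wb n j • mkL2 a b (deriv (W j)) := by
      rw [← Finset.sum_sub_distrib]
      refine Finset.sum_congr rfl fun j hj => ?_
      rw [deriv_sub_ae_eq P (hzm j hj) (hWm j hj), smul_sub]
    have pn : mkL2 a b (z n - W n) = toL2 (ω (n * τ)) - η n - mkL2 a b (W n) := by
      rw [mkL2_sub (P.memLp_of_mem_femSpace (hzm n hnn)) (hWL n hnn)]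
      simp only [hηdef, sub_sub_cancel]
    rw [split wq, split wb, splitd, pn]
    rw [← hτdef, ← hwq, ← hwb, ← hc, ← pde] at scheme
    simp only [inner_sub_left, inner_add_left, inner_neg_left, real_inner_smul_left] at scheme ⊢
    rw [ritz]
    linear_combination -scheme
  · intro n hn
    have hnτ := hnT n hn
    have hn1 := (Finset.mem_Icc.1 hn).1
    have hη' : ∀ j ∈ Finset.Icc 1 n, ‖η j‖ ≤ H := fun j hj => hη j (hsub n hn j hj)
    have b1 := hη n hn
    have b2 := norm_sum_weight_smul_le ha0 hT.le hτ hC hH hqi hq hnτ hη'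
    have b3 := norm_sum_weight_smul_le ha0 hT.le hτ zero_le_one hH hβi hβ1 hnτ hη'
    have b4 := norm_conv_sub_sum_weight_le hω ha0 ha1 hK.le hqi hq hτ hn1 hnτ
    have b5 := norm_conv_sub_sum_weight_le hω ha0 ha1 hK.le hβi hβ1 hτ hn1 hnτ
    have b6 := (norm_toL2_le (Dq n)).trans b4
    have b7 := (norm_toL2_le (Db n)).trans b5
    have b8 := (norm_dxx_le (Db n)).trans b5
    rw [norm_neg]
    have tri : ‖η n + ∑ j ∈ Finset.Icc 1 n, wq n j • η j
        + lam σ r • ∑ j ∈ Finset.Icc 1 n, wb n j • η j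
        + toL2 (Dq n) + lam σ r • toL2 (Db n) - c • dxx (Db n)‖
        ≤ ‖η n‖ + ‖∑ j ∈ Finset.Icc 1 n, wq n j • η j‖
          + lam σ r * ‖∑ j ∈ Finset.Icc 1 n, wb n j • η j‖ + ‖toL2 (Dq n)‖
          + lam σ r * ‖toL2 (Db n)‖ + c * ‖dxx (Db n)‖ := by
      refine (norm_sub_le _ _).trans ?_
      rw [norm_smul, Real.norm_of_nonneg hc0]
      gcongr
      refine (norm_add_le _ _).trans ?_
      rw [norm_smul, Real.norm_of_nonneg hl]
      gcongr
      refine (norm_add_le _ _).trans ?_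
      gcongr
      refine (norm_add_le _ _).trans ?_
      rw [norm_smul, Real.norm_of_nonneg hl]
      gcongr
      exact norm_add_le _ _
    have m3 := mul_le_mul_of_nonneg_left b3 hl
    have m7 := mul_le_mul_of_nonneg_left b7 hl
    have m8 := mul_le_mul_of_nonneg_left b8 hc0
    refine (tri.trans (add_le_add (add_le_add (add_le_add (add_le_add (add_le_add b1 b2) m3) b6)
      m7) m8)).trans (le_of_eq ?_)
    ring

/-! ### Assembly of the error estimate -/

theorem sq_le_of_le_add {x p q : ℝ} (hx : 0 ≤ x) (h : x ≤ p + q) :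
    x ^ 2 ≤ 2 * p ^ 2 + 2 * q ^ 2 := by
  nlinarith [sq_nonneg (p - q), pow_le_pow_left₀ hx h 2]

theorem sqrt_le_mul_add {X A B h e : ℝ} (hA : 0 ≤ A) (hB : 0 ≤ B) (hh : 0 ≤ h) (he : 0 ≤ e)
    (hX : X ≤ A * h ^ 2 + B * e ^ 2) : √X ≤ (A + B + 1) * (e + h) := by
  refine Real.sqrt_le_iff.2 ⟨by positivity, hX.trans ?_⟩
  calc A * h ^ 2 + B * e ^ 2 ≤ A * (e + h) ^ 2 + B * (e + h) ^ 2 := by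
        gcongr <;> linarith
    _ = (A + B) * (e + h) ^ 2 := by ring
    _ ≤ (A + B + 1) ^ 2 * (e + h) ^ 2 := by
        gcongr
        nlinarith
    _ = _ := by ring

theorem theorem4p1 (a b T σ r : ℝ) (hab : a < b) (hT : 0 < T) (hσ : 0 < σ) (hr : 0 ≤ r)
    (α : ℝ → ℝ) (hα : AdmissibleExponent T α) (K : ℝ) (hK : 0 < K) (ρ : ℝ) (hρ : 1 ≤ ρ) :
    ∃ C : ℝ, 0 < C ∧ ∃ τ₀ : ℝ, 0 < τ₀ ∧ ∀ (F : ℝ → L2 a b) (ω : ℝ → H2 a b),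
      IsSolution a b T σ r α F ω → RegularityBound T (α 0) K ω →
      ∀ (N : ℕ), 1 ≤ N → T / N ≤ τ₀ →
      ∀ (P : Mesh a b), P.QuasiUniform ρ →
      ∀ (W : ℕ → ℝ → ℝ), IsDiscreteSolution T σ r α F N P W →
        Real.sqrt (T / N * ∑ n ∈ Finset.Icc 1 N,
            l2Norm a b (fun x => toL2 (ω (n * (T / N))) x - W n x) ^ 2)
          ≤ C * ((T / N) ^ (1 / 2 + 3 / 2 * α 0) + P.diam ^ 2) := by
  obtain ⟨ha0, ha1⟩ := hα.zero_mem hT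
  obtain ⟨Q, hQ0, hQ⟩ := exists_abs_deriv_qfun_le hT hα
  have hG := Real.Gamma_pos_of_pos ha0
  have hl : 0 ≤ lam σ r := by unfold lam; positivity
  set B := T ^ α 0 / (α 0 * Real.Gamma (α 0)) with hB
  have hB0 : 0 ≤ B := by positivity
  obtain ⟨κ, hκ, hκQ⟩ := exists_decay_rate ha0 hQ0 hB0
  set J := ∫ u in (0 : ℝ)..1, (1 - u) ^ (α 0 - 1) * u ^ ((1 - (1 + α 0) / 2) - 1) with hJ
  have hJ0 : 0 ≤ J := intervalIntegral.integral_nonneg zero_le_one fun u hu =>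
    mul_nonneg (Real.rpow_nonneg (by linarith [hu.2]) _) (Real.rpow_nonneg hu.1 _)
  set R := K / α 0 * T ^ α 0 with hR
  have hR0 : 0 ≤ R := by positivity
  set p₁ := (1 + (Q + lam σ r) * B) * (2 * R) with hp₁
  set p₂ := (Q + lam σ r + 1 / 2 * σ ^ 2) * ((8 * K + 2 * K / α 0) * (J / Real.Gamma (α 0)))
    with hp₂
  set E := 4 * Real.exp (κ * T) with hE
  have hE0 : 0 ≤ E := by positivity
  -- `C₁` collects the projection error, once directly and once through the stability estimate. `C₂`
  -- collects the quadrature defects, with `T ^ α 0 / α 0` bounding the Riemann sum of `t ^ (α 0 -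
  -- 1)`.
  set C₁ := 2 * T * (2 * R) ^ 2 + 2 * E * (2 * p₁ ^ 2 * T) with hC₁
  set C₂ := 2 * E * (2 * p₂ ^ 2 * (T ^ α 0 / α 0)) with hC₂
  have hC₁0 : 0 ≤ C₁ := by positivity
  have hC₂0 : 0 ≤ C₂ := by positivity
  refine ⟨C₁ + C₂ + 1, by positivity, 1 / κ, by positivity, ?_⟩
  intro F ω hsol hreg N hN hτκ P _ W hW
  obtain ⟨ω₁, ω₂, hd₁, hd₂, -, hbd⟩ := hreg
  have hω : SingularAtZero T (α 0) K ω ω₁ ω₂ := ⟨hsol.initial, hd₁, hd₂, hbd⟩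
  have hN0 : (0 : ℝ) < N := by exact_mod_cast hN
  set τ := T / N with hτdef
  have hτ : 0 < τ := by positivity
  have hNτ : N * τ = T := by rw [hτdef]; field_simp
  have ht : ∀ n ∈ Finset.Icc 1 N, (n : ℝ) * τ ∈ Icc 0 T := fun n hn => by
    refine ⟨by positivity, ?_⟩
    rw [← hNτ]
    exact mul_le_mul_of_nonneg_right (by exact_mod_cast (Finset.mem_Icc.1 hn).2) hτ.le
  have hωR : ∀ n ∈ Finset.Icc 1 N, ‖ω (n * τ)‖ ≤ R := fun n hn => by
    refine (hω.norm_le ha0 (ht n hn)).trans (mul_le_mul_of_nonneg_left ?_ (by positivity))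
    exact Real.rpow_le_rpow (ht n hn).1 (ht n hn).2 ha0.le
  -- The membership condition is placed inside the existential so that a sequence on all of `ℕ` can
  -- be chosen; outside `1, …, N` the value is an irrelevant `0`.
  have ritz : ∀ n : ℕ, ∃ z : ℝ → ℝ, n ∈ Finset.Icc 1 N → z ∈ P.femSpace ∧
      ‖toL2 (ω (n * τ)) - mkL2 a b z‖ ≤ 2 * P.diam ^ 2 * R ∧
      ∀ v ∈ P.femSpace, inner ℝ (mkL2 a b (deriv z)) (mkL2 a b (deriv v))
        = -inner ℝ (dxx (ω (n * τ))) (mkL2 a b v) := by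
    intro n
    by_cases hn : n ∈ Finset.Icc 1 N
    · obtain ⟨z, hz, hz1, hz2⟩ := exists_ritz hab P (hsol.boundary _ (ht n hn))
      exact ⟨z, fun _ => ⟨hz, hz1.trans (mul_le_mul_of_nonneg_left (hωR n hn) (by positivity)),
        hz2⟩⟩
    · exact ⟨0, fun h => absurd h hn⟩
  choose z hz using ritz
  obtain ⟨δ, hδeq, hδ⟩ := exists_error_equation hT hα hK hQ0 hQ hsol hω hN hW
    (H := 2 * P.diam ^ 2 * R) (by positivity) (fun n hn => (hz n hn).1)
    (fun n hn => (hz n hn).2.1) (fun n hn => (hz n hn).2.2)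
  have stab := sum_norm_sq_le_of_scheme ha0 ha1.le hT.le hQ0
    (intervalIntegrable_of_abs_le_beta ha0 hT.le (measurable_deriv _) hQ) hQ hκ hκQ hτ hτκ hl
    (by positivity : 0 ≤ 1 / 2 * σ ^ 2) hNτ (fun n => mkL2 a b (z n - W n))
    (fun n => mkL2 a b (deriv (z n - W n))) δ
    (fun n hn => hδeq n hn _ (P.sub_mem_femSpace (hz n hn).1 (hW.mem n hn)))
  have hsumt := sum_mul_rpow_le ha0 ha1.le hτ N
  rw [hNτ] at hsumt
  have hδsq : ∀ n ∈ Finset.Icc 1 N, ‖δ n‖ ^ 2 ≤ 2 * p₁ ^ 2 * (P.diam ^ 2) ^ 2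
      + 2 * p₂ ^ 2 * (τ ^ ((1 + 3 * α 0) / 2)) ^ 2 * (n * τ) ^ (α 0 - 1) := by
    intro n hn
    have e : ((n * τ) ^ ((α 0 - 1) / 2)) ^ 2 = (n * τ) ^ (α 0 - 1) := by
      rw [← Real.rpow_natCast, ← Real.rpow_mul (ht n hn).1]
      norm_num
    have h1 : ‖δ n‖ ≤ p₁ * P.diam ^ 2
        + p₂ * (τ ^ ((1 + 3 * α 0) / 2) * (n * τ) ^ ((α 0 - 1) / 2)) :=
      (hδ n hn).trans (le_of_eq (by rw [hp₁, hp₂]; ring))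
    rw [← e]
    exact (sq_le_of_le_add (norm_nonneg _) h1).trans (le_of_eq (by ring))
  have hδsum : τ * ∑ n ∈ Finset.Icc 1 N, ‖δ n‖ ^ 2 ≤ 2 * p₁ ^ 2 * T * (P.diam ^ 2) ^ 2
      + 2 * p₂ ^ 2 * (T ^ α 0 / α 0) * (τ ^ ((1 + 3 * α 0) / 2)) ^ 2 := by
    have h1 := mul_le_mul_of_nonneg_left (Finset.sum_le_sum hδsq) hτ.le
    rw [Finset.sum_add_distrib, Finset.sum_const, ← Finset.mul_sum, Nat.card_Icc,
      Nat.add_sub_cancel, nsmul_eq_mul] at h1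
    have h2 := mul_le_mul_of_nonneg_left hsumt
      (by positivity : 0 ≤ 2 * p₂ ^ 2 * (τ ^ ((1 + 3 * α 0) / 2)) ^ 2)
    rw [← hNτ] at h2 ⊢
    linarith
  have herr : ∀ n ∈ Finset.Icc 1 N, l2Norm a b (fun x => toL2 (ω (n * τ)) x - W n x) ^ 2
      ≤ 2 * (2 * P.diam ^ 2 * R) ^ 2 + 2 * ‖mkL2 a b (z n - W n)‖ ^ 2 := by
    intro n hn
    have hWL := P.memLp_of_mem_femSpace (hW.mem n hn)
    rw [l2Norm_sub_sq _ hWL, mkL2_sub (P.memLp_of_mem_femSpace (hz n hn).1) hWL]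
    refine sq_le_of_le_add (norm_nonneg _) ((norm_sub_le_norm_sub_add_norm_sub _ _ _).trans
      (add_le_add (hz n hn).2.1 le_rfl))
  have total : τ * ∑ n ∈ Finset.Icc 1 N, l2Norm a b (fun x => toL2 (ω (n * τ)) x - W n x) ^ 2
      ≤ C₁ * (P.diam ^ 2) ^ 2 + C₂ * (τ ^ ((1 + 3 * α 0) / 2)) ^ 2 := by
    have h1 := mul_le_mul_of_nonneg_left (Finset.sum_le_sum herr) hτ.le
    rw [Finset.sum_add_distrib, Finset.sum_const, ← Finset.mul_sum, Nat.card_Icc,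
      Nat.add_sub_cancel, nsmul_eq_mul] at h1
    have h2 := mul_le_mul_of_nonneg_left stab (by positivity : 0 ≤ 2 * τ)
    have h3 := mul_le_mul_of_nonneg_left hδsum (by positivity : 0 ≤ 2 * E)
    calc _ ≤ _ := h1
      _ = 2 * (N * τ) * (2 * R) ^ 2 * (P.diam ^ 2) ^ 2
          + 2 * τ * ∑ n ∈ Finset.Icc 1 N, ‖mkL2 a b (z n - W n)‖ ^ 2 := by ring
      _ ≤ 2 * (N * τ) * (2 * R) ^ 2 * (P.diam ^ 2) ^ 2
          + 2 * E * (2 * p₁ ^ 2 * T * (P.diam ^ 2) ^ 2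
          + 2 * p₂ ^ 2 * (T ^ α 0 / α 0) * (τ ^ ((1 + 3 * α 0) / 2)) ^ 2) := by linarith
      _ = _ := by rw [hNτ, hC₁, hC₂]; ring
  have hexp : (1 : ℝ) / 2 + 3 / 2 * α 0 = (1 + 3 * α 0) / 2 := by ring
  rw [hexp]
  have he : 0 ≤ τ ^ ((1 + 3 * α 0) / 2) := by positivity
  have hh : 0 ≤ P.diam ^ 2 := by positivity
  exact sqrt_le_mul_add hC₁0 hC₂0 hh he total
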